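/- Let $M$ be a smooth manifold with a smooth action of a Lie group $H$ with Lie algebra $\mathfrak h$ (for instance $M$ and $H$ compact). Let $E\subset TM$ be a smooth distribution whose annihilator $E^0\subset T^*M$ is oriented, of rank $k$; suppose that $H$ preserves $E$ and the orientation of $E^0$, and that the action is transverse to $E$, i.e. $E+\mathfrak h_M=TM$, where $\mathfrak h_M$ is the set of vectors tangent to the $H$-orbits. Let $\imath:E^0\to T^*M$ be the inclusion, $q:E^0\to M$ the projection, $q_*$ integration over the oriented fibres of $q$, and let $\theta$ be the canonical $1$-form on $T^*M$. Let $X_{T^*M}$ denote the fundamental vector field of $X\in\mathfrak h$, let $D\theta(X)=d\theta-\iota(X_{T^*M})\theta$, and let $f_\theta:T^*M\to\mathfrak h^*$, $\langle f_\theta,X\rangle=-\theta(X_{T^*M})$, be the moment map. An equivariant differential form with generalized coefficients on $M$ is a continuous linear map $\phi\mapsto\int_{\mathfrak h}\alpha(X)\phi(X)\,dX$ from $C_c^\infty(\mathfrak h)$ to smooth complex differential forms on $M$ such that $g^*\alpha(\mathrm{Ad}_gX)=\alpha(X)$ for $g\in H$. Fibre integrals are understood as oscillatory integrals: one first pairs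 with a test function $\phi$ on $\mathfrak h$ and then integrates over the fibres of $E^0$. Put $$\mathcal J(E,X)=(2\pi i)^{-k}\,q_*\imath^*e^{iD\theta(X)} .$$ Let $\chi\in C^\infty(T^*M)$ be an $H$-invariant function which is equal to $1$ in a neighbourhood of $f_\theta^{-1}(0)$ and for which $q:\operatorname{supp}\chi\cap E^0\to M$ is proper (if $M$ is compact: $\operatorname{supp}\chi\cap E^0$ is compact), and put $$P_\theta(X)=\chi+d\chi\wedge\beta(\theta)(X),\qquad \beta(\theta)(X)=-i\,\theta\int_0^\infty e^{itD\theta(X)}\,dt ,$$ where $\beta(\theta)$ is a form with generalized coefficients on $T^*M\setminus f_\theta^{-1}(0)$ (after pairing with a test function, the integral over $t$ converges absolutely at every point of this set). Then, for every such $\chi$ and every test function, the fibre integrals $q_*\imath^*P_\theta$ and $q_*\imath^*e^{iD\theta}$ converge absolutely, they define equivariant differential forms with generalized coefficients on $M$ (and so does $\mathcal J(E,X)$), and $$q_*\imath^*P_\theta(X)=(2\pi i)^k\mathcal J(E,X)=q_*\imath^*e^{iD\theta(X)} .$$ -/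

import Mathlib

open scoped Manifold ContDiff Topology Distributions Bundle
open MeasureTheory

noncomputable section

namespace EqForm

/-! ### Pointwise exterior algebra

An inhomogeneous complex valued exterior form on a real vector space `T` is recorded by its
components: the component of degree `p` is a function of `p` vectors. The operations below are given
by the usual formulas; that the forms which matter are multilinear and alternating is part of
`IsSmoothForm`. -/

/-- Inhomogeneous complex valued forms (as functions of tuples of vectors, one for each degree). -/
abbrev PreForm (T : Type*) := ∀ p : ℕ, (Fin p → T) → ℂ

/-- The exterior product, in degree `r`:
`∑_{p + q = r} 1 / (p! q!) ∑_σ sign(σ) a(v_{σ 0}, …, v_{σ (p-1)}) b(v_{σ p}, …, v_{σ (r-1)})`. -/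
def wedge {T : Type*} (a b : PreForm T) : PreForm T := fun r v =>
  ∑ p : Fin (r + 1), (1 / ((p.1.factorial : ℂ) * ((r - p.1).factorial : ℂ))) *
    ∑ σ : Equiv.Perm (Fin r), ((Equiv.Perm.sign σ : ℤ) : ℂ) *
      (a p.1 (fun i => v (σ ⟨i.1, by omega⟩)) *
        b (r - p.1) (fun j => v (σ ⟨p.1 + j.1, by omega⟩)))

/-- A number as a form of degree `0`. -/
def scalarForm {T : Type*} (c : ℂ) : PreForm T := fun p _ => if p = 0 then c else 0

/-- Exterior powers `a ∧ ⋯ ∧ a`. -/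
def wedgePow {T : Type*} (a : PreForm T) : ℕ → PreForm T
  | 0 => scalarForm 1
  | n + 1 => wedge a (wedgePow a n)

/-- The part of positive degree. -/
def positivePart {T : Type*} (a : PreForm T) : PreForm T := fun p v => if p = 0 then 0 else a p v

/-- The exponential `exp (a₀ + a₊) = exp (a₀) ∑ⱼ (a₊)ʲ / j!` of a form `a` of even degrees, where
`a₀` is the component of degree `0` and `a₊` the (nilpotent) part of positive degree. In degree `p`
the terms with `j > p` vanish. -/
def expForm {T : Type*} (a : PreForm T) : PreForm T := fun p v =>
  Complex.exp (a 0 Fin.elim0) *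
    ∑ j ∈ Finset.range (p + 1), (1 / (j.factorial : ℂ)) * wedgePow (positivePart a) j p v

/-- The contraction `ι(Y) a`. -/
def contract {T : Type*} (Y : T) (a : PreForm T) : PreForm T := fun p v =>
  a (p + 1) (Fin.cons Y v)

/-! ### Forms on manifolds -/

section Manifold

variable {E : Type*} [NormedAddCommGroup E] [NormedSpace ℝ E]
  {B : Type*} [TopologicalSpace B] (I : ModelWithCorners ℝ E B)
  {N : Type*} [TopologicalSpace N] [ChartedSpace B N]
  {E' : Type*} [NormedAddCommGroup E'] [NormedSpace ℝ E']
  {B' : Type*} [TopologicalSpace B'] (I' : ModelWithCorners ℝ E' B')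
  {N' : Type*} [TopologicalSpace N'] [ChartedSpace B' N']

/-- (Not necessarily smooth) inhomogeneous complex differential forms on a manifold `N`. -/
abbrev Form (N : Type*) [TopologicalSpace N] [ChartedSpace B N] :=
  ∀ x : N, PreForm (TangentSpace I x)

/-- A function as a form of degree `0`. -/
def ofFun (f : N → ℂ) : Form I N := fun x => scalarForm (f x)

/-- A real `1`-form as a form of degree `1`. -/
def ofOneForm (lam : ∀ x : N, TangentSpace I x →L[ℝ] ℝ) : Form I N := fun x p v =>
  match p, v with
  | 1, v => ((lam x (v 0) : ℝ) : ℂ)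
  | _, _ => 0

/-- The pullback `f^* η`. -/
def pullback (f : N → N') (η : Form I' N') : Form I N := fun x p v =>
  η (f x) p (fun i => mfderiv I I' f x (v i))

/-- The expression of a form in the chart around `x₀`: its pullback to the model vector space by the
inverse of the chart. -/
def inChart (η : Form I N) (x₀ : N) (y : E) : PreForm E := fun p u =>
  η ((extChartAt I x₀).symm y) p (fun i => mfderiv 𝓘(ℝ, E) I (extChartAt I x₀).symm y (u i))

/-- The exterior derivative, computed at `x` in the chart around `x`:
`dη (v₀, …, v_p) = ∑ᵢ (-1)ⁱ ∂_{vᵢ} η (v₀, …, v̂ᵢ, …, v_p)`. -/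
def extD (η : Form I N) : Form I N := fun x p v =>
  match p, v with
  | 0, _ => 0
  | p + 1, v =>
    let w : Fin (p + 1) → E := fun i => mfderiv I 𝓘(ℝ, E) (extChartAt I x) x (v i)
    ∑ i : Fin (p + 1), (-1 : ℂ) ^ (i : ℕ) *
      fderiv ℝ (fun y => inChart I η x y p (fun j => w (i.succAbove j))) (extChartAt I x x) (w i)

/-- Smooth differential forms: at each point every component is multilinear and alternating, and in
each chart the coefficients are smooth. -/
def IsSmoothForm (η : Form I N) : Prop :=
  (∀ (x : N) (p : ℕ), ∃ a : (TangentSpace I x) [⋀^Fin p]→ₗ[ℝ] ℂ, ∀ v, η x p v = a v) ∧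
  ∀ (x₀ : N) (p : ℕ) (u : Fin p → E),
    ContDiffOn ℝ ∞ (fun y => inChart I η x₀ y p u) (extChartAt I x₀).target

end Manifold

/-! ### Equivariant forms

`H` is a Lie group modelled on `W`; its Lie algebra is the tangent space at `1`, whose underlying
vector space is `W`. -/

section Equivariant

variable {W : Type*} [NormedAddCommGroup W] [NormedSpace ℝ W]
  {H : Type*} [Group H] [TopologicalSpace H] [ChartedSpace W H]
  {E : Type*} [NormedAddCommGroup E] [NormedSpace ℝ E]
  {B : Type*} [TopologicalSpace B] (I : ModelWithCorners ℝ E B)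
  {N : Type*} [TopologicalSpace N] [ChartedSpace B N]

/-- The fundamental vector field `X_N` generated by `X` for the action `act` of `H` on `N`, that is
`X_N (x) = d/dt exp(tX) x` at `t = 0`, as a linear function of `X`. -/
def fundamental (act : H → N → N) (x : N) : W →L[ℝ] TangentSpace I x :=
  (mfderiv 𝓘(ℝ, W) I (fun g => act g x) (1 : H) : W →L[ℝ] E)

/-- The adjoint action of `H` on its Lie algebra. -/
def Ad (g : H) : W →L[ℝ] W :=
  (mfderiv 𝓘(ℝ, W) 𝓘(ℝ, W) (fun h : H => g * h * g⁻¹) (1 : H) : W →L[ℝ] W)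

/-- The equivariant differential `(Dα)(X) = d(α(X)) - ι(X_N) α(X)`. -/
def equivD (act : H → N → N) (α : W → Form I N) : W → Form I N := fun X x =>
  extD I (α X) x - contract (fundamental I act x X) (α X x)

/-- `Dλ(X)` for a real `1`-form `λ` (which does not depend on `X`). -/
def equivDOne (act : H → N → N) (lam : ∀ x : N, TangentSpace I x →L[ℝ] ℝ) : W → Form I N :=
  equivD I act (fun _ => ofOneForm I lam)

/-- The `λ`-moment map `⟨f_λ(x), X⟩ = - ⟨λ, X_N⟩(x)`. -/
def momentMap (act : H → N → N) (lam : ∀ x : N, TangentSpace I x →L[ℝ] ℝ) (x : N) : W →L[ℝ] ℝ :=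
  -((lam x).comp (fundamental I act x))

/-- The form `e^{itDλ(X)}`. -/
def expD (act : H → N → N) (lam : ∀ x : N, TangentSpace I x →L[ℝ] ℝ) (t : ℝ) : W → Form I N :=
  fun X x => expForm ((Complex.I * (t : ℂ)) • equivDOne I act lam X x)

variable [MeasurableSpace W] (μ : Measure W)

/-- The pairing `∫ α(X) φ(X) dX` of a family of forms with a test function. -/
def pairing (α : W → Form I N) (φ : 𝓓((⊤ : TopologicalSpace.Opens W), ℂ)) : Form I N :=
  fun x p v => ∫ X, φ X * α X x p v ∂μ

/-- The pairing with a test function of `β(λ)(X) = -i λ ∧ ∫₀^∞ e^{itDλ(X)} dt`: one integrates over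
`X` first, which gives a rapidly decreasing function of `t` away from the zeros of the moment map.
(At the zeros of the moment map the value is irrelevant.) -/
def betaForm (act : H → N → N) (lam : ∀ x : N, TangentSpace I x →L[ℝ] ℝ)
    (φ : 𝓓((⊤ : TopologicalSpace.Opens W), ℂ)) : Form I N := fun x =>
  wedge ((-Complex.I) • ofOneForm I lam x)
    (fun p v => ∫ t in Set.Ioi (0 : ℝ), pairing I μ (expD I act lam t) φ x p v)

/-- The pairing with a test function of the form `P_λ(X) = χ + dχ ∧ β(λ)(X)`. -/
def paradanForm (act : H → N → N) (lam : ∀ x : N, TangentSpace I x →L[ℝ] ℝ) (χ : N → ℝ)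
    (φ : 𝓓((⊤ : TopologicalSpace.Opens W), ℂ)) : Form I N := fun x =>
  (∫ X, φ X ∂μ) • ofFun I (fun y => (χ y : ℂ)) x +
    wedge (extD I (ofFun I (fun y => (χ y : ℂ))) x) (betaForm I μ act lam φ x)

/-- `A` (a map from test functions on the Lie algebra to forms on `N`) is an equivariant
differential form with generalized coefficients: a linear and continuous map from test functions to
smooth forms, with `g^* (α (Ad_g X)) = α (X)`. The continuity is expressed by the seminorms of the
two sides: uniform norms of derivatives of `φ` with support in a fixed compact set, and uniform norms
over compact sets of derivatives of the coefficients in charts. -/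
structure IsEquivGenForm (act : H → N → N)
    (A : 𝓓((⊤ : TopologicalSpace.Opens W), ℂ) → Form I N) : Prop where
  smooth : ∀ φ, IsSmoothForm I (A φ)
  map_add : ∀ φ ψ, A (φ + ψ) = A φ + A ψ
  map_smul : ∀ (c : ℂ) φ, A (c • φ) = c • A φ
  continuous : ∀ (K : Set W), IsCompact K → ∀ (x₀ : N) (L : Set E), IsCompact L →
    L ⊆ (extChartAt I x₀).target → ∀ (p : ℕ) (u : Fin p → E) (n : ℕ), ∃ (m : ℕ) (C : ℝ),
      ∀ φ : 𝓓((⊤ : TopologicalSpace.Opens W), ℂ), tsupport φ ⊆ K →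
      ∀ b : ℝ, (∀ j ≤ m, ∀ X, ‖iteratedFDeriv ℝ j φ X‖ ≤ b) →
      ∀ y ∈ L, ‖iteratedFDeriv ℝ n (fun z => inChart I (A φ) x₀ z p u) y‖ ≤ C * b
  equivariant : ∀ (g : H) (φ ψ : 𝓓((⊤ : TopologicalSpace.Opens W), ℂ)),
    (∀ X, ψ (Ad g X) = φ X) →
      pullback I I (act g) (A ψ) = ((|(Ad g : W →L[ℝ] W).det| : ℝ) : ℂ) • A φ

end Equivariant

/-! ### The cotangent bundle and its canonical form -/

section Cotangent

variable {V : Type*} [NormedAddCommGroup V] [NormedSpace ℝ V]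
  (M : Type*) [TopologicalSpace M] [ChartedSpace V M]

/-- The cotangent spaces. -/
abbrev CoFibre (m : M) : Type _ := TangentSpace 𝓘(ℝ, V) m →L[ℝ] Bundle.Trivial M ℝ m

variable [IsManifold 𝓘(ℝ, V) ∞ M]

/-- The total space of the cotangent bundle, with Mathlib's topology and manifold structure. -/
abbrev Cotangent : Type _ := Bundle.TotalSpace (V →L[ℝ] ℝ) (CoFibre (V := V) M)

/-- The model with corners of the cotangent bundle. -/
abbrev ModelT (V : Type*) [NormedAddCommGroup V] [NormedSpace ℝ V] :=
  (𝓘(ℝ, V)).prod 𝓘(ℝ, V →L[ℝ] ℝ)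

variable {M}

/-- The canonical `1`-form `θ_ξ(w) = ξ(π_* w)`. -/
def canonicalForm (ξ : Cotangent (V := V) M) : TangentSpace (ModelT V) ξ →L[ℝ] ℝ :=
  (show TangentSpace 𝓘(ℝ, V) ξ.proj →L[ℝ] ℝ from ξ.2).comp
    (mfderiv (ModelT V) 𝓘(ℝ, V) (Bundle.TotalSpace.proj : Cotangent (V := V) M → M) ξ)

variable {H : Type*} [Group H] [MulAction H M]

/-- The action of `g` on covectors at `m`: `ξ ↦ ξ ∘ (T_m g)⁻¹`. -/
def coAct (g : H) {m : M} (ξ : CoFibre (V := V) M m) : CoFibre (V := V) M (g • m) :=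
  (show V →L[ℝ] ℝ from ξ).comp
    (show V →L[ℝ] V from mfderiv 𝓘(ℝ, V) 𝓘(ℝ, V) (fun x : M => g⁻¹ • x) (g • m))

/-- The cotangent lift of the action. -/
def cotangentLift (g : H) (ξ : Cotangent (V := V) M) : Cotangent (V := V) M :=
  ⟨g • ξ.proj, coAct g ξ.2⟩

end Cotangent

/-! ### Co-oriented distributions and integration over the fibres of the annihilator -/

section Distribution

variable {V : Type*} [NormedAddCommGroup V] [NormedSpace ℝ V]
  {M : Type*} [TopologicalSpace M] [ChartedSpace V M]

/-- The fibre at `m` of the annihilator `E⁰ ⊆ T^*M`: the covectors at `m` which vanish on `E m`.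
(The vector space underlying the tangent space at `m` is `V`.) -/
def annihilator (E : ∀ m : M, Submodule ℝ (TangentSpace 𝓘(ℝ, V) m)) (m : M) :
    Submodule ℝ (V →L[ℝ] ℝ) where
  carrier := {ξ | ∀ v ∈ E m, ξ v = 0}
  add_mem' := by
    intro a b ha hb v hv
    have h1 : a v = 0 := ha v hv
    have h2 : b v = 0 := hb v hv
    change a v + b v = 0
    rw [h1, h2, add_zero]
  zero_mem' := by intro v _; rfl
  smul_mem' := by
    intro c a ha v hv
    have h1 : a v = 0 := ha v hv
    change c • a v = 0
    rw [h1, smul_zero]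

variable [IsManifold 𝓘(ℝ, V) ∞ M]

/-- `α = (α₁, …, α_k)` is a smooth oriented frame of `E⁰` over the open set `U`. -/
structure IsOrientedFrame {k : ℕ} (E : ∀ m : M, Submodule ℝ (TangentSpace 𝓘(ℝ, V) m))
    (o : ∀ m : M, Orientation ℝ (annihilator E m) (Fin k)) (U : Set M)
    (α : Fin k → ∀ m : M, CoFibre (V := V) M m) : Prop where
  isOpen : IsOpen U
  smooth : ∀ j, ContMDiffOn 𝓘(ℝ, V) (ModelT V) ∞
    (fun m => (⟨m, α j m⟩ : Cotangent (V := V) M)) U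
  oriented : ∀ m ∈ U, ∃ b : Module.Basis (Fin k) ℝ (annihilator E m),
    (∀ j, ((b j : annihilator E m) : V →L[ℝ] ℝ) = α j m) ∧
      Module.Basis.orientation (R := ℝ) (M := annihilator E m) b = o m

variable (V M) in
/-- A smooth co-oriented distribution `E ⊆ TM` of corank `k`: a family of subspaces whose annihilator
`E⁰` is a smooth oriented subbundle of rank `k` of `T^*M`. -/
structure CoorientedDistribution (k : ℕ) where
  /-- the distribution -/
  E : ∀ m : M, Submodule ℝ (TangentSpace 𝓘(ℝ, V) m)
  /-- the orientation of the annihilator -/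
  o : ∀ m : M, Orientation ℝ (annihilator E m) (Fin k)
  exists_frame : ∀ m : M, ∃ (U : Set M) (α : Fin k → ∀ m : M, CoFibre (V := V) M m),
    m ∈ U ∧ IsOrientedFrame E o U α

/-- The local parametrization `(m, x) ↦ ∑ⱼ xⱼ αⱼ(m)` of `E⁰`, composed with the inclusion
`ı : E⁰ → T^*M`. -/
def frameMap {k : ℕ} (α : Fin k → ∀ m : M, CoFibre (V := V) M m)
    (z : M × (Fin k → ℝ)) : Cotangent (V := V) M :=
  ⟨z.1, ∑ j, z.2 j • α j z.1⟩

/-- The integrand, on the fibre `ℝᵏ` over `m`, of `q_* ı^* η` in the local trivialization of `E⁰` given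
by `α`: the coefficient of `dx₁ ∧ ⋯ ∧ dx_k` on the right, evaluated on the vectors `v`. -/
def fibreIntegrand {k : ℕ} (α : Fin k → ∀ m : M, CoFibre (V := V) M m)
    (η : Form (ModelT V) (Cotangent (V := V) M)) (m : M) (p : ℕ)
    (v : Fin p → TangentSpace 𝓘(ℝ, V) m) (x : Fin k → ℝ) : ℂ :=
  pullback ((𝓘(ℝ, V)).prod 𝓘(ℝ, Fin k → ℝ)) (ModelT V) (frameMap α) η (m, x) (p + k)
    (Fin.append (fun i => ((v i, 0) : V × (Fin k → ℝ)))
      (fun j => ((0, Pi.single j 1) : V × (Fin k → ℝ))))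

/-- An oriented local frame of `E⁰` around `m`. -/
def CoorientedDistribution.frameAt {k : ℕ} (D : CoorientedDistribution V M k) (m : M) :
    Fin k → ∀ m : M, CoFibre (V := V) M m :=
  (D.exists_frame m).choose_spec.choose

/-- The form `q_* ı^* η` on `M`: restriction to `E⁰` followed by integration over the oriented fibres
of `E⁰`, computed at `m` in an oriented local trivialization around `m`. -/
def CoorientedDistribution.fibreIntegral {k : ℕ} (D : CoorientedDistribution V M k)
    (η : Form (ModelT V) (Cotangent (V := V) M)) : Form 𝓘(ℝ, V) M := fun m p v =>
  ∫ x, fibreIntegrand (D.frameAt m) η m p v x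

end Distribution

section Action

variable {V : Type*} [NormedAddCommGroup V] [NormedSpace ℝ V]
  {M : Type*} [TopologicalSpace M] [ChartedSpace V M] [IsManifold 𝓘(ℝ, V) ∞ M]
  {W : Type*} [NormedAddCommGroup W] [NormedSpace ℝ W]
  {k : ℕ} (D : CoorientedDistribution V M k)
  (H : Type*) [Group H] [TopologicalSpace H] [ChartedSpace W H] [MulAction H M]

/-- The action of `H` preserves the distribution `E` and the orientation of `E⁰`. -/
structure PreservedBy : Prop where
  map_mem : ∀ (g : H) (m : M), ∀ v ∈ D.E m,
    mfderiv 𝓘(ℝ, V) 𝓘(ℝ, V) (fun x : M => g • x) m v ∈ D.E (g • m)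
  orientation : ∀ (g : H) (m : M) (b : Module.Basis (Fin k) ℝ (annihilator D.E m))
    (b' : Module.Basis (Fin k) ℝ (annihilator D.E (g • m))),
    (∀ j, ((b' j : annihilator D.E (g • m)) : V →L[ℝ] ℝ) =
      coAct g (m := m) ((b j : annihilator D.E m) : V →L[ℝ] ℝ)) →
    Module.Basis.orientation (R := ℝ) (M := annihilator D.E m) b = D.o m →
    Module.Basis.orientation (R := ℝ) (M := annihilator D.E (g • m)) b' = D.o (g • m)

/-- The action of `H` is transverse to `E`: `E + 𝔥_M = TM`. -/
def Transverse : Prop := ∀ m : M, D.E m ⊔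
  (fundamental (H := H) 𝓘(ℝ, V) (fun (g : H) (x : M) => g • x) m :
    W →L[ℝ] TangentSpace 𝓘(ℝ, V) m).range = ⊤

/-- `χ` is a cutoff function on `T^*M`: smooth, invariant, equal to `1` near the zeros of the moment
map of the canonical form, and such that the part of its support in `E⁰` is proper over `M` (if `M`
is compact: is compact). -/
structure IsCutoff (χ : Cotangent (V := V) M → ℝ) : Prop where
  smooth : ContMDiff (ModelT V) 𝓘(ℝ, ℝ) ∞ χ
  invariant : ∀ (g : H) (ξ : Cotangent (V := V) M), χ (cotangentLift g ξ) = χ ξ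
  eq_one : ∀ ξ : Cotangent (V := V) M,
    momentMap (W := W) (H := H) (ModelT V) cotangentLift canonicalForm ξ = 0 →
      ∀ᶠ ζ in 𝓝 ξ, χ ζ = 1
  proper : ∀ K : Set M, IsCompact K → IsCompact (tsupport χ ∩
    {ξ : Cotangent (V := V) M | ξ.proj ∈ K ∧
      (show V →L[ℝ] ℝ from ξ.2) ∈ annihilator D.E ξ.proj})

variable [MeasurableSpace W] (μ : Measure W)

/-- The pairing with a test function of the family of forms `e^{iDθ(X)}` on `T^*M`. -/
def expTheta (φ : 𝓓((⊤ : TopologicalSpace.Opens W), ℂ)) : Form (ModelT V) (Cotangent (V := V) M) :=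
  pairing (ModelT V) μ (expD (H := H) (ModelT V) cotangentLift canonicalForm 1) φ

/-- The pairing with a test function of the form `P_θ(X)` on `T^*M`. -/
def paradanTheta (χ : Cotangent (V := V) M → ℝ) (φ : 𝓓((⊤ : TopologicalSpace.Opens W), ℂ)) :
    Form (ModelT V) (Cotangent (V := V) M) :=
  paradanForm (H := H) (ModelT V) μ cotangentLift canonicalForm χ φ

/-- The form `𝒥(E, X) = (2πi)^{-k} q_* ı^* e^{iDθ(X)}`. -/
def JForm (φ : 𝓓((⊤ : TopologicalSpace.Opens W), ℂ)) : Form 𝓘(ℝ, V) M :=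
  ((2 * Real.pi * Complex.I : ℂ) ^ k)⁻¹ • D.fibreIntegral (expTheta H μ φ)

end Action

end EqForm

end

open EqForm

/-! Locally E⁰ is described by an oriented frame α and fibre coordinates x in ℝᵏ. The degree 0 part
of Dθ(X) is ⟨f_θ, X⟩ and the remaining part is dθ, so pairing e^{itDθ} with a test function φ gives
φ̂(t f_θ) e^{it dθ}, where φ̂ is `fhat` (`pairing_expD`). Along a fibre of E⁰ the moment map is
linear, f_θ = Σ xⱼ aⱼ, and transversality makes the covectors aⱼ on the Lie algebra linearly
independent (`linearIndependent_frameMoment`). Hence φ̂(Σ xⱼ aⱼ) decreases rapidly in x, while the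
coefficients of ı^* e^{i dθ} are polynomial in x. The fibre integrand Φ(x) is therefore rapidly
decreasing, with all its derivatives in the base point, and is controlled by seminorms of φ; this
gives convergence, smoothness and continuity (`exists_oscIntegral_smooth`,
`exists_fibreIntegral_smooth`).

The fibre integral is independent of the oriented frame: a change of frame acts on the integrand as
a linear substitution of positive determinant (`integral_fibreIntegrand_congr`). Equivariance
follows because the cotangent lift preserves θ, hence dθ, and intertwines the moment map with Ad
(`fibreIntegrand_smul`).

For P_θ, let R be the Euler field of the fibres of E⁰. On E⁰ one has ι(R)dθ = θ. On vectors whose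
span contains R, contraction with R of a product whose degree exceeds the number of vectors gives it
dχ ∧ θ ∧ e^{it dθ} = (it)⁻¹ (Rχ) e^{it dθ} (`wedge_wedge_expTwo`). So for k ≥ 1 the fibre integrand
of P_θ is -(Rχ)(x) ∫₀^∞ t⁻¹ (ı^* e^{itDθ})(x) dt, and dilation of the fibres turns t⁻¹ (ı^*
e^{itDθ})(x) into t^{k-1} Φ(tx) (`frameExp_smul`). After Fubini and the substitution y = tx this is
the integral over t of the derivative of ∫ χ(y/t) Φ(y) dy. That function tends to 0 as t → 0,
because χ has compact support on the fibre, and to ∫ Φ as t → ∞, because χ = 1 near the zero section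
(`integral_radial`). For k = 0 the fibre is a point at which χ = 1 and dχ = 0.

Thus P_θ and e^{iDθ} have the same fibre integrals, and the regularity of the former is inherited
from the latter. -/

noncomputable section

namespace EqForm

/-! ### Exponentials of 2-forms given as functions of tuples -/

section Algebra

/-- The form which is `B` in degree `2` and vanishes in the other degrees. -/
def twoForm {T : Type*} (B : T → T → ℂ) : PreForm T := fun p v =>
  match p, v with
  | 2, v => B (v 0) (v 1)
  | _, _ => 0

/-- The form which is `c` in degree `1` and vanishes in the other degrees. -/
def oneForm {T : Type*} (c : T → ℂ) : PreForm T := fun p v =>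
  match p, v with
  | 1, v => c (v 0)
  | _, _ => 0

/-- The exponential of a `2`-form. -/
def expTwo {T : Type*} (B : T → T → ℂ) : PreForm T := fun p v =>
  ∑ j ∈ Finset.range (p + 1), (1 / (j.factorial : ℂ)) * wedgePow (twoForm B) j p v

lemma twoForm_of_ne {T : Type*} (B : T → T → ℂ) {p : ℕ} (hp : p ≠ 2) (v : Fin p → T) :
    twoForm B p v = 0 := by
  rcases p with _ | _ | _ | p <;> first | rfl | exact absurd rfl hp

lemma oneForm_of_ne {T : Type*} (c : T → ℂ) {p : ℕ} (hp : p ≠ 1) (v : Fin p → T) :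
    oneForm c p v = 0 := by
  rcases p with _ | _ | p <;> first | rfl | exact absurd rfl hp

/-- The product only permutes the entries of a tuple, so `f` may be any map of sets. In particular
vectors can be replaced by their indices in a fixed tuple. -/
lemma wedge_comp {T T' : Type*} (f : T' → T) (a b : PreForm T) :
    wedge (fun p v => a p (f ∘ v)) (fun p v => b p (f ∘ v)) = fun p v => wedge a b p (f ∘ v) :=
  rfl

lemma wedgePow_comp {T T' : Type*} (f : T' → T) (a : PreForm T) (j : ℕ) :
    wedgePow (fun p v => a p (f ∘ v)) j = fun p v => wedgePow a j p (f ∘ v) := by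
  induction j with
  | zero => rfl
  | succ j ih =>
    simp only [wedgePow]
    rw [ih, wedge_comp]

lemma twoForm_comp {T T' : Type*} (f : T' → T) (B : T → T → ℂ) :
    twoForm (fun v w => B (f v) (f w)) = fun p v => twoForm B p (f ∘ v) := by
  funext p v
  rcases p with _ | _ | _ | p <;> rfl

lemma expTwo_comp {T T' : Type*} (f : T' → T) (B : T → T → ℂ) (p : ℕ) (v : Fin p → T') :
    expTwo (fun v w => B (f v) (f w)) p v = expTwo B p (f ∘ v) := by
  simp only [expTwo, twoForm_comp, wedgePow_comp]

/-- The exponential of a `2`-form depends only on its values on the given vectors. -/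
lemma expTwo_eq_index {T : Type*} (B : T → T → ℂ) (p : ℕ) (v : Fin p → T) :
    expTwo B p v = expTwo (fun a b : Fin p => B (v a) (v b)) p id :=
  (expTwo_comp v B p id).symm

/-- Only the matrix of values of the 2-form on the given vectors enters. Pulled-back 2-forms living
on different spaces are compared through this lemma. -/
lemma expTwo_congr {T T' : Type*} {B : T → T → ℂ} {B' : T' → T' → ℂ} {p : ℕ}
    {v : Fin p → T} {v' : Fin p → T'} (h : ∀ a b, B (v a) (v b) = B' (v' a) (v' b)) :
    expTwo B p v = expTwo B' p v' := by
  rw [expTwo_eq_index, expTwo_eq_index B']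
  congr 1
  funext a b
  exact h a b

/-- A form is multilinear and alternating in each degree. -/
def IsAlt {T : Type*} [AddCommGroup T] [Module ℝ T] (a : PreForm T) : Prop :=
  ∀ p, ∃ A : T [⋀^Fin p]→ₗ[ℝ] ℂ, ∀ v, a p v = A v

section Alt

variable {T : Type*} [AddCommGroup T] [Module ℝ T]

lemma alternatingMap_sum_apply {n ι : Type*} (s : Finset ι) (f : ι → T [⋀^n]→ₗ[ℝ] ℂ) (v : n → T) :
    (∑ i ∈ s, f i) v = ∑ i ∈ s, f i v := by
  classical
  induction s using Finset.induction_on with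
  | empty => simp
  | insert a s ha ih => rw [Finset.sum_insert ha, Finset.sum_insert ha, AlternatingMap.add_apply, ih]

lemma isAlt_scalarForm (c : ℂ) : IsAlt (T := T) (scalarForm c) := fun p => by
  by_cases hp : p = 0
  · subst hp
    exact ⟨AlternatingMap.constOfIsEmpty ℝ T (Fin 0) c, fun v => by simp [scalarForm]⟩
  · exact ⟨0, fun v => by simp [scalarForm, hp]⟩

/-- The summand of bidegree (p, r - p) is, up to the factorials, the alternatization of the tensor
product of the two components. -/
lemma IsAlt.wedge {a b : PreForm T} (ha : IsAlt a) (hb : IsAlt b) : IsAlt (wedge a b) := fun r => by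
  choose A hA using ha
  choose B hB using hb
  let e : ∀ p : Fin (r + 1), Fin p.1 ⊕ Fin (r - p.1) ≃ Fin r := fun p =>
    finSumFinEquiv.trans (finCongr (by omega))
  let f : ∀ p : Fin (r + 1), MultilinearMap ℝ (fun _ : Fin r => T) ℂ := fun p =>
    ((LinearMap.mul' ℝ ℂ).compMultilinearMap (MultilinearMap.domCoprod
      (A p.1).toMultilinearMap (B (r - p.1)).toMultilinearMap)).domDomCongr (e p)
  refine ⟨∑ p : Fin (r + 1), (1 / ((p.1.factorial : ℂ) * ((r - p.1).factorial : ℂ))) •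
    MultilinearMap.alternatization (f p), fun v => ?_⟩
  rw [alternatingMap_sum_apply]
  refine Finset.sum_congr rfl fun p _ => ?_
  rw [AlternatingMap.smul_apply, MultilinearMap.alternatization_apply, smul_eq_mul]
  congr 1
  refine Finset.sum_congr rfl fun σ _ => ?_
  rw [Units.smul_def, zsmul_eq_mul]
  congr 1
  simp only [hA, hB]
  rfl

lemma IsAlt.wedgePow {a : PreForm T} (ha : IsAlt a) (j : ℕ) : IsAlt (wedgePow a j) := by
  induction j with
  | zero => exact isAlt_scalarForm 1
  | succ j ih => exact ha.wedge ih

lemma isAlt_oneForm (c : T →ₗ[ℝ] ℂ) : IsAlt (oneForm (fun v => c v)) := fun p => by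
  by_cases hp : p = 1
  · subst hp
    exact ⟨AlternatingMap.ofSubsingleton ℝ T ℂ (0 : Fin 1) c, fun v => rfl⟩
  · exact ⟨0, fun v => by simp [oneForm_of_ne _ hp]⟩

lemma isAlt_twoForm (B : T →ₗ[ℝ] T →ₗ[ℝ] ℂ) (hB : ∀ v, B v v = 0) :
    IsAlt (twoForm (fun v w => B v w)) := fun p => by
  by_cases hp : p = 2
  · subst hp
    refine ⟨{ toFun := fun v => B (v 0) (v 1)
              map_update_add' := ?_
              map_update_smul' := ?_
              map_eq_zero_of_eq' := ?_ }, fun v => rfl⟩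
    · intro _ v i x y
      have hd : ‹DecidableEq (Fin 2)› = instDecidableEqFin 2 := Subsingleton.elim _ _
      subst hd
      fin_cases i <;> simp
    · intro _ v i x y
      have hd : ‹DecidableEq (Fin 2)› = instDecidableEqFin 2 := Subsingleton.elim _ _
      subst hd
      fin_cases i <;> simp
    · intro v i j h hij
      have : v 0 = v 1 := by
        fin_cases i <;> fin_cases j <;> simp_all
      simp [this, hB]
  · exact ⟨0, fun v => by simp [twoForm_of_ne _ hp]⟩

lemma isAlt_expTwo (B : T →ₗ[ℝ] T →ₗ[ℝ] ℂ) (hB : ∀ v, B v v = 0) :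
    IsAlt (expTwo (fun v w => B v w)) := fun p => by
  choose A hA using fun j => (isAlt_twoForm B hB).wedgePow j p
  refine ⟨∑ j ∈ Finset.range (p + 1), (1 / (j.factorial : ℂ)) • A j, fun v => ?_⟩
  simp [expTwo, alternatingMap_sum_apply, hA]

end Alt

/-- An algebra of functions which contains the coefficients of a family of `2`-forms contains the
coefficients of the exponentials. -/
lemma expTwo_mem {Z T : Type*} (S : Subalgebra ℂ (Z → ℂ)) (B : Z → T → T → ℂ)
    (hB : ∀ a b, (fun z => B z a b) ∈ S) (p : ℕ) (v : Fin p → T) :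
    (fun z => expTwo (B z) p v) ∈ S := by
  have hconst : ∀ c : ℂ, (fun _ : Z => c) ∈ S := fun c => S.algebraMap_mem c
  have hsum : ∀ {ι : Type} (s : Finset ι) (f : ι → Z → ℂ), (∀ i ∈ s, f i ∈ S) →
      (fun z => ∑ i ∈ s, f i z) ∈ S := fun s f h => by
    have := S.sum_mem h
    convert this using 1
    funext z
    simp
  have htwo : ∀ p v, (fun z => twoForm (B z) p v) ∈ S := by
    intro p v
    by_cases hp : p = 2
    · subst hp
      exact hB _ _
    · simp only [twoForm_of_ne _ hp]
      exact hconst 0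
  have hpow : ∀ j p v, (fun z => wedgePow (twoForm (B z)) j p v) ∈ S := by
    intro j
    induction j with
    | zero => intro p v; exact hconst _
    | succ j ih =>
      intro p v
      simp only [wedgePow, wedge]
      refine hsum _ _ fun q _ => S.mul_mem (hconst _) (hsum _ _ fun σ _ =>
        S.mul_mem (hconst _) (S.mul_mem (htwo _ _) (ih _ _)))
  exact hsum _ _ fun j _ => S.mul_mem (hconst _) (hpow _ _ _)

end Algebra

/-! ### Forms on indices as elements of the exterior algebra, and contraction -/

section Bracket

open ExteriorAlgebra

variable {n : ℕ}

/-- The product `ε_{i 0} ⋯ ε_{i (p-1)}` of basis vectors in the exterior algebra. -/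
def basisProd {p : ℕ} (i : Fin p → Fin n) : ExteriorAlgebra ℂ (Fin n → ℂ) :=
  ιMulti ℂ p (fun k => (Pi.single (i k) (1 : ℂ) : Fin n → ℂ))

/-- The element of the exterior algebra given by the component of degree `p` of a form on indices. -/
def bracket (a : PreForm (Fin n)) (p : ℕ) : ExteriorAlgebra ℂ (Fin n → ℂ) :=
  (1 / (p.factorial : ℂ)) • ∑ i : Fin p → Fin n, a p i • basisProd i

lemma basisProd_comp_perm {p : ℕ} (i : Fin p → Fin n) (σ : Equiv.Perm (Fin p)) :
    basisProd (i ∘ σ) = ((Equiv.Perm.sign σ : ℤ) : ℂ) • basisProd i := by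
  unfold basisProd
  have := (ιMulti ℂ p (M := Fin n → ℂ)).map_perm (fun k => Pi.single (i k) (1 : ℂ)) σ
  rw [show (fun k => (Pi.single ((i ∘ σ) k) (1 : ℂ) : Fin n → ℂ)) =
    (fun k => Pi.single (i k) (1 : ℂ)) ∘ σ from rfl, this, Units.smul_def,
    Int.cast_smul_eq_zsmul]

lemma basisProd_append {p q : ℕ} (i : Fin p → Fin n) (j : Fin q → Fin n) :
    basisProd (Fin.append i j) = basisProd i * basisProd j := by
  simp only [basisProd, ιMulti_apply]
  rw [← List.prod_append, ← List.ofFn_fin_append]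
  congr 2
  funext k
  refine Fin.addCases (fun l => ?_) (fun l => ?_) k <;> simp

/-- An index tuple of length r is the concatenation of a tuple of length p and one of length q, and
`basisProd` is multiplicative for concatenation. -/
lemma sum_mul_basisProd {p q r : ℕ} (h : p + q = r) (a : (Fin p → Fin n) → ℂ)
    (b : (Fin q → Fin n) → ℂ) :
    ∑ i : Fin r → Fin n, (a (fun k => i ⟨k.1, by omega⟩) * b (fun k => i ⟨p + k.1, by omega⟩)) •
      basisProd i = (∑ i, a i • basisProd i) * ∑ j, b j • basisProd j := by
  subst h
  rw [Finset.sum_mul_sum, ← Fintype.sum_prod_type', ← (Fin.appendEquiv p q).sum_comp]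
  refine Finset.sum_congr rfl fun x _ => ?_
  have h1 : (fun k : Fin p => Fin.append x.1 x.2 ⟨k.1, by omega⟩) = x.1 := by
    funext k
    exact Fin.append_left x.1 x.2 k
  have h2 : (fun k : Fin q => Fin.append x.1 x.2 ⟨p + k.1, by omega⟩) = x.2 := by
    funext k
    exact Fin.append_right x.1 x.2 k
  change (a (fun k : Fin p => Fin.append x.1 x.2 _) * b (fun k : Fin q => Fin.append x.1 x.2 _)) •
    basisProd (Fin.append x.1 x.2) = _
  rw [h1, h2, basisProd_append, smul_mul_smul_comm]

/-- Reindexing by σ produces the sign of σ a second time, from `basisProd`. Each of the r!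
permutations therefore contributes the same sum. -/
lemma sum_alternate {r : ℕ} (f : (Fin r → Fin n) → ℂ) :
    ∑ i : Fin r → Fin n, (∑ σ : Equiv.Perm (Fin r), ((Equiv.Perm.sign σ : ℤ) : ℂ) * f (i ∘ σ)) •
      basisProd i = (r.factorial : ℂ) • ∑ i, f i • basisProd i := by
  simp only [Finset.sum_smul]
  rw [Finset.sum_comm]
  have : ∀ σ : Equiv.Perm (Fin r), ∑ i : Fin r → Fin n,
      (((Equiv.Perm.sign σ : ℤ) : ℂ) * f (i ∘ σ)) • basisProd i = ∑ i, f i • basisProd i := by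
    intro σ
    rw [← (Equiv.arrowCongr σ (Equiv.refl (Fin n))).sum_comp]
    refine Finset.sum_congr rfl fun i _ => ?_
    have h1 : (Equiv.arrowCongr σ (Equiv.refl (Fin n))) i = i ∘ σ.symm := rfl
    have h2 : (i ∘ σ.symm) ∘ σ = i := by
      funext k
      simp
    rw [h1, h2, basisProd_comp_perm, smul_smul, Equiv.Perm.sign_symm]
    congr 1
    have : (((Equiv.Perm.sign σ : ℤ) : ℂ)) * ((Equiv.Perm.sign σ : ℤ) : ℂ) = 1 := by
      rw [← Int.cast_mul, ← Units.val_mul, Int.units_mul_self]; simp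
    linear_combination f i * this
  simp only [this, Finset.sum_const, Finset.card_univ, Fintype.card_perm, Fintype.card_fin]
  rw [Nat.cast_smul_eq_nsmul]

/-- The factor r! from antisymmetrization cancels the normalization 1/r! of `bracket`, and the 1/(p!
(r-p)!) in `wedge` supplies the normalizations of the two factors. Identities between wedge products
can then be proved in the associative exterior algebra. -/
lemma bracket_wedge (a b : PreForm (Fin n)) (r : ℕ) :
    bracket (wedge a b) r = ∑ p : Fin (r + 1), bracket a p.1 * bracket b (r - p.1) := by
  have hr : (r.factorial : ℂ) ≠ 0 := by exact_mod_cast r.factorial_ne_zero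
  have key : ∀ p : Fin (r + 1), ∑ i : Fin r → Fin n,
      (∑ σ : Equiv.Perm (Fin r), ((Equiv.Perm.sign σ : ℤ) : ℂ) *
        (a p.1 (fun k => i (σ ⟨k.1, by omega⟩)) *
          b (r - p.1) (fun j => i (σ ⟨p.1 + j.1, by omega⟩)))) • basisProd i =
      (r.factorial : ℂ) • ((∑ i, a p.1 i • basisProd i) *
        ∑ j, b (r - p.1) j • basisProd j) := by
    intro p
    rw [← sum_mul_basisProd (r := r) (by omega)]
    exact sum_alternate (fun i => a p.1 (fun k => i ⟨k.1, by omega⟩) *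
          b (r - p.1) (fun j => i ⟨p.1 + j.1, by omega⟩))
  unfold bracket
  simp only [wedge, Finset.sum_smul, mul_smul]
  rw [Finset.sum_comm, Finset.smul_sum]
  refine Finset.sum_congr rfl fun p _ => ?_
  have := key p
  simp only [Finset.sum_smul, mul_smul] at this
  rw [← Finset.smul_sum, this, smul_mul_smul_comm, smul_smul, smul_smul]
  congr 1
  field_simp

lemma basisProd_of_card_lt {p : ℕ} (h : n < p) (i : Fin p → Fin n) : basisProd i = 0 := by
  obtain ⟨x, y, hxy, h⟩ := Fintype.exists_ne_map_eq_of_card_lt i (by simpa using h)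
  exact (ιMulti ℂ p).map_eq_zero_of_eq _ (by simp [h]) hxy

lemma bracket_of_lt (a : PreForm (Fin n)) {p : ℕ} (h : n < p) : bracket a p = 0 := by
  simp [bracket, basisProd_of_card_lt h]

lemma bracket_of_eq_zero (a : PreForm (Fin n)) {p : ℕ} (h : ∀ v, a p v = 0) : bracket a p = 0 := by
  simp [bracket, h]

lemma bracket_oneForm (c : Fin n → ℂ) : bracket (oneForm c) 1 = ι ℂ c := by
  have hc : c = ∑ k, c k • (Pi.single k (1 : ℂ) : Fin n → ℂ) := pi_eq_sum_univ' c
  conv_rhs => rw [hc, map_sum]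
  rw [bracket, ← (Equiv.funUnique (Fin 1) (Fin n)).symm.sum_comp]
  simp [basisProd, oneForm, ιMulti_apply]

/-- The `2`-form `B` on indices as an element of the exterior algebra. -/
def twoElement (B : Fin n → Fin n → ℂ) : ExteriorAlgebra ℂ (Fin n → ℂ) :=
  (1 / 2 : ℂ) • ∑ a, ∑ b, B a b •
    (ι ℂ (Pi.single a (1 : ℂ) : Fin n → ℂ) * ι ℂ (Pi.single b (1 : ℂ) : Fin n → ℂ))

lemma bracket_twoForm (B : Fin n → Fin n → ℂ) : bracket (twoForm B) 2 = twoElement B := by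
  rw [bracket, twoElement, ← (finTwoArrowEquiv (Fin n)).symm.sum_comp, Fintype.sum_prod_type]
  simp [basisProd, twoForm, ιMulti_apply, finTwoArrowEquiv]
  rfl

lemma bracket_wedge_oneForm (c : Fin n → ℂ) (a : PreForm (Fin n)) (r : ℕ) :
    bracket (wedge (oneForm c) a) (r + 1) = ι ℂ c * bracket a r := by
  rw [bracket_wedge, Finset.sum_eq_single (⟨1, by omega⟩ : Fin (r + 2))]
  · simp [bracket_oneForm]
  · intro p _ hp
    rw [bracket_of_eq_zero (oneForm c) (fun v => oneForm_of_ne c (fun h => hp (Fin.ext h)) v),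
      zero_mul]
  · simp

lemma bracket_wedge_twoForm (B : Fin n → Fin n → ℂ) (a : PreForm (Fin n)) (r : ℕ) :
    bracket (wedge (twoForm B) a) (r + 2) = twoElement B * bracket a r := by
  rw [bracket_wedge, Finset.sum_eq_single (⟨2, by omega⟩ : Fin (r + 3))]
  · simp [bracket_twoForm]
  · intro p _ hp
    rw [bracket_of_eq_zero (twoForm B) (fun v => twoForm_of_ne B (fun h => hp (Fin.ext h)) v),
      zero_mul]
  · simp

lemma bracket_wedgePow_twoForm (B : Fin n → Fin n → ℂ) (j : ℕ) :
    bracket (wedgePow (twoForm B) j) (2 * j) = twoElement B ^ j := by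
  induction j with
  | zero =>
    simp [bracket, wedgePow, scalarForm, basisProd, ιMulti_apply]
  | succ j ih =>
    rw [wedgePow, show 2 * (j + 1) = 2 * j + 2 by ring, bracket_wedge_twoForm, ih, pow_succ']

/-- Moving a vector past a product of two vectors changes the sign twice. -/
lemma twoElement_mul_ι (B : Fin n → Fin n → ℂ) (v : Fin n → ℂ) :
    twoElement B * ι ℂ v = ι ℂ v * twoElement B := by
  have anti : ∀ x y : Fin n → ℂ, ι ℂ x * ι ℂ y = -(ι ℂ y * ι ℂ x) := fun x y =>
    eq_neg_of_add_eq_zero_left (ι_add_mul_swap x y)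
  simp only [twoElement, smul_mul_assoc, mul_smul_comm, Finset.sum_mul, Finset.mul_sum]
  congr 1
  refine Finset.sum_congr rfl fun a _ => Finset.sum_congr rfl fun b _ => ?_
  congr 1
  rw [mul_assoc, anti (Pi.single b 1) v, mul_neg, ← mul_assoc, anti (Pi.single a 1) v, neg_mul,
    neg_neg, mul_assoc]

/-- Contraction in the exterior algebra with the vector `r`. -/
def contr (r : Fin n → ℂ) :
    ExteriorAlgebra ℂ (Fin n → ℂ) →ₗ[ℂ] ExteriorAlgebra ℂ (Fin n → ℂ) :=
  CliffordAlgebra.contractLeft (Q := (0 : QuadraticForm ℂ (Fin n → ℂ)))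
    (Fintype.linearCombination ℂ r)

lemma contr_ι_mul (r v : Fin n → ℂ) (y : ExteriorAlgebra ℂ (Fin n → ℂ)) :
    contr r (ι ℂ v * y) = (∑ a, v a * r a) • y - ι ℂ v * contr r y := by
  have := CliffordAlgebra.contractLeft_ι_mul (Q := (0 : QuadraticForm ℂ (Fin n → ℂ)))
    (d := Fintype.linearCombination ℂ r) v y
  simpa [contr, Fintype.linearCombination_apply] using! this

/-- Contraction is an antiderivation, without a sign past an element of degree 2. By antisymmetry of
`B` the contractions in its two slots agree, which cancels the factor 1/2. -/
lemma contr_twoElement_mul {B : Fin n → Fin n → ℂ} (hB : ∀ a b, B a b = -B b a)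
    (r : Fin n → ℂ) (y : ExteriorAlgebra ℂ (Fin n → ℂ)) :
    contr r (twoElement B * y) = ι ℂ (fun a => ∑ b, r b * B b a) * y +
      twoElement B * contr r y := by
  have hl : (fun a => ∑ b, r b * B b a) =
      ∑ a, (∑ b, r b * B b a) • (Pi.single a (1 : ℂ) : Fin n → ℂ) := pi_eq_sum_univ' _
  have hs : ∀ a : Fin n, ∑ x, (Pi.single a (1 : ℂ) : Fin n → ℂ) x * r x = r a := by
    intro a
    simp [Pi.single_apply]
  rw [hl]
  simp only [twoElement, smul_mul_assoc, Finset.sum_mul, map_smul, map_sum, mul_assoc, contr_ι_mul,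
    hs, mul_sub, mul_smul_comm, sub_sub_eq_add_sub]
  have h1 : ∑ a, ∑ b, B a b • r a • (ι ℂ (Pi.single b (1 : ℂ) : Fin n → ℂ) * y) =
      ∑ a, (∑ b, r b * B b a) • (ι ℂ (Pi.single a (1 : ℂ) : Fin n → ℂ) * y) := by
    rw [Finset.sum_comm]
    refine Finset.sum_congr rfl fun a _ => ?_
    rw [Finset.sum_smul]
    exact Finset.sum_congr rfl fun b _ => by rw [smul_smul, mul_comm]
  have h2 : ∑ a, ∑ b, B a b • r b • (ι ℂ (Pi.single a (1 : ℂ) : Fin n → ℂ) * y) =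
      -∑ a, (∑ b, r b * B b a) • (ι ℂ (Pi.single a (1 : ℂ) : Fin n → ℂ) * y) := by
    rw [← Finset.sum_neg_distrib]
    refine Finset.sum_congr rfl fun a _ => ?_
    rw [Finset.sum_smul, ← Finset.sum_neg_distrib]
    exact Finset.sum_congr rfl fun b _ => by rw [smul_smul, hB a b, mul_comm, mul_neg, neg_smul]
  simp only [smul_sub, smul_add, Finset.sum_sub_distrib, Finset.sum_add_distrib, h1, h2]
  module

lemma contr_twoElement_pow {B : Fin n → Fin n → ℂ} (hB : ∀ a b, B a b = -B b a)
    (r : Fin n → ℂ) (j : ℕ) :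
    contr r (twoElement B ^ (j + 1)) =
      ((j : ℂ) + 1) • (ι ℂ (fun a => ∑ b, r b * B b a) * twoElement B ^ j) := by
  induction j with
  | zero =>
    have h1 : contr r (1 : ExteriorAlgebra ℂ (Fin n → ℂ)) = 0 :=
      CliffordAlgebra.contractLeft_one (Q := (0 : QuadraticForm ℂ (Fin n → ℂ))) _
    rw [zero_add, pow_one, ← mul_one (twoElement B), contr_twoElement_mul hB, h1]
    simp
  | succ j ih =>
    rw [pow_succ', contr_twoElement_mul hB, ih, mul_smul_comm, ← mul_assoc (twoElement B),
      twoElement_mul_ι, mul_assoc, ← pow_succ']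
    push_cast
    module

/-- The coefficient of the volume form. -/
def top (n : ℕ) : ExteriorAlgebra ℂ (Fin n → ℂ) →ₗ[ℂ] ℂ :=
  liftAlternating (fun m => if h : m = n then
    (Matrix.detRowAlternating : (Fin n → ℂ) [⋀^Fin n]→ₗ[ℂ] ℂ).domDomCongr (finCongr h.symm) else 0)

lemma top_basisProd (i : Fin n → Fin n) :
    top n (basisProd i) = Matrix.det (fun k => (Pi.single (i k) (1 : ℂ) : Fin n → ℂ)) := by
  rw [top, basisProd, liftAlternating_apply_ιMulti]
  simp
  rfl

/-- Index tuples with a repetition contribute 0. For a permutation, the sign from `A` and the sign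
from the determinant cancel, and the n! equal terms cancel the normalization 1/n!. So evaluation on
n vectors is the coefficient of the volume form. -/
lemma top_bracket (a : PreForm (Fin n)) {T : Type*} [AddCommGroup T] [Module ℝ T]
    (A : T [⋀^Fin n]→ₗ[ℝ] ℂ) (u : Fin n → T) (h : ∀ i, a n i = A (u ∘ i)) :
    top n (bracket a n) = A u := by
  have hn : (n.factorial : ℂ) ≠ 0 := by exact_mod_cast n.factorial_ne_zero
  rw [bracket, map_smul, map_sum]
  have : ∑ i : Fin n → Fin n, top n (a n i • basisProd i) =
      ∑ σ : Equiv.Perm (Fin n), A u := by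
    symm
    refine Fintype.sum_of_injective (fun σ : Equiv.Perm (Fin n) => (σ : Fin n → Fin n))
      (fun σ τ h => Equiv.ext (congrFun h)) _ _ ?_ ?_
    · intro i hi
      have : ¬ Function.Injective i := fun hinj => hi
        ⟨Equiv.ofBijective i (Finite.injective_iff_bijective.1 hinj), rfl⟩
      rw [Function.not_injective_iff] at this
      obtain ⟨x, y, hxy, hne⟩ := this
      rw [h, A.map_eq_zero_of_eq _ (by simp [hxy]) hne, zero_smul, map_zero]
    · intro σ
      have h1 : Matrix.det (fun k => (Pi.single (σ k) (1 : ℂ) : Fin n → ℂ)) =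
          ((Equiv.Perm.sign σ : ℤ) : ℂ) := by
        rw [← Matrix.det_permutation σ]
        congr 1
        ext k l
        simp [Equiv.Perm.permMatrix, PEquiv.toMatrix_apply, Pi.single_apply, eq_comm]
      have hs : (((Equiv.Perm.sign σ : ℤ) : ℂ)) * ((Equiv.Perm.sign σ : ℤ) : ℂ) = 1 := by
        rw [← Int.cast_mul, ← Units.val_mul, Int.units_mul_self]; simp
      rw [h, A.map_perm, map_smul, top_basisProd, h1, Units.smul_def, zsmul_eq_mul, smul_eq_mul]
      linear_combination -A u * hs
  rw [this]
  simp only [Finset.sum_const, Finset.card_univ, Fintype.card_perm, Fintype.card_fin]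
  rw [nsmul_eq_mul, smul_eq_mul]
  field_simp

lemma wedge_oneForm_eq_zero {T : Type*} (c : T → ℂ) (a : PreForm T) (r : ℕ)
    (h : r ≠ 0 → ∀ v, a (r - 1) v = 0) (v : Fin r → T) : wedge (oneForm c) a r v = 0 := by
  unfold wedge
  refine Finset.sum_eq_zero fun p _ => ?_
  by_cases hp : p.1 = 1
  · obtain ⟨p, hp'⟩ := p
    obtain rfl : p = 1 := hp
    simp [h (by omega)]
  · simp [oneForm_of_ne c hp]

lemma wedgePow_twoForm_of_ne {T : Type*} (B : T → T → ℂ) (j : ℕ) :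
    ∀ {p : ℕ}, p ≠ 2 * j → ∀ v : Fin p → T, wedgePow (twoForm B) j p v = 0 := by
  induction j with
  | zero => intro p hp v; simp [wedgePow, scalarForm, show p ≠ 0 by omega]
  | succ j ih =>
    intro p hp v
    unfold wedgePow wedge
    refine Finset.sum_eq_zero fun q _ => ?_
    by_cases hq : q.1 = 2
    · obtain ⟨q, hq'⟩ := q
      obtain rfl : q = 2 := hq
      simp [ih (show p - 2 ≠ 2 * j by omega)]
    · simp [twoForm_of_ne B hq]

/-- If `l = ι(R) B` with `R` in the span of the vectors `u`, then
`(j + 1) c ∧ l ∧ Bʲ = c(R) Bʲ⁺¹` on the vectors `u`. -/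
lemma wedge_wedge_wedgePow {T : Type*} [AddCommGroup T] [Module ℝ T] (c l : T →ₗ[ℝ] ℂ)
    (B : T →ₗ[ℝ] T →ₗ[ℝ] ℂ) (hB : ∀ v, B v v = 0) (u : Fin n → T) (r : Fin n → ℂ)
    (hl : ∀ a, l (u a) = ∑ b, r b * B (u b) (u a)) (j : ℕ) :
    ((j : ℂ) + 1) * wedge (oneForm (fun v => c v)) (wedge (oneForm (fun v => l v))
        (wedgePow (twoForm (fun v w => B v w)) j)) n u =
      (∑ b, r b * c (u b)) * wedgePow (twoForm (fun v w => B v w)) (j + 1) n u := by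
  -- Both sides are homogeneous of degree 2j + 2, so only this number of vectors matters. The forms
  -- are then transported to the index set `Fin n`.
  by_cases hn : n = 2 * j + 2
  · let c' : Fin n → ℂ := fun a => c (u a)
    let l' : Fin n → ℂ := fun a => l (u a)
    let B' : Fin n → Fin n → ℂ := fun a b => B (u a) (u b)
    have hB' : ∀ a b, B' a b = -B' b a := by
      intro a b
      have := hB (u a + u b)
      simp only [map_add, LinearMap.add_apply, hB, zero_add, add_zero] at this
      exact eq_neg_of_add_eq_zero_right this
    have hl' : l' = fun a => ∑ b, r b * B' b a := funext hl
    obtain ⟨A, hA⟩ := (isAlt_oneForm c).wedge ((isAlt_oneForm l).wedge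
      ((isAlt_twoForm B hB).wedgePow j)) n
    obtain ⟨C, hC⟩ := (isAlt_twoForm B hB).wedgePow (j + 1) n
    rw [hA, hC, ← top_bracket (wedge (oneForm c') (wedge (oneForm l') (wedgePow (twoForm B') j))) A u
      (fun i => ?_), ← top_bracket (wedgePow (twoForm B') (j + 1)) C u (fun i => ?_)]
    rotate_left
    · rw [← hC, show B' = fun a b => B (u a) (u b) from rfl,
        twoForm_comp u (fun v w => B v w), wedgePow_comp]
    · rw [← hA, show B' = fun a b => B (u a) (u b) from rfl,
        twoForm_comp u (fun v w => B v w), wedgePow_comp]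
      have h1 : ∀ m : T →ₗ[ℝ] ℂ, oneForm (fun a => m (u a)) =
          fun p v => oneForm (fun v => m v) p (u ∘ v) := by
        intro m
        funext p v
        rcases p with _ | _ | p <;> rfl
      rw [h1 c, h1 l, wedge_comp, wedge_comp]
    rw [show bracket (wedge (oneForm c') (wedge (oneForm l') (wedgePow (twoForm B') j))) n =
        ι ℂ c' * (ι ℂ l' * twoElement B' ^ j) by
      rw [congrArg (bracket _) (show n = 2 * j + 1 + 1 from hn), bracket_wedge_oneForm, bracket_wedge_oneForm, bracket_wedgePow_twoForm],
      show bracket (wedgePow (twoForm B') (j + 1)) n = twoElement B' ^ (j + 1) by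
        rw [← bracket_wedgePow_twoForm]; exact congrArg (bracket _) (by omega)]
    -- This product has degree 2j + 3 and there are only n = 2j + 2 generators. Contracting the
    -- relation with `r` yields the claim.
    have h0 : ι ℂ c' * twoElement B' ^ (j + 1) = 0 := by
      rw [← bracket_wedgePow_twoForm, ← bracket_wedge_oneForm]
      exact bracket_of_lt _ (by omega)
    have h2 := contr_ι_mul r c' (twoElement B' ^ (j + 1))
    rw [h0, map_zero, contr_twoElement_pow hB', ← hl', mul_smul_comm] at h2
    have h3 := congrArg (top n) (sub_eq_zero.1 h2.symm)
    rw [map_smul, map_smul, smul_eq_mul, smul_eq_mul] at h3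
    rw [← h3]
    congr 1
    exact Finset.sum_congr rfl fun b _ => mul_comm _ _
  · rw [wedgePow_twoForm_of_ne _ _ (by omega), wedge_oneForm_eq_zero, mul_zero, mul_zero]
    exact fun _ => wedge_oneForm_eq_zero _ _ _ fun _ => wedgePow_twoForm_of_ne _ _ (by omega)

end Bracket

/-! ### Wedge products with exponentials; alternating maps with the last arguments fixed -/

section AlgebraMore

lemma wedge_congr_right {T : Type*} (a : PreForm T) {b b' : PreForm T} {r : ℕ}
    (h : ∀ p ≤ r, ∀ v, b p v = b' p v) (v : Fin r → T) : wedge a b r v = wedge a b' r v := by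
  simp only [wedge]
  refine Finset.sum_congr rfl fun p _ => ?_
  congr 1
  refine Finset.sum_congr rfl fun σ _ => ?_
  rw [h _ (Nat.sub_le _ _)]

lemma wedge_sum_right {T ι : Type*} (a : PreForm T) (s : Finset ι) (κ : ι → ℂ)
    (b : ι → PreForm T) (r : ℕ) (v : Fin r → T) :
    wedge a (fun p v => ∑ j ∈ s, κ j * b j p v) r v = ∑ j ∈ s, κ j * wedge a (b j) r v := by
  simp only [wedge, Finset.mul_sum]
  rw [Finset.sum_comm (s := s)]
  refine Finset.sum_congr rfl fun p _ => ?_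
  rw [Finset.sum_comm (s := s)]
  refine Finset.sum_congr rfl fun σ _ => Finset.sum_congr rfl fun j _ => ?_
  ring

lemma wedge_smul_right {T : Type*} (a : PreForm T) (κ : ℂ) (b : PreForm T) (r : ℕ)
    (v : Fin r → T) : wedge a (fun p v => κ * b p v) r v = κ * wedge a b r v := by
  have := wedge_sum_right a (Finset.univ : Finset Unit) (fun _ => κ) (fun _ => b) r v
  simpa using this

lemma wedge_smul_left {T : Type*} (a : PreForm T) (κ : ℂ) (b : PreForm T) (r : ℕ)
    (v : Fin r → T) : wedge (fun p v => κ * a p v) b r v = κ * wedge a b r v := by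
  simp only [wedge, Finset.mul_sum]
  refine Finset.sum_congr rfl fun p _ => Finset.sum_congr rfl fun σ _ => ?_
  ring

lemma wedge_integral {T S : Type*} [MeasurableSpace S] (ν : Measure S) (a : PreForm T)
    (b : S → PreForm T) (hb : ∀ p v, Integrable (fun t => b t p v) ν) (r : ℕ) (v : Fin r → T) :
    wedge a (fun p v => ∫ t, b t p v ∂ν) r v = ∫ t, wedge a (b t) r v ∂ν := by
  simp only [wedge]
  rw [integral_finsetSum]
  · refine Finset.sum_congr rfl fun p _ => ?_
    rw [integral_const_mul, integral_finsetSum]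
    · simp only [integral_const_mul]
    · exact fun σ _ => ((hb _ _).const_mul _).const_mul _
  · exact fun p _ => (integrable_finsetSum _ fun σ _ =>
      ((hb _ _).const_mul _).const_mul _).const_mul _

lemma wedgePow_smul {T : Type*} (a : PreForm T) (κ : ℂ) (j : ℕ) :
    wedgePow (fun p v => κ * a p v) j = fun p v => κ ^ j * wedgePow a j p v := by
  induction j with
  | zero => simp [wedgePow]
  | succ j ih =>
    funext p v
    simp only [wedgePow]
    rw [ih, wedge_smul_right, wedge_smul_left]
    ring

lemma twoForm_smul {T : Type*} (B : T → T → ℂ) (κ : ℂ) :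
    twoForm (fun v w => κ * B v w) = fun p v => κ * twoForm B p v := by
  funext p v
  rcases p with _ | _ | _ | p <;> simp [twoForm]

/-- The j-th power has degree 2j, so the sum may be cut off at any `N` above p. A cutoff common to
several degrees allows the sum to be pulled out of a wedge product. -/
lemma expTwo_smul {T : Type*} (B : T → T → ℂ) (κ : ℂ) {N p : ℕ} (h : p < N) (v : Fin p → T) :
    expTwo (fun v w => κ * B v w) p v =
      ∑ j ∈ Finset.range N, (κ ^ j / (j.factorial : ℂ)) * wedgePow (twoForm B) j p v := by
  rw [expTwo, twoForm_smul]
  simp only [wedgePow_smul]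
  rw [Finset.sum_subset (Finset.range_subset_range.2 h)]
  · exact Finset.sum_congr rfl fun j _ => by ring
  · intro j _ hj
    rw [Finset.mem_range, not_lt] at hj
    rw [wedgePow_twoForm_of_ne _ _ (by omega)]
    ring

/-- `κ c ∧ l ∧ exp(κB) = c(R) exp(κB)` on the vectors `u`, if `l = ι(R) B` with `R` in the span of
`u`. -/
lemma wedge_wedge_expTwo {T : Type*} [AddCommGroup T] [Module ℝ T] {n : ℕ} (c l : T →ₗ[ℝ] ℂ)
    (B : T →ₗ[ℝ] T →ₗ[ℝ] ℂ) (hB : ∀ v, B v v = 0) (u : Fin n → T) (r : Fin n → ℂ)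
    (hl : ∀ a, l (u a) = ∑ b, r b * B (u b) (u a)) (κ : ℂ) :
    κ * wedge (oneForm (fun v => c v)) (wedge (oneForm (fun v => l v))
        (expTwo (fun v w => κ * B v w))) n u =
      (∑ b, r b * c (u b)) * expTwo (fun v w => κ * B v w) n u := by
  rw [wedge_congr_right _ (fun p hp v => wedge_congr_right _ (fun q hq w =>
    expTwo_smul (fun v w => B v w) κ (show q < n + 1 by omega) w) v)]
  rw [wedge_congr_right _ (fun p hp v => wedge_sum_right _ _ _ _ _ _), wedge_sum_right,
    expTwo_smul (fun v w => B v w) κ (show n < n + 2 by omega), Finset.sum_range_succ' _ (n + 1)]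
  -- The term j = 0 on the right has no partner on the left. It vanishes because its power has
  -- degree 0, unless n = 0, when the sum over `b` is empty.
  have h0 : (∑ b, r b * c (u b)) * wedgePow (twoForm fun v w => (B v) w) 0 n u = 0 := by
    rcases n with _ | n
    · simp
    · simp [wedgePow, scalarForm]
  rw [mul_add, Finset.mul_sum, Finset.mul_sum, mul_left_comm _ (κ ^ 0 / _), h0, mul_zero, add_zero]
  refine Finset.sum_congr rfl fun j _ => ?_
  have h1 := wedge_wedge_wedgePow c l B hB u r hl j
  have h2 : (j.factorial : ℂ) ≠ 0 := by exact_mod_cast j.factorial_ne_zero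
  have h3 : (j : ℂ) + 1 ≠ 0 := by exact_mod_cast j.succ_ne_zero
  rw [mul_left_comm (∑ b, r b * c (u b)), ← h1, Nat.factorial_succ]
  push_cast
  field_simp
  ring

section Append

variable {T : Type*} [AddCommGroup T] [Module ℝ T] {p k : ℕ} (A : T [⋀^Fin (p + k)]→ₗ[ℝ] ℂ)

/-- An alternating map as a multilinear map of its first `p` and its last `k` arguments. -/
def splitAlt : MultilinearMap ℝ (fun _ : Fin p => T) (MultilinearMap ℝ (fun _ : Fin k => T) ℂ) :=
  (A.toMultilinearMap.domDomCongr finSumFinEquiv.symm).currySum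

lemma splitAlt_apply (v : Fin p → T) (b : Fin k → T) : splitAlt A v b = A (Fin.append v b) := by
  simp only [splitAlt, MultilinearMap.currySum_apply, MultilinearMap.domDomCongr_apply]
  change A _ = _
  congr 1
  funext i
  refine Fin.addCases (fun l => ?_) (fun l => ?_) i <;> simp

lemma append_eq_zero_of_mem_span (v : Fin p → T) (b : Fin k → T) (i : Fin p)
    (h : v i ∈ Submodule.span ℝ (Set.range b)) : A (Fin.append v b) = 0 := by
  refine A.map_linearDependent _ fun hli => ?_
  have := hli.notMem_span_image (s := Set.range (Fin.natAdd p)) (x := Fin.castAdd k i) (by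
    rintro ⟨j, hj⟩
    have := congrArg Fin.val hj
    simp at this
    omega)
  apply this
  rw [← Set.range_comp]
  simpa [Function.comp_def] using h

/-- Expanding multilinearly, every term that contains some `c i` has linearly dependent arguments.
For fibre integrals this means that horizontal vectors matter only modulo vertical ones. -/
lemma append_add_of_mem_span (v c : Fin p → T) (b : Fin k → T)
    (h : ∀ i, c i ∈ Submodule.span ℝ (Set.range b)) :
    A (Fin.append (v + c) b) = A (Fin.append v b) := by
  classical
  rw [← splitAlt_apply, MultilinearMap.map_add_univ, sum_apply,
    Finset.sum_eq_single Finset.univ]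
  · rw [Finset.piecewise_univ, splitAlt_apply]
  · intro s _ hs
    obtain ⟨i, hi⟩ : ∃ i, i ∉ s := by
      by_contra! hall
      exact hs (Finset.eq_univ_iff_forall.2 hall)
    rw [splitAlt_apply]
    refine append_eq_zero_of_mem_span A _ b i ?_
    rw [Finset.piecewise_eq_of_notMem _ _ _ hi]
    exact h i
  · simp

/-- With `v` fixed and the last slots restricted to combinations of `b`, one has an alternating
k-form on ℝᵏ, which is a multiple of the determinant. -/
lemma append_sum_smul (v : Fin p → T) (b : Fin k → T) (g : Matrix (Fin k) (Fin k) ℝ) :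
    A (Fin.append v (fun j => ∑ i, g j i • b i)) = (g.det : ℂ) * A (Fin.append v b) := by
  let L : (Fin k → ℝ) →ₗ[ℝ] T := Fintype.linearCombination ℝ b
  let G : (Fin k → ℝ) [⋀^Fin k]→ₗ[ℝ] ℂ :=
    { (splitAlt A v).compLinearMap (fun _ => L) with
      map_eq_zero_of_eq' := by
        intro y i j hij hne
        change (splitAlt A v) (fun k => L (y k)) = 0
        rw [splitAlt_apply]
        refine A.map_eq_zero_of_eq _ (i := Fin.natAdd p i) (j := Fin.natAdd p j) ?_ ?_
        · simp [hij]
        · simpa using hne }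
  have hG : ∀ y, G y = A (Fin.append v (fun j => ∑ i, y j i • b i)) := by
    intro y
    change (splitAlt A v) (fun k => L (y k)) = _
    rw [splitAlt_apply]
    rfl
  have h1 : G = (LinearMap.toSpanSingleton ℝ ℂ (A (Fin.append v b))).compAlternatingMap
      Matrix.detRowAlternating := by
    refine (Pi.basisFun ℝ (Fin k)).ext_alternating fun σ hσ => ?_
    let τ : Equiv.Perm (Fin k) := Equiv.ofBijective σ (Finite.injective_iff_bijective.1 hσ)
    have h2 : (fun i => (Pi.basisFun ℝ (Fin k)) (σ i)) = (fun i => (Pi.basisFun ℝ (Fin k)) i) ∘ τ :=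
      rfl
    have h3 : G (fun i => (Pi.basisFun ℝ (Fin k)) i) = A (Fin.append v b) := by
      rw [hG]
      congr 2
      funext j
      simp [Pi.single_apply]
    have h4 : Matrix.detRowAlternating (fun i => (Pi.basisFun ℝ (Fin k)) i) = (1 : ℝ) := by
      rw [← Matrix.det_one (n := Fin k)]
      change Matrix.det _ = _
      congr 1
      ext i j
      simp [Matrix.one_apply, Pi.single_apply, eq_comm]
    rw [h2, AlternatingMap.map_perm, AlternatingMap.map_perm, h3,
      LinearMap.compAlternatingMap_apply, h4]
    simp
  refine (hG g).symm.trans ?_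
  rw [h1]
  exact Complex.real_smul

lemma append_smul (v : Fin p → T) (b : Fin k → T) (t : ℝ) :
    A (Fin.append v (fun j => t • b j)) = (t : ℂ) ^ k * A (Fin.append v b) := by
  rw [← splitAlt_apply, MultilinearMap.map_smul_univ, splitAlt_apply]
  simp

end Append

end AlgebraMore

/-! ### Rapid decrease of the transforms of test functions, with seminorm bounds -/

section Fourier

variable {W : Type*} [NormedAddCommGroup W] [NormedSpace ℝ W] [FiniteDimensional ℝ W]
  [MeasurableSpace W] [BorelSpace W] (μ : Measure W) [μ.IsAddHaarMeasure]

/-- The transform `a ↦ ∫ φ(X) e^{i a(X)} dX` on the dual space. -/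
def fhat (φ : W → ℂ) (a : W →L[ℝ] ℝ) : ℂ := ∫ X, φ X * Complex.exp (Complex.I * (a X : ℂ)) ∂μ

/-- The pairing which turns `fhat` into Mathlib's Fourier integral. -/
def fourierPairing (W : Type*) [NormedAddCommGroup W] [NormedSpace ℝ W] :
    W →L[ℝ] (W →L[ℝ] ℝ) →L[ℝ] ℝ :=
  (-(2 * Real.pi)⁻¹) • (ContinuousLinearMap.id ℝ (W →L[ℝ] ℝ)).flip

-- The standard additive character is s ↦ e^{2πis} and enters the Fourier integral with a minus
-- sign, which explains the factor -(2π)⁻¹ in `fourierPairing`.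
omit [FiniteDimensional ℝ W] [BorelSpace W] [μ.IsAddHaarMeasure] in
lemma fhat_eq_fourierIntegral (φ : W → ℂ) :
    fhat μ φ = VectorFourier.fourierIntegral Real.fourierChar μ
      (fourierPairing W).toLinearMap₁₂ φ := by
  funext a
  rw [fhat, VectorFourier.fourierIntegral]
  refine integral_congr_ae (Filter.Eventually.of_forall fun X => ?_)
  have h : (fourierPairing W).toLinearMap₁₂ X a = -(2 * Real.pi)⁻¹ * a X := by
    simp [fourierPairing]
  change _ = Real.fourierChar (-(fourierPairing W).toLinearMap₁₂ X a) • φ X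
  rw [h, Circle.smul_def, Real.fourierChar_apply, smul_eq_mul, mul_comm]
  have : (Real.pi : ℂ) ≠ 0 := by exact_mod_cast Real.pi_ne_zero
  push_cast
  field_simp

omit [FiniteDimensional ℝ W] in
lemma integrable_pow_mul_iteratedFDeriv {φ : W → ℂ} (hφ : ContDiff ℝ ∞ φ)
    (hc : HasCompactSupport φ) (k n : ℕ) :
    Integrable (fun v => ‖v‖ ^ k * ‖iteratedFDeriv ℝ n φ v‖) μ := by
  refine Continuous.integrable_of_hasCompactSupport ?_ ?_
  · exact (continuous_norm.pow k).mul
      (hφ.continuous_iteratedFDeriv (by exact_mod_cast le_top)).norm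
  · exact (hc.iteratedFDeriv n).norm.mul_left

lemma contDiff_fhat {φ : W → ℂ} (hφ : ContDiff ℝ ∞ φ) (hc : HasCompactSupport φ) :
    ContDiff ℝ ∞ (fhat μ φ) := by
  rw [fhat_eq_fourierIntegral]
  refine VectorFourier.contDiff_fourierIntegral (N := ⊤) _ fun n _ => ?_
  simpa using integrable_pow_mul_iteratedFDeriv μ hφ hc n 0

/-- Multiplication by powers of `L v a` corresponds to differentiating φ in the direction v. The
restriction to the unit ball removes v from the constant, which is also independent of φ. -/
lemma exists_pow_mul_fourierIntegral_le {W' : Type*} [NormedAddCommGroup W'] [NormedSpace ℝ W']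
    (L : W →L[ℝ] W' →L[ℝ] ℝ) (n N : ℕ) : ∃ c : ℝ, 0 ≤ c ∧
    ∀ φ : W → ℂ, ContDiff ℝ ∞ φ → HasCompactSupport φ → ∀ v : W, ‖v‖ ≤ 1 → ∀ a : W',
    |L v a| ^ N * ‖iteratedFDeriv ℝ n (VectorFourier.fourierIntegral Real.fourierChar μ
      L.toLinearMap₁₂ φ) a‖ ≤
      c * ∑ p ∈ Finset.range (n + 1) ×ˢ Finset.range (N + 1),
        ∫ v, ‖v‖ ^ p.1 * ‖iteratedFDeriv ℝ p.2 φ v‖ ∂μ := by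
  refine ⟨(2 * Real.pi * ‖L‖) ^ n * (2 * n + 2) ^ N, by positivity, fun φ hφ hc v hv a => ?_⟩
  refine (VectorFourier.pow_mul_norm_iteratedFDeriv_fourierIntegral_le L
      (μ := μ) (K := ⊤) (N := ⊤) (f := φ) hφ
      (fun k n _ _ => integrable_pow_mul_iteratedFDeriv μ hφ hc k n)
      (k := n) (n := N) le_top le_top v a).trans ?_
  refine mul_le_mul_of_nonneg_right ?_
    (Finset.sum_nonneg fun p _ => integral_nonneg fun v => by positivity)
  rw [mul_assoc]
  exact mul_le_of_le_one_left (by positivity) (pow_le_one₀ (norm_nonneg _) hv)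

/-- The transforms of the test functions with support in a compact set are rapidly decreasing,
uniformly in terms of seminorms. -/
lemma exists_fhat_decay (K : Set W) (hK : IsCompact K) (n N : ℕ) : ∃ C : ℝ, 0 ≤ C ∧
    ∀ φ : W → ℂ, ContDiff ℝ ∞ φ → tsupport φ ⊆ K →
    ∀ b : ℝ, (∀ j ≤ N, ∀ X, ‖iteratedFDeriv ℝ j φ X‖ ≤ b) →
    ∀ a, ‖a‖ ^ N * ‖iteratedFDeriv ℝ n (fhat μ φ) a‖ ≤ C * b := by
  obtain ⟨R, hR⟩ := hK.isBounded.exists_norm_le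
  let R' := max R 0
  have hμ : μ K ≠ ⊤ := hK.measure_lt_top.ne
  obtain ⟨c, hc0, hcb⟩ := exists_pow_mul_fourierIntegral_le μ (fourierPairing W) n N
  let C₀ : ℝ := c * ∑ p ∈ Finset.range (n + 1) ×ˢ Finset.range (N + 1), R' ^ p.1 * μ.real K
  have hC₀ : 0 ≤ C₀ := by positivity
  -- The factor (2π)ᴺ undoes the normalization of `fourierPairing`. The other factor 2ᴺ comes from
  -- choosing a vector v in the unit ball with ‖a‖ ≤ 2 |a v|.
  refine ⟨(4 * Real.pi) ^ N * C₀, by positivity, fun φ hφ hsupp b hb a => ?_⟩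
  have hc : HasCompactSupport φ := hK.of_isClosed_subset (isClosed_tsupport φ) hsupp
  have hb0 : 0 ≤ b := (norm_nonneg _).trans (hb 0 (Nat.zero_le _) 0)
  have hint : ∀ p ∈ Finset.range (n + 1) ×ˢ Finset.range (N + 1),
      ∫ v, ‖v‖ ^ p.1 * ‖iteratedFDeriv ℝ p.2 φ v‖ ∂μ ≤ R' ^ p.1 * μ.real K * b := by
    intro p hp
    have hzero : ∀ v ∉ K, ‖v‖ ^ p.1 * ‖iteratedFDeriv ℝ p.2 φ v‖ = 0 := by
      intro v hv
      have : v ∉ tsupport (iteratedFDeriv ℝ p.2 φ) := fun h =>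
        hv (hsupp (tsupport_iteratedFDeriv_subset p.2 h))
      rw [image_eq_zero_of_notMem_tsupport this, norm_zero, mul_zero]
    rw [← setIntegral_eq_integral_of_forall_compl_eq_zero hzero]
    calc ∫ v in K, ‖v‖ ^ p.1 * ‖iteratedFDeriv ℝ p.2 φ v‖ ∂μ
        ≤ ∫ v in K, R' ^ p.1 * b ∂μ := by
          refine setIntegral_mono_on (integrable_pow_mul_iteratedFDeriv μ hφ hc _ _).integrableOn
            (integrableOn_const hμ) hK.measurableSet fun v hv => ?_
          have h1 : ‖v‖ ≤ R' := (hR v hv).trans (le_max_left _ _)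
          have h2 := hb p.2 (by simp at hp; omega) v
          gcongr
      _ = R' ^ p.1 * μ.real K * b := by
          rw [setIntegral_const, smul_eq_mul]; ring
  have main : ∀ v : W, ‖v‖ ≤ 1 →
      |a v| ^ N * ‖iteratedFDeriv ℝ n (fhat μ φ) a‖ ≤ (2 * Real.pi) ^ N * (C₀ * b) := by
    intro v hv
    have := hcb φ hφ hc v hv a
    rw [← fhat_eq_fourierIntegral] at this
    have h1 : |fourierPairing W v a| = (2 * Real.pi)⁻¹ * |a v| := by
      have : fourierPairing W v a = -(2 * Real.pi)⁻¹ * a v := by simp [fourierPairing]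
      rw [this, abs_mul, abs_neg, abs_of_pos (by positivity)]
    rw [h1, mul_pow, inv_pow, mul_assoc, inv_mul_le_iff₀ (by positivity)] at this
    refine this.trans (mul_le_mul_of_nonneg_left ?_ (by positivity))
    rw [mul_assoc, Finset.sum_mul]
    exact mul_le_mul_of_nonneg_left (Finset.sum_le_sum hint) hc0
  by_cases ha : ‖a‖ = 0
  · have := main 0 (by simp)
    rcases N with _ | N
    · simpa using this
    · rw [ha, zero_pow (by omega), zero_mul]
      positivity
  · obtain ⟨v, hv, hav⟩ := a.exists_lt_apply_of_lt_opNorm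
      (show ‖a‖ / 2 < ‖a‖ by have := norm_nonneg a; have : 0 < ‖a‖ := by positivity
                             linarith)
    have h1 : ‖a‖ ≤ 2 * |a v| := by rw [Real.norm_eq_abs] at hav; linarith
    calc ‖a‖ ^ N * ‖iteratedFDeriv ℝ n (fhat μ φ) a‖
        ≤ (2 * |a v|) ^ N * ‖iteratedFDeriv ℝ n (fhat μ φ) a‖ := by gcongr
      _ = 2 ^ N * (|a v| ^ N * ‖iteratedFDeriv ℝ n (fhat μ φ) a‖) := by ring
      _ ≤ 2 ^ N * ((2 * Real.pi) ^ N * (C₀ * b)) := by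
          exact mul_le_mul_of_nonneg_left (main v hv.le) (by positivity)
      _ = (4 * Real.pi) ^ N * C₀ * b := by
          rw [show (4 * Real.pi : ℝ) = 2 * (2 * Real.pi) by ring, mul_pow 2 (2 * Real.pi)]; ring

/-- A version of `exists_fhat_decay` with the weight `(1 + ‖a‖)ᴺ`. -/
lemma exists_fhat_decay_one_add (K : Set W) (hK : IsCompact K) (n N : ℕ) : ∃ C : ℝ, 0 ≤ C ∧
    ∀ φ : W → ℂ, ContDiff ℝ ∞ φ → tsupport φ ⊆ K →
    ∀ b : ℝ, (∀ j ≤ N, ∀ X, ‖iteratedFDeriv ℝ j φ X‖ ≤ b) →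
    ∀ a, (1 + ‖a‖) ^ N * ‖iteratedFDeriv ℝ n (fhat μ φ) a‖ ≤ C * b := by
  obtain ⟨C₁, hC₁, h₁⟩ := exists_fhat_decay μ K hK n 0
  obtain ⟨C₂, hC₂, h₂⟩ := exists_fhat_decay μ K hK n N
  refine ⟨2 ^ N * (C₁ + C₂), by positivity, fun φ hφ hs b hb a => ?_⟩
  have hx := h₁ φ hφ hs b (fun j hj => hb j (by omega)) a
  have hy := h₂ φ hφ hs b hb a
  have : (1 + ‖a‖) ^ N ≤ 2 ^ N * (1 + ‖a‖ ^ N) := by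
    rcases le_total 1 ‖a‖ with h | h
    · calc (1 + ‖a‖) ^ N ≤ (2 * ‖a‖) ^ N := by gcongr; linarith
        _ = 2 ^ N * ‖a‖ ^ N := mul_pow _ _ _
        _ ≤ _ := by gcongr; linarith
    · calc (1 + ‖a‖) ^ N ≤ 2 ^ N := by gcongr; linarith
        _ = 2 ^ N * 1 := (mul_one _).symm
        _ ≤ _ := by gcongr; have := pow_nonneg (norm_nonneg a) N; linarith
  calc (1 + ‖a‖) ^ N * ‖iteratedFDeriv ℝ n (fhat μ φ) a‖
      ≤ 2 ^ N * (1 + ‖a‖ ^ N) * ‖iteratedFDeriv ℝ n (fhat μ φ) a‖ := by gcongr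
    _ = 2 ^ N * (‖a‖ ^ 0 * ‖iteratedFDeriv ℝ n (fhat μ φ) a‖ +
          ‖a‖ ^ N * ‖iteratedFDeriv ℝ n (fhat μ φ) a‖) := by ring
    _ ≤ 2 ^ N * (C₁ * b + C₂ * b) := by gcongr
    _ = _ := by ring

end Fourier

/-! ### Differentiation under the integral sign to all orders -/

section ParametricIntegral

variable {V : Type*} [NormedAddCommGroup V] [NormedSpace ℝ V]
  {X : Type*} [NormedAddCommGroup X] [NormedSpace ℝ X] [FiniteDimensional ℝ X]
  [MeasurableSpace X] [BorelSpace X] (ν : Measure X)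
  {F : Type*} [NormedAddCommGroup F] [NormedSpace ℝ F] [CompleteSpace F]

/-- The `n`-th derivative in the first variable, in terms of the `n`-th joint derivative. -/
def sliceDeriv (h : V × X → F) (n : ℕ) (y : V) (x : X) : V [×n]→L[ℝ] F :=
  (iteratedFDeriv ℝ n h (y, x)).compContinuousLinearMap fun _ => ContinuousLinearMap.inl ℝ V X

omit [FiniteDimensional ℝ X] [MeasurableSpace X] [BorelSpace X] [CompleteSpace F] in
lemma norm_sliceDeriv_le (h : V × X → F) (n : ℕ) (y : V) (x : X) :
    ‖sliceDeriv h n y x‖ ≤ ‖iteratedFDeriv ℝ n h (y, x)‖ := by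
  refine (ContinuousMultilinearMap.norm_compContinuousLinearMap_le _ _).trans ?_
  refine mul_le_of_le_one_right (norm_nonneg _) (Finset.prod_le_one (fun _ _ => norm_nonneg _)
    fun _ _ => ContinuousLinearMap.norm_inl_le_one ℝ V X)

-- Restricting all arguments of the joint derivative to the first factor commutes with one more
-- differentiation in that factor, by the chain rule.
omit [FiniteDimensional ℝ X] [MeasurableSpace X] [BorelSpace X] [CompleteSpace F] in
lemma hasFDerivAt_sliceDeriv {O : Set V} (hO : IsOpen O) {h : V × X → F}
    (hh : ContDiffOn ℝ ∞ h (O ×ˢ Set.univ)) (n : ℕ) {y : V} (hy : y ∈ O) (x : X) :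
    HasFDerivAt (fun y => sliceDeriv h n y x) (sliceDeriv h (n + 1) y x).curryLeft y := by
  have hS : IsOpen (O ×ˢ (Set.univ : Set X)) := hO.prod isOpen_univ
  have hat : ContDiffAt ℝ ∞ h (y, x) := hh.contDiffAt (hS.mem_nhds ⟨hy, trivial⟩)
  have hd : DifferentiableAt ℝ (iteratedFDeriv ℝ n h) (y, x) :=
    hat.differentiableAt_iteratedFDeriv (by exact_mod_cast ENat.natCast_lt_top n)
  have h1 : HasFDerivAt (iteratedFDeriv ℝ n h) (iteratedFDeriv ℝ (n + 1) h (y, x)).curryLeft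
      (y, x) := by
    have := hd.hasFDerivAt
    rwa [show fderiv ℝ (iteratedFDeriv ℝ n h) (y, x) =
      (iteratedFDeriv ℝ (n + 1) h (y, x)).curryLeft by
        rw [iteratedFDeriv_succ_eq_comp_left]; rfl] at this
  have h2 : HasFDerivAt (fun y : V => (y, x)) (ContinuousLinearMap.inl ℝ V X) y :=
    hasFDerivAt_prodMk_left y x
  have h3 := (ContinuousMultilinearMap.compContinuousLinearMapL (F := F) (𝕜 := ℝ)
    (fun _ : Fin n => ContinuousLinearMap.inl ℝ V X)).hasFDerivAt.comp y (h1.comp y h2)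
  refine h3.congr_fderiv ?_
  ext v w
  simp [sliceDeriv]
  congr 1
  funext i
  refine Fin.cases ?_ (fun j => ?_) i <;> simp

omit [MeasurableSpace X] [BorelSpace X] [FiniteDimensional ℝ X] [CompleteSpace F] in
lemma continuous_sliceDeriv {O : Set V} (hO : IsOpen O) {h : V × X → F}
    (hh : ContDiffOn ℝ ∞ h (O ×ˢ Set.univ)) (n : ℕ) {y : V} (hy : y ∈ O) :
    Continuous (fun x => sliceDeriv h n y x) := by
  have hS : IsOpen (O ×ˢ (Set.univ : Set X)) := hO.prod isOpen_univ
  refine (ContinuousMultilinearMap.compContinuousLinearMapL (F := F) (𝕜 := ℝ)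
    (fun _ : Fin n => ContinuousLinearMap.inl ℝ V X)).continuous.comp ?_
  refine continuous_iff_continuousAt.2 fun x => ?_
  have hat : ContDiffAt ℝ ∞ h (y, x) := hh.contDiffAt (hS.mem_nhds ⟨hy, trivial⟩)
  have hd : DifferentiableAt ℝ (iteratedFDeriv ℝ n h) (y, x) :=
    hat.differentiableAt_iteratedFDeriv (by exact_mod_cast ENat.natCast_lt_top n)
  exact hd.continuousAt.comp (f := fun x => (y, x)) (by fun_prop)

omit [CompleteSpace F] in
lemma integrable_sliceDeriv {O : Set V} (hO : IsOpen O) {h : V × X → F}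
    (hh : ContDiffOn ℝ ∞ h (O ×ˢ Set.univ)) {bound : ℕ → X → ℝ}
    (hbound : ∀ n, Integrable (bound n) ν)
    (hle : ∀ n, ∀ y ∈ O, ∀ x, ‖iteratedFDeriv ℝ n h (y, x)‖ ≤ bound n x) (n : ℕ) {y : V}
    (hy : y ∈ O) : Integrable (fun x => sliceDeriv h n y x) ν :=
  (hbound n).mono' (continuous_sliceDeriv hO hh n hy).aestronglyMeasurable
    (Filter.Eventually.of_forall fun x => (norm_sliceDeriv_le h n y x).trans (hle n y hy x))

-- Dominated differentiation, with the derivative represented through an isometry. With `e` the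
-- currying isometry, the step from order n to n + 1 stays within multilinear maps and keeps the
-- bounds.
omit [NormedAddCommGroup X] [FiniteDimensional ℝ X] [NormedSpace ℝ X] [BorelSpace X] in
lemma hasFDerivAt_integral_of_isometry {F₂ : Type*} [NormedAddCommGroup F₂] [NormedSpace ℝ F₂]
    [CompleteSpace F₂] (e : F₂ →ₗᵢ[ℝ] (V →L[ℝ] F)) {O : Set V} (hO : IsOpen O)
    {p : V → X → F} {p' : V → X → F₂} {bound : X → ℝ}
    (hp : ∀ y ∈ O, Integrable (p y) ν) (hp' : ∀ y ∈ O, Integrable (p' y) ν)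
    (hbound : Integrable bound ν) (hle : ∀ y ∈ O, ∀ x, ‖p' y x‖ ≤ bound x)
    (hderiv : ∀ y ∈ O, ∀ x, HasFDerivAt (fun y => p y x) (e (p' y x)) y) {y : V} (hy : y ∈ O) :
    HasFDerivAt (fun y => ∫ x, p y x ∂ν) (e (∫ x, p' y x ∂ν)) y := by
  have h1 : e (∫ x, p' y x ∂ν) = ∫ x, e (p' y x) ∂ν :=
    (e.toContinuousLinearMap.integral_comp_comm (hp' y hy)).symm
  rw [h1]
  refine hasFDerivAt_integral_of_dominated_of_fderiv_le (hO.mem_nhds hy)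
    (Filter.eventually_of_mem (hO.mem_nhds hy) fun z hz => (hp z hz).aestronglyMeasurable)
    (hp y hy) (e.continuous.comp_aestronglyMeasurable (hp' y hy).aestronglyMeasurable)
    (Filter.Eventually.of_forall fun x z hz => ?_) hbound
    (Filter.Eventually.of_forall fun x z hz => hderiv z hz x)
  rw [e.norm_map]
  exact hle z hz x

/-- An integral depending on a parameter is smooth if all derivatives of the integrand are
dominated by integrable functions. -/
lemma hasFTaylorSeriesUpToOn_integral {O : Set V} (hO : IsOpen O) {h : V × X → F}
    (hh : ContDiffOn ℝ ∞ h (O ×ˢ Set.univ)) {bound : ℕ → X → ℝ}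
    (hbound : ∀ n, Integrable (bound n) ν)
    (hle : ∀ n, ∀ y ∈ O, ∀ x, ‖iteratedFDeriv ℝ n h (y, x)‖ ≤ bound n x) :
    HasFTaylorSeriesUpToOn ∞ (fun y => ∫ x, h (y, x) ∂ν)
      (fun y n => ∫ x, sliceDeriv h n y x ∂ν) O := by
  have hint := fun n {y} (hy : y ∈ O) => integrable_sliceDeriv ν hO hh hbound hle n hy
  have hderiv : ∀ n, ∀ y ∈ O, HasFDerivAt (fun y => ∫ x, sliceDeriv h n y x ∂ν)
      (∫ x, sliceDeriv h (n + 1) y x ∂ν).curryLeft y := by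
    intro n y hy
    exact hasFDerivAt_integral_of_isometry ν
      (continuousMultilinearCurryLeftEquiv ℝ (fun _ : Fin (n + 1) => V) F).toLinearIsometry hO
      (fun y hy => hint n hy) (fun y hy => hint (n + 1) hy) (hbound (n + 1))
      (fun z hz x => (norm_sliceDeriv_le h (n + 1) z x).trans (hle (n + 1) z hz x))
      (fun z hz x => hasFDerivAt_sliceDeriv hO hh n hz x) hy
  refine ⟨fun y hy => ?_, fun n _ y hy => (hderiv n y hy).hasFDerivWithinAt,
    fun n _ y hy => (hderiv n y hy).continuousAt.continuousWithinAt⟩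
  rw [ContinuousMultilinearMap.curry0_apply, ContinuousMultilinearMap.integral_apply (hint 0 hy)]
  simp [sliceDeriv]

lemma contDiffOn_integral {O : Set V} (hO : IsOpen O) {h : V × X → F}
    (hh : ContDiffOn ℝ ∞ h (O ×ˢ Set.univ)) {bound : ℕ → X → ℝ}
    (hbound : ∀ n, Integrable (bound n) ν)
    (hle : ∀ n, ∀ y ∈ O, ∀ x, ‖iteratedFDeriv ℝ n h (y, x)‖ ≤ bound n x) :
    ContDiffOn ℝ ∞ (fun y => ∫ x, h (y, x) ∂ν) O :=
  (hasFTaylorSeriesUpToOn_integral ν hO hh hbound hle).contDiffOn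

/-- On an open set the Taylor series is unique, so the iterated derivative of the integral is the
integral of the `sliceDeriv`, which is bounded by the majorant. -/
lemma norm_iteratedFDeriv_integral_le {O : Set V} (hO : IsOpen O) {h : V × X → F}
    (hh : ContDiffOn ℝ ∞ h (O ×ˢ Set.univ)) {bound : ℕ → X → ℝ}
    (hbound : ∀ n, Integrable (bound n) ν)
    (hle : ∀ n, ∀ y ∈ O, ∀ x, ‖iteratedFDeriv ℝ n h (y, x)‖ ≤ bound n x) (n : ℕ) {y : V}
    (hy : y ∈ O) :
    ‖iteratedFDeriv ℝ n (fun y => ∫ x, h (y, x) ∂ν) y‖ ≤ ∫ x, bound n x ∂ν := by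
  rw [← iteratedFDerivWithin_of_isOpen n hO hy,
    ← (hasFTaylorSeriesUpToOn_integral ν hO hh hbound hle).eq_iteratedFDerivWithin_of_uniqueDiffOn
      (by exact_mod_cast le_top) hO.uniqueDiffOn hy]
  exact norm_integral_le_of_norm_le (hbound n) (Filter.Eventually.of_forall fun x =>
    (norm_sliceDeriv_le h n y x).trans (hle n y hy x))

end ParametricIntegral

/-! ### Functions of polynomial growth along the fibres -/

section Moderate

variable {V : Type*} [NormedAddCommGroup V] [NormedSpace ℝ V]
  {X : Type*} [NormedAddCommGroup X] [NormedSpace ℝ X]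
  {F : Type*} [NormedAddCommGroup F] [NormedSpace ℝ F]

/-- Smooth functions of `(y, x)`, `y ∈ Ω`, all derivatives of which have polynomial growth in `x`,
uniformly for `y ∈ L`. -/
def IsModerate (Ω L : Set V) (g : V × X → F) : Prop :=
  ContDiffOn ℝ ∞ g (Ω ×ˢ Set.univ) ∧ ∀ n : ℕ, ∃ (C : ℝ) (N : ℕ), 0 ≤ C ∧ ∀ y ∈ L, ∀ x,
    ‖iteratedFDerivWithin ℝ n g (Ω ×ˢ Set.univ) (y, x)‖ ≤ C * (1 + ‖x‖) ^ N

variable {Ω L : Set V}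

lemma IsModerate.exists_forall_le {g : V × X → F} (hg : IsModerate Ω L g) (n : ℕ) :
    ∃ (C : ℝ) (N : ℕ), 0 ≤ C ∧ ∀ i ≤ n, ∀ y ∈ L, ∀ x,
      ‖iteratedFDerivWithin ℝ i g (Ω ×ˢ Set.univ) (y, x)‖ ≤ C * (1 + ‖x‖) ^ N := by
  choose C N hC h using hg.2
  refine ⟨∑ i ∈ Finset.range (n + 1), C i, ∑ i ∈ Finset.range (n + 1), N i,
    Finset.sum_nonneg fun i _ => hC i, fun i hi y hy x => (h i y hy x).trans ?_⟩
  have hi' : i ∈ Finset.range (n + 1) := Finset.mem_range.2 (by omega)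
  gcongr
  · exact Finset.sum_nonneg fun i _ => hC i
  · exact Finset.single_le_sum (fun i _ => hC i) hi'
  · linarith [norm_nonneg x]
  · exact Finset.single_le_sum (fun i _ => Nat.zero_le (N i)) hi'

lemma uniqueDiffOn_prod_univ (hΩ : IsOpen Ω) : UniqueDiffOn ℝ (Ω ×ˢ (Set.univ : Set X)) :=
  (hΩ.prod isOpen_univ).uniqueDiffOn

lemma IsModerate.add (hΩ : IsOpen Ω) (hL : L ⊆ Ω) {f g : V × X → F} (hf : IsModerate Ω L f)
    (hg : IsModerate Ω L g) : IsModerate Ω L (f + g) := by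
  refine ⟨hf.1.add hg.1, fun n => ?_⟩
  obtain ⟨C, N, hC, h⟩ := hf.2 n
  obtain ⟨C', N', hC', h'⟩ := hg.2 n
  refine ⟨C + C', N + N', by positivity, fun y hy x => ?_⟩
  have hx : (y, x) ∈ Ω ×ˢ (Set.univ : Set X) := ⟨hL hy, trivial⟩
  rw [iteratedFDerivWithin_add_apply ((hf.1 _ hx).of_le (by exact_mod_cast le_top))
    ((hg.1 _ hx).of_le (by exact_mod_cast le_top)) (uniqueDiffOn_prod_univ hΩ) hx, add_mul]
  have h1 : (1 : ℝ) ≤ 1 + ‖x‖ := by linarith [norm_nonneg x]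
  refine (norm_add_le _ _).trans (add_le_add ((h y hy x).trans ?_) ((h' y hy x).trans ?_))
  · gcongr; omega
  · gcongr; omega

lemma IsModerate.smul {𝕜 : Type*} [NormedField 𝕜] [NormedAlgebra ℝ 𝕜] [NormedSpace 𝕜 F]
    [IsScalarTower ℝ 𝕜 F] (hΩ : IsOpen Ω) (hL : L ⊆ Ω) {f : V × X → 𝕜} {g : V × X → F}
    (hf : IsModerate Ω L f) (hg : IsModerate Ω L g) : IsModerate Ω L (fun z => f z • g z) := by
  refine ⟨hf.1.smul hg.1, fun n => ?_⟩
  obtain ⟨C, N, hC, h⟩ := hf.exists_forall_le n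
  obtain ⟨C', N', hC', h'⟩ := hg.exists_forall_le n
  refine ⟨∑ i ∈ Finset.range (n + 1), (n.choose i : ℝ) * C * C', N + N', by positivity,
    fun y hy x => ?_⟩
  have hx : (y, x) ∈ Ω ×ˢ (Set.univ : Set X) := ⟨hL hy, trivial⟩
  refine (norm_iteratedFDerivWithin_smul_le hf.1 hg.1 (uniqueDiffOn_prod_univ hΩ) hx
    (by exact_mod_cast le_top)).trans ?_
  rw [Finset.sum_mul]
  refine Finset.sum_le_sum fun i hi => ?_
  have hi' : i ≤ n := by have := Finset.mem_range.1 hi; omega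
  calc (n.choose i : ℝ) * ‖iteratedFDerivWithin ℝ i f (Ω ×ˢ Set.univ) (y, x)‖ *
        ‖iteratedFDerivWithin ℝ (n - i) g (Ω ×ˢ Set.univ) (y, x)‖
      ≤ (n.choose i : ℝ) * (C * (1 + ‖x‖) ^ N) * (C' * (1 + ‖x‖) ^ N') := by
        gcongr
        · exact h i hi' y hy x
        · exact h' (n - i) (by omega) y hy x
    _ = _ := by ring

lemma isModerate_comp_fst (hΩ : IsOpen Ω) (hL : L ⊆ Ω) (hLc : IsCompact L) {c : V → F}
    (hc : ContDiffOn ℝ ∞ c Ω) : IsModerate Ω L (fun z : V × X => c z.1) := by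
  refine ⟨hc.comp contDiffOn_fst (fun z hz => hz.1), fun n => ?_⟩
  obtain ⟨C, hC⟩ := hLc.exists_bound_of_continuousOn
    ((hc.continuousOn_iteratedFDerivWithin (m := n) (by exact_mod_cast le_top)
      hΩ.uniqueDiffOn).mono hL)
  refine ⟨max C 0, 0, le_max_right _ _, fun y hy x => ?_⟩
  have hpre : Ω ×ˢ (Set.univ : Set X) = ContinuousLinearMap.fst ℝ V X ⁻¹' Ω := by
    ext z; simp
  have h1 := (ContinuousLinearMap.fst ℝ V X).iteratedFDerivWithin_comp_right (f := c) hc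
    hΩ.uniqueDiffOn (hpre ▸ uniqueDiffOn_prod_univ hΩ) (x := (y, x)) (hL hy) (i := n)
    (by exact_mod_cast le_top)
  rw [← hpre] at h1
  change ‖iteratedFDerivWithin ℝ n (c ∘ ContinuousLinearMap.fst ℝ V X) _ _‖ ≤ _
  rw [h1, pow_zero, mul_one]
  refine (ContinuousMultilinearMap.norm_compContinuousLinearMap_le _ _).trans ?_
  refine (mul_le_of_le_one_right (norm_nonneg _) (Finset.prod_le_one (fun _ _ => norm_nonneg _)
    fun _ _ => ContinuousLinearMap.norm_fst_le ℝ V X)).trans ((hC y hy).trans (le_max_left _ _))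

lemma isModerate_snd_apply (hΩ : IsOpen Ω) (hL : L ⊆ Ω) (l : X →L[ℝ] F) :
    IsModerate Ω L (fun z : V × X => l z.2) := by
  let l' : V × X →L[ℝ] F := l.comp (ContinuousLinearMap.snd ℝ V X)
  have hu := uniqueDiffOn_prod_univ (X := X) hΩ
  refine ⟨l'.contDiff.contDiffOn, fun n => ?_⟩
  refine ⟨‖l‖ + ‖l'‖, 1, by positivity, fun y hy x => ?_⟩
  have hx : (y, x) ∈ Ω ×ˢ (Set.univ : Set X) := ⟨hL hy, trivial⟩
  change ‖iteratedFDerivWithin ℝ n l' _ _‖ ≤ _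
  have h0 := norm_nonneg x
  rcases n with _ | n
  · rw [norm_iteratedFDerivWithin_zero]
    calc ‖l x‖ ≤ ‖l‖ * ‖x‖ := l.le_opNorm x
      _ ≤ (‖l‖ + ‖l'‖) * (1 + ‖x‖) ^ 1 := by
        rw [pow_one]
        gcongr
        · linarith [norm_nonneg l']
        · linarith
  · rw [← norm_iteratedFDerivWithin_fderivWithin hu hx]
    have h1 : ∀ z ∈ Ω ×ˢ (Set.univ : Set X),
        fderivWithin ℝ l' (Ω ×ˢ (Set.univ : Set X)) z = (fun _ => l') z := fun z hz =>
      l'.fderivWithin (hu z hz)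
    rw [iteratedFDerivWithin_congr h1 hx]
    rcases n with _ | n
    · rw [norm_iteratedFDerivWithin_zero, pow_one]
      nlinarith [norm_nonneg l, norm_nonneg l']
    · rw [iteratedFDerivWithin_succ_const]
      simp only [Pi.zero_apply, norm_zero]
      positivity

/-- Functions of moderate growth form an algebra. -/
def moderate (X : Type*) [NormedAddCommGroup X] [NormedSpace ℝ X] (hΩ : IsOpen Ω) (hL : L ⊆ Ω)
    (hLc : IsCompact L) : Subalgebra ℂ (V × X → ℂ) where
  carrier := {f | IsModerate Ω L f}
  mul_mem' := fun hf hg => IsModerate.smul (𝕜 := ℂ) hΩ hL hf hg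
  add_mem' := fun hf hg => IsModerate.add hΩ hL hf hg
  algebraMap_mem' := fun r => isModerate_comp_fst hΩ hL hLc (c := fun _ => r) contDiffOn_const

lemma IsModerate.sum {ι : Type*} (hΩ : IsOpen Ω) (hL : L ⊆ Ω) (hLc : IsCompact L) (s : Finset ι)
    {f : ι → V × X → F} (hf : ∀ i ∈ s, IsModerate Ω L (f i)) :
    IsModerate Ω L (fun z => ∑ i ∈ s, f i z) := by
  classical
  induction s using Finset.induction_on with
  | empty =>
    simpa using isModerate_comp_fst hΩ hL hLc (c := fun _ => (0 : F)) contDiffOn_const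
  | insert i s hi ih =>
    simp only [Finset.sum_insert hi]
    exact (hf i (Finset.mem_insert_self _ _)).add hΩ hL
      (ih fun j hj => hf j (Finset.mem_insert_of_mem hj))

/-- The product of a rapidly decreasing function of `g(y, x)` with a function of moderate growth. -/
lemma exists_rapid {G : Type*} [NormedAddCommGroup G] [NormedSpace ℝ G] (hΩ : IsOpen Ω)
    (hL : L ⊆ Ω) {g : V × X → G} (hg : IsModerate Ω L g) {P : V × X → ℂ} (hP : IsModerate Ω L P)
    {c : ℝ} (hc : 0 < c) (hlow : ∀ y ∈ L, ∀ x, 1 + ‖x‖ ≤ c * (1 + ‖g (y, x)‖)) (n R : ℕ) :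
    ∃ (N : ℕ) (C : ℝ), 0 ≤ C ∧ ∀ Ψ : G → ℂ, ContDiff ℝ ∞ Ψ → ∀ b : ℝ,
      (∀ i ≤ n, ∀ a, (1 + ‖a‖) ^ N * ‖iteratedFDeriv ℝ i Ψ a‖ ≤ b) → ∀ y ∈ L, ∀ x,
      ‖iteratedFDerivWithin ℝ n (fun z => Ψ (g z) * P z) (Ω ×ˢ Set.univ) (y, x)‖ ≤
        C * b * ((1 + ‖x‖) ^ R)⁻¹ := by
  obtain ⟨C₁, N₁, hC₁, h₁⟩ := hg.exists_forall_le n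
  obtain ⟨C₂, N₂, hC₂, h₂⟩ := hP.exists_forall_le n
  have hu := uniqueDiffOn_prod_univ (X := X) hΩ
  -- The decay of Ψ must pay for the desired decay R, for at most n factors of growth N₁ arising
  -- from derivatives of `g` in the chain rule, and for the growth N₂ of `P`.
  let N := R + N₁ * n + N₂
  -- Adding 1 makes D at least 1, so that the bound on the j-th derivative of `g` may be replaced by
  -- the j-th power required in the estimate for a composition.
  let D : ℝ := C₁ + 1
  have hD : 1 ≤ D := by simp only [D]; linarith
  refine ⟨N, ∑ i ∈ Finset.range (n + 1), (n.choose i : ℝ) * (n.factorial * c ^ N * D ^ n) * C₂,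
    by positivity, fun Ψ hΨ b hb y hy x => ?_⟩
  have hx : (y, x) ∈ Ω ×ˢ (Set.univ : Set X) := ⟨hL hy, trivial⟩
  have h1x : (1 : ℝ) ≤ 1 + ‖x‖ := by linarith [norm_nonneg x]
  have hpos : (0 : ℝ) < 1 + ‖x‖ := by linarith
  have hb0 : 0 ≤ b := le_trans (by positivity) (hb 0 (Nat.zero_le _) 0)
  have hΨ1 : ∀ i ≤ n, ‖iteratedFDeriv ℝ i Ψ (g (y, x))‖ ≤ b * c ^ N * ((1 + ‖x‖) ^ N)⁻¹ := by
    intro i hi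
    have h3 := hb i hi (g (y, x))
    have h4 : (1 + ‖x‖) ^ N ≤ c ^ N * (1 + ‖g (y, x)‖) ^ N := by
      rw [← mul_pow]
      exact pow_le_pow_left₀ hpos.le (hlow y hy x) N
    rw [le_mul_inv_iff₀ (by positivity)]
    calc _ ≤ ‖iteratedFDeriv ℝ i Ψ (g (y, x))‖ * (c ^ N * (1 + ‖g (y, x)‖) ^ N) := by gcongr
      _ = c ^ N * ((1 + ‖g (y, x)‖) ^ N * ‖iteratedFDeriv ℝ i Ψ (g (y, x))‖) := by ring
      _ ≤ c ^ N * b := by gcongr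
      _ = b * c ^ N := mul_comm _ _
  have hcomp : ∀ i ≤ n, ‖iteratedFDerivWithin ℝ i (fun z => Ψ (g z)) (Ω ×ˢ Set.univ) (y, x)‖ ≤
      (n.factorial * c ^ N * D ^ n) * b * ((1 + ‖x‖) ^ N)⁻¹ * (1 + ‖x‖) ^ (N₁ * n) := by
    intro i hi
    have h5 := norm_iteratedFDerivWithin_comp_le (g := Ψ) (f := g) (n := i) (t := Set.univ)
      (s := Ω ×ˢ Set.univ) (x := (y, x)) hΨ.contDiffOn hg.1 (by exact_mod_cast le_top)
      uniqueDiffOn_univ hu (Set.mapsTo_univ _ _) hx (C := b * c ^ N * ((1 + ‖x‖) ^ N)⁻¹)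
      (D := D * (1 + ‖x‖) ^ N₁)
      (fun j hj => by rw [iteratedFDerivWithin_univ]; exact hΨ1 j (hj.trans hi))
      (fun j hj1 hj => by
        have h6 : 1 ≤ D * (1 + ‖x‖) ^ N₁ := one_le_mul_of_one_le_of_one_le hD (one_le_pow₀ h1x)
        refine (h₁ j (hj.trans hi) y hy x).trans (le_trans ?_ (le_self_pow₀ h6 (by omega)))
        gcongr
        simp only [D]; linarith)
    refine h5.trans ?_
    have h7 : D ^ i ≤ D ^ n := pow_le_pow_right₀ hD hi
    have h8 : (1 + ‖x‖) ^ (N₁ * i) ≤ (1 + ‖x‖) ^ (N₁ * n) :=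
      pow_le_pow_right₀ h1x (Nat.mul_le_mul_left _ hi)
    have h9 : (i.factorial : ℝ) ≤ n.factorial := by exact_mod_cast Nat.factorial_le hi
    calc (i.factorial : ℝ) * (b * c ^ N * ((1 + ‖x‖) ^ N)⁻¹) * (D * (1 + ‖x‖) ^ N₁) ^ i
        = (i.factorial : ℝ) * (b * c ^ N * ((1 + ‖x‖) ^ N)⁻¹) *
            (D ^ i * (1 + ‖x‖) ^ (N₁ * i)) := by rw [mul_pow, ← pow_mul]
      _ ≤ (n.factorial : ℝ) * (b * c ^ N * ((1 + ‖x‖) ^ N)⁻¹) *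
            (D ^ n * (1 + ‖x‖) ^ (N₁ * n)) := by gcongr
      _ = _ := by ring
  refine (norm_iteratedFDerivWithin_mul_le (hΨ.comp_contDiffOn hg.1) hP.1 hu hx
    (by exact_mod_cast le_top)).trans ?_
  rw [Finset.sum_mul, Finset.sum_mul]
  refine Finset.sum_le_sum fun i hi => ?_
  have hi' : i ≤ n := by have := Finset.mem_range.1 hi; omega
  calc (n.choose i : ℝ) * ‖iteratedFDerivWithin ℝ i (fun z => Ψ (g z)) (Ω ×ˢ Set.univ) (y, x)‖ *
        ‖iteratedFDerivWithin ℝ (n - i) P (Ω ×ˢ Set.univ) (y, x)‖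
      ≤ (n.choose i : ℝ) * ((n.factorial * c ^ N * D ^ n) * b * ((1 + ‖x‖) ^ N)⁻¹ *
          (1 + ‖x‖) ^ (N₁ * n)) * (C₂ * (1 + ‖x‖) ^ N₂) := by
        gcongr
        · exact hcomp i hi'
        · exact h₂ (n - i) (by omega) y hy x
    _ = _ := by
        simp only [N, pow_add]
        field_simp

lemma exists_iteratedFDeriv_bound {W : Type*} [NormedAddCommGroup W] [NormedSpace ℝ W]
    {φ : W → F} (hφ : ContDiff ℝ ∞ φ) (hc : HasCompactSupport φ) (N : ℕ) :
    ∃ b : ℝ, ∀ j ≤ N, ∀ X, ‖iteratedFDeriv ℝ j φ X‖ ≤ b := by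
  have : ∀ j : ℕ, ∃ b : ℝ, ∀ X, ‖iteratedFDeriv ℝ j φ X‖ ≤ b := fun j =>
    (hφ.continuous_iteratedFDeriv (by exact_mod_cast le_top)).bounded_above_of_compact_support
      (hc.iteratedFDeriv j)
  choose b hb using this
  refine ⟨∑ j ∈ Finset.range (N + 1), b j, fun j hj X => (hb j X).trans ?_⟩
  exact Finset.single_le_sum (f := b) (fun i _ => (norm_nonneg _).trans (hb i 0))
    (Finset.mem_range.2 (by omega))

end Moderate

/-! ### Smooth dependence of oscillatory integrals on parameters -/

section Oscillatory

variable {V : Type*} [NormedAddCommGroup V] [NormedSpace ℝ V] [FiniteDimensional ℝ V]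
  {W : Type*} [NormedAddCommGroup W] [NormedSpace ℝ W] [FiniteDimensional ℝ W]
  [MeasurableSpace W] [BorelSpace W] (μ : Measure W) [μ.IsAddHaarMeasure]

-- On the compact product of `L` with the unit sphere the continuous function ‖Σ xⱼ aⱼ(y)‖ has no
-- zero, hence has a positive lower bound d. Homogeneity in x extends it to all x.
omit [NormedSpace ℝ V] [FiniteDimensional ℝ V] in
lemma exists_one_add_norm_le {G : Type*} [NormedAddCommGroup G] [NormedSpace ℝ G] {k : ℕ}
    {a : Fin k → V → G} {Ω L : Set V} (ha : ∀ j, ContinuousOn (a j) Ω)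
    (hinj : ∀ y ∈ Ω, LinearIndependent ℝ fun j => a j y) (hL : L ⊆ Ω) (hLc : IsCompact L) :
    ∃ c : ℝ, 0 < c ∧ ∀ y ∈ L, ∀ x : Fin k → ℝ, 1 + ‖x‖ ≤ c * (1 + ‖∑ j, x j • a j y‖) := by
  have hcont : ContinuousOn (fun z : V × (Fin k → ℝ) => ‖∑ j, z.2 j • a j z.1‖)
      (L ×ˢ Metric.sphere 0 1) := by
    refine ContinuousOn.norm (continuousOn_finsetSum _ fun j _ => ContinuousOn.smul ?_ ?_)
    · exact (by fun_prop : Continuous fun z : V × (Fin k → ℝ) => z.2 j).continuousOn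
    · exact (ha j).comp continuousOn_fst fun z hz => hL hz.1
  obtain ⟨d, hd, hdle⟩ := (hLc.prod (isCompact_sphere 0 1)).exists_forall_le' hcont (a := 0)
    (fun z hz => by
      rw [norm_pos_iff]
      intro h0
      have h1 := Fintype.linearIndependent_iff.1 (hinj z.1 (hL hz.1)) z.2 h0
      have h2 : z.2 = 0 := funext h1
      have := hz.2
      simp [h2] at this)
  refine ⟨1 + d⁻¹, by positivity, fun y hy x => ?_⟩
  have h3 : d * ‖x‖ ≤ ‖∑ j, x j • a j y‖ := by
    by_cases hx : x = 0
    · simp [hx]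
    · have hx' : ‖x‖ ≠ 0 := norm_ne_zero_iff.2 hx
      have := hdle (y, ‖x‖⁻¹ • x) ⟨hy, by simp [norm_smul, hx']⟩
      have h4 : ∑ j, (‖x‖⁻¹ • x) j • a j y = ‖x‖⁻¹ • ∑ j, x j • a j y := by
        rw [Finset.smul_sum]
        exact Finset.sum_congr rfl fun j _ => by simp [mul_smul]
      simp only [h4, norm_smul, norm_inv, norm_norm] at this
      rwa [le_inv_mul_iff₀ (by positivity), mul_comm] at this
  have h5 : ‖x‖ ≤ d⁻¹ * ‖∑ j, x j • a j y‖ := by rwa [le_inv_mul_iff₀ hd]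
  have h6 : 0 ≤ d⁻¹ := by positivity
  nlinarith [norm_nonneg (∑ j, x j • a j y)]

/-- The integrand `fhat φ (∑ⱼ xⱼ aⱼ(y)) P(y, x)`. -/
def oscIntegrand {k : ℕ} (a : Fin k → V → (W →L[ℝ] ℝ)) (P : V × (Fin k → ℝ) → ℂ) (φ : W → ℂ)
    (z : V × (Fin k → ℝ)) : ℂ := fhat μ φ (∑ j, z.2 j • a j z.1) * P z

-- By linear independence Σ xⱼ aⱼ(y) grows at least like x, uniformly on `L`. The rapid decrease of
-- `fhat` thus becomes rapid decrease in x and absorbs the polynomial growth of `P` and of the inner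
-- derivatives.
omit [FiniteDimensional ℝ V] in
lemma exists_oscIntegrand_bound {k : ℕ} {a : Fin k → V → (W →L[ℝ] ℝ)} {Ω L : Set V}
    (hΩ : IsOpen Ω) (ha : ∀ j, ContDiffOn ℝ ∞ (a j) Ω)
    (hinj : ∀ y ∈ Ω, LinearIndependent ℝ fun j => a j y) (hL : L ⊆ Ω) (hLc : IsCompact L)
    {P : V × (Fin k → ℝ) → ℂ} (hP : IsModerate Ω L P) (n R : ℕ) (K : Set W) (hK : IsCompact K) :
    ∃ (m : ℕ) (C : ℝ), 0 ≤ C ∧ ∀ φ : W → ℂ, ContDiff ℝ ∞ φ → tsupport φ ⊆ K →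
      ∀ b : ℝ, (∀ j ≤ m, ∀ X, ‖iteratedFDeriv ℝ j φ X‖ ≤ b) → ∀ y ∈ L, ∀ x,
      ‖iteratedFDerivWithin ℝ n (oscIntegrand μ a P φ) (Ω ×ˢ Set.univ) (y, x)‖ ≤
        C * b * ((1 + ‖x‖) ^ R)⁻¹ := by
  have hg : IsModerate Ω L (fun z : V × (Fin k → ℝ) => ∑ j, z.2 j • a j z.1) := by
    refine IsModerate.sum hΩ hL hLc _ fun j _ => IsModerate.smul (𝕜 := ℝ) hΩ hL ?_ ?_
    · exact isModerate_snd_apply hΩ hL (ContinuousLinearMap.proj (R := ℝ) (φ := fun _ => ℝ) j)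
    · exact isModerate_comp_fst hΩ hL hLc (ha j)
  obtain ⟨c, hc, hlow⟩ := exists_one_add_norm_le (fun j => (ha j).continuousOn) hinj hL hLc
  obtain ⟨N, C, hC, h⟩ := exists_rapid hΩ hL hg hP hc hlow n R
  choose C' hC' h' using fun i => exists_fhat_decay_one_add μ K hK i N
  refine ⟨N, C * ∑ i ∈ Finset.range (n + 1), C' i,
    mul_nonneg hC (Finset.sum_nonneg fun i _ => hC' i), fun φ hφ hs b hb y hy x => ?_⟩
  have hcs : HasCompactSupport φ := hK.of_isClosed_subset (isClosed_tsupport φ) hs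
  have hb0 : 0 ≤ b := (norm_nonneg _).trans (hb 0 (Nat.zero_le _) 0)
  rw [mul_assoc C]
  refine h (fhat μ φ) (contDiff_fhat μ hφ hcs) _ (fun i hi α => ?_) y hy x
  refine (h' i φ hφ hs b hb α).trans ?_
  gcongr
  exact Finset.single_le_sum (fun i _ => hC' i) (Finset.mem_range.2 (by omega))

lemma integrable_one_add_norm_pow_inv (k : ℕ) :
    Integrable (fun x : Fin k → ℝ => ((1 + ‖x‖) ^ (k + 1))⁻¹) := by
  have := integrable_one_add_norm (E := Fin k → ℝ) (μ := volume) (r := ((k + 1 : ℕ) : ℝ)) (by simp)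
  refine this.congr (Filter.Eventually.of_forall fun x => ?_)
  change (1 + ‖x‖) ^ (-((k + 1 : ℕ) : ℝ)) = _
  rw [Real.rpow_neg (by positivity), Real.rpow_natCast]

/-- Oscillatory integrals depend smoothly on parameters, and their derivatives are bounded by
seminorms of the test function. -/
theorem exists_oscIntegral_smooth {k : ℕ} {a : Fin k → V → (W →L[ℝ] ℝ)} {Ω : Set V}
    (hΩ : IsOpen Ω) (ha : ∀ j, ContDiffOn ℝ ∞ (a j) Ω)
    (hinj : ∀ y ∈ Ω, LinearIndependent ℝ fun j => a j y)
    {P : V × (Fin k → ℝ) → ℂ} (hP : ∀ L ⊆ Ω, IsCompact L → IsModerate Ω L P) {y₁ : V}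
    (hy₁ : y₁ ∈ Ω) :
    ∃ O : Set V, IsOpen O ∧ y₁ ∈ O ∧ O ⊆ Ω ∧
      (∀ φ : W → ℂ, ContDiff ℝ ∞ φ → HasCompactSupport φ →
        ContDiffOn ℝ ∞ (fun y => ∫ x, oscIntegrand μ a P φ (y, x)) O ∧
        ∀ y ∈ O, Integrable (fun x => oscIntegrand μ a P φ (y, x))) ∧
      ∀ (K : Set W), IsCompact K → ∀ n : ℕ, ∃ (m : ℕ) (C : ℝ), 0 ≤ C ∧
        ∀ φ : W → ℂ, ContDiff ℝ ∞ φ → tsupport φ ⊆ K →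
        ∀ b : ℝ, (∀ j ≤ m, ∀ X, ‖iteratedFDeriv ℝ j φ X‖ ≤ b) → ∀ y ∈ O,
        ‖iteratedFDeriv ℝ n (fun y => ∫ x, oscIntegrand μ a P φ (y, x)) y‖ ≤ C * b := by
  -- Bounds are uniform on compact sets, whereas the derivatives are taken on an open set; the
  -- interior of `L` serves as `O`.
  obtain ⟨L, hLc, hyL, hL⟩ := exists_compact_subset hΩ hy₁
  have hO : IsOpen (interior L) := isOpen_interior
  have hOΩ : interior L ⊆ Ω := interior_subset.trans hL
  have hI := integrable_one_add_norm_pow_inv k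
  have hsm : ∀ φ : W → ℂ, ContDiff ℝ ∞ φ → HasCompactSupport φ →
      ContDiffOn ℝ ∞ (oscIntegrand μ a P φ) (interior L ×ˢ Set.univ) := by
    intro φ hφ hc
    refine ContDiffOn.mul ((contDiff_fhat μ hφ hc).comp_contDiffOn ?_)
      ((hP L hL hLc).1.mono (Set.prod_mono hOΩ subset_rfl))
    have h1 : ∀ j, ContDiffOn ℝ ∞ (fun z : V × (Fin k → ℝ) => z.2 j • a j z.1)
        (interior L ×ˢ Set.univ) := fun j =>
      ((by fun_prop : ContDiff ℝ ∞ fun z : V × (Fin k → ℝ) => z.2 j).contDiffOn).smul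
        ((ha j).comp contDiffOn_fst fun z hz => hOΩ hz.1)
    exact ContDiffOn.sum fun j _ => h1 j
  have hwithin : ∀ (φ : W → ℂ) (n : ℕ), ∀ y ∈ interior L, ∀ x,
      iteratedFDerivWithin ℝ n (oscIntegrand μ a P φ) (Ω ×ˢ Set.univ) (y, x) =
      iteratedFDeriv ℝ n (oscIntegrand μ a P φ) (y, x) := fun φ n y hy x =>
    iteratedFDerivWithin_of_isOpen n (hΩ.prod isOpen_univ) ⟨hOΩ hy, trivial⟩
  have hbd : ∀ φ : W → ℂ, ContDiff ℝ ∞ φ → HasCompactSupport φ → ∀ n : ℕ, ∃ B : ℝ,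
      ∀ y ∈ interior L, ∀ x, ‖iteratedFDeriv ℝ n (oscIntegrand μ a P φ) (y, x)‖ ≤
        B * ((1 + ‖x‖) ^ (k + 1))⁻¹ := by
    intro φ hφ hc n
    obtain ⟨m, C, hC, h⟩ := exists_oscIntegrand_bound μ hΩ ha hinj hL hLc (hP L hL hLc) n (k + 1)
      (tsupport φ) hc
    obtain ⟨b, hb⟩ := exists_iteratedFDeriv_bound hφ hc m
    exact ⟨C * b, fun y hy x => by
      rw [← hwithin φ n y hy x]
      exact h φ hφ subset_rfl b hb y (interior_subset hy) x⟩
  refine ⟨interior L, hO, hyL, hOΩ, fun φ hφ hc => ?_, fun K hK n => ?_⟩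
  · choose B hB using hbd φ hφ hc
    refine ⟨contDiffOn_integral volume hO (hsm φ hφ hc) (fun n => hI.const_mul (B n)) hB,
      fun y hy => ?_⟩
    refine (hI.const_mul (B 0)).mono' ?_ (Filter.Eventually.of_forall fun x => ?_)
    · have : Continuous fun x => oscIntegrand μ a P φ (y, x) :=
        (hsm φ hφ hc).continuousOn.comp_continuous (by fun_prop) fun x => ⟨hy, trivial⟩
      exact this.aestronglyMeasurable
    · simpa using hB 0 y hy x
  · obtain ⟨m, C, hC, h⟩ := exists_oscIntegrand_bound μ hΩ ha hinj hL hLc (hP L hL hLc) n (k + 1)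
      K hK
    have hI0 : 0 ≤ ∫ x : Fin k → ℝ, ((1 + ‖x‖) ^ (k + 1))⁻¹ :=
      integral_nonneg fun x => by positivity
    refine ⟨m, C * ∫ x : Fin k → ℝ, ((1 + ‖x‖) ^ (k + 1))⁻¹, mul_nonneg hC hI0,
      fun φ hφ hs b hb y hy => ?_⟩
    have hc : HasCompactSupport φ := hK.of_isClosed_subset (isClosed_tsupport φ) hs
    choose B hB using hbd φ hφ hc
    -- A majorant is required at every order. Only at order n must it be linear in `b` with a
    -- constant independent of φ; at the other orders the constants `B i`, which depend on φ, are
    -- enough. The exponent k + 1 makes the majorants integrable over ℝᵏ.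
    refine (norm_iteratedFDeriv_integral_le volume hO (hsm φ hφ hc)
      (bound := fun i x => if i = n then C * b * ((1 + ‖x‖) ^ (k + 1))⁻¹ else
        B i * ((1 + ‖x‖) ^ (k + 1))⁻¹) (fun i => ?_) (fun i z hz x => ?_) n hy).trans ?_
    · split_ifs
      · exact hI.const_mul _
      · exact hI.const_mul _
    · split_ifs with hi
      · subst hi
        rw [← hwithin φ i z hz x]
        exact h φ hφ hs b hb z (interior_subset hz) x
      · exact hB i z hz x
    · simp only [if_true]
      rw [integral_const_mul]
      exact le_of_eq (by ring)

end Oscillatory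

/-! ### Coordinates on the cotangent bundle -/

section CotangentGeometry

variable {V : Type*} [NormedAddCommGroup V] [NormedSpace ℝ V]
  {M : Type*} [TopologicalSpace M] [ChartedSpace V M] [IsManifold 𝓘(ℝ, V) ∞ M]

omit [IsManifold 𝓘(ℝ, V) ∞ M] in
/-- The components of a covector at `m` in the chart around `x₀`. -/
def coComp (x₀ m : M) (ξ : CoFibre (V := V) M m) : V →L[ℝ] ℝ :=
  (ξ : V →L[ℝ] ℝ).comp
    (mfderiv 𝓘(ℝ, V) 𝓘(ℝ, V) (extChartAt 𝓘(ℝ, V) x₀).symm (extChartAt 𝓘(ℝ, V) x₀ m) : V →L[ℝ] V)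

lemma trivializationAt_cotangent_apply {x₀ : M} {ξ : Cotangent (V := V) M}
    (h : ξ.proj ∈ (chartAt V x₀).source) :
    trivializationAt (V →L[ℝ] ℝ) (CoFibre (V := V) M) x₀ ξ = (ξ.proj, coComp x₀ ξ.proj ξ.2) := by
  rw [hom_trivializationAt_apply]
  congr 1
  rw [ContinuousLinearMap.inCoordinates]
  rw [TangentBundle.symmL_trivializationAt h]
  ext v
  simp [coComp, mfderivWithin_univ]

lemma extChartAt_cotangent_apply {ξ₀ ξ : Cotangent (V := V) M}
    (h : ξ.proj ∈ (chartAt V ξ₀.proj).source) :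
    extChartAt (ModelT V) ξ₀ ξ =
      (extChartAt 𝓘(ℝ, V) ξ₀.proj ξ.proj, coComp ξ₀.proj ξ.proj ξ.2) := by
  rw [FiberBundle.extChartAt]
  have := trivializationAt_cotangent_apply h
  simp [this]

/-- This reduces smoothness of maps into T^*M to maps into M and a fixed vector space. Any chart of
M around the base point is allowed, not only the preferred one at that point. -/
lemma contMDiffAt_cotangent_iff {E' : Type*} [NormedAddCommGroup E'] [NormedSpace ℝ E']
    {B' : Type*} [TopologicalSpace B'] {I' : ModelWithCorners ℝ E' B'}
    {N' : Type*} [TopologicalSpace N'] [ChartedSpace B' N'] {G : N' → Cotangent (V := V) M} {z : N'}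
    {x₀ : M} (h : (G z).proj ∈ (chartAt V x₀).source) :
    ContMDiffAt I' (ModelT V) ∞ G z ↔ ContMDiffAt I' 𝓘(ℝ, V) ∞ (fun y => (G y).proj) z ∧
      ContMDiffAt I' 𝓘(ℝ, V →L[ℝ] ℝ) ∞ (fun y => coComp x₀ (G y).proj (G y).2) z := by
  rw [(trivializationAt (V →L[ℝ] ℝ) (CoFibre (V := V) M) x₀).contMDiffAt_iff (by simpa using h)]
  refine and_congr_right fun h1 => ?_
  refine Filter.EventuallyEq.contMDiffAt_iff ?_
  filter_upwards [h1.continuousAt ((chartAt V x₀).open_source.mem_nhds h)] with y hy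
  rw [trivializationAt_cotangent_apply hy]

lemma mdifferentiableAt_chart {x₀ m : M} (h : m ∈ (chartAt V x₀).source) :
    MDifferentiableAt 𝓘(ℝ, V) 𝓘(ℝ, V) (extChartAt 𝓘(ℝ, V) x₀) m :=
  mdifferentiableAt_extChartAt h

lemma contMDiffAt_chart_symm {x₀ : M} {y : V} (h : y ∈ (extChartAt 𝓘(ℝ, V) x₀).target) :
    ContMDiffAt 𝓘(ℝ, V) 𝓘(ℝ, V) ∞ (extChartAt 𝓘(ℝ, V) x₀).symm y :=
  (contMDiffOn_extChartAt_symm x₀).contMDiffAt ((isOpen_extChartAt_target x₀).mem_nhds h)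

lemma contMDiffAt_chart {x₀ m : M} (h : m ∈ (chartAt V x₀).source) :
    ContMDiffAt 𝓘(ℝ, V) 𝓘(ℝ, V) ∞ (extChartAt 𝓘(ℝ, V) x₀) m :=
  contMDiffAt_extChartAt' h

/-- The derivatives of a chart and of its inverse are inverse to each other. -/
lemma mfderiv_chart_symm_mfderiv_chart {x₀ m : M} (h : m ∈ (chartAt V x₀).source) (v : V) :
    (mfderiv 𝓘(ℝ, V) 𝓘(ℝ, V) (extChartAt 𝓘(ℝ, V) x₀).symm (extChartAt 𝓘(ℝ, V) x₀ m) :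
      V →L[ℝ] V) ((mfderiv 𝓘(ℝ, V) 𝓘(ℝ, V) (extChartAt 𝓘(ℝ, V) x₀) m : V →L[ℝ] V) v) = v := by
  have hs : m ∈ (extChartAt 𝓘(ℝ, V) x₀).source := by simpa using h
  have h1 := (contMDiffAt_chart_symm ((extChartAt 𝓘(ℝ, V) x₀).map_source hs)).mdifferentiableAt
    (by simp)
  have h2 := mfderiv_comp m h1 (mdifferentiableAt_chart h)
  have h3 : (extChartAt 𝓘(ℝ, V) x₀).symm ∘ (extChartAt 𝓘(ℝ, V) x₀) =ᶠ[𝓝 m] id := by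
    filter_upwards [(chartAt V x₀).open_source.mem_nhds h] with y hy
    exact (extChartAt 𝓘(ℝ, V) x₀).left_inv (by simpa using hy)
  rw [h3.mfderiv_eq, mfderiv_id] at h2
  exact (DFunLike.congr_fun h2 v).symm

lemma coComp_mfderiv_chart {x₀ m : M} (h : m ∈ (chartAt V x₀).source) (ξ : CoFibre (V := V) M m)
    (v : V) : coComp x₀ m ξ ((mfderiv 𝓘(ℝ, V) 𝓘(ℝ, V) (extChartAt 𝓘(ℝ, V) x₀) m : V →L[ℝ] V) v) =
      (ξ : V →L[ℝ] ℝ) v := by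
  change (ξ : V →L[ℝ] ℝ) ((mfderiv 𝓘(ℝ, V) 𝓘(ℝ, V) (extChartAt 𝓘(ℝ, V) x₀).symm
    (extChartAt 𝓘(ℝ, V) x₀ m) : V →L[ℝ] V)
      ((mfderiv 𝓘(ℝ, V) 𝓘(ℝ, V) (extChartAt 𝓘(ℝ, V) x₀) m : V →L[ℝ] V) v)) = _
  rw [mfderiv_chart_symm_mfderiv_chart h]

/-- A covector applied to the projection of a tangent vector. -/
lemma canonicalForm_mfderiv {E' : Type*} [NormedAddCommGroup E'] [NormedSpace ℝ E']
    {B' : Type*} [TopologicalSpace B'] {I' : ModelWithCorners ℝ E' B'}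
    {N' : Type*} [TopologicalSpace N'] [ChartedSpace B' N'] {G : N' → Cotangent (V := V) M} {z : N'}
    (hG : MDifferentiableAt I' (ModelT V) G z) (b : E') :
    canonicalForm (G z) (mfderiv I' (ModelT V) G z b) =
      ((G z).2 : V →L[ℝ] ℝ)
        ((mfderiv I' 𝓘(ℝ, V) (fun y => (G y).proj) z : E' →L[ℝ] V) b) := by
  have h := mfderiv_comp z ((Bundle.contMDiff_proj (CoFibre (V := V) M) (n := ∞)
    (IB := 𝓘(ℝ, V)) (F := V →L[ℝ] ℝ)).mdifferentiable (by simp) (G z)) hG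
  change _ = ((G z).2 : V →L[ℝ] ℝ)
    ((mfderiv I' 𝓘(ℝ, V) (Bundle.TotalSpace.proj ∘ G) z : E' →L[ℝ] V) b)
  rw [h]
  rfl

variable {Z : Type*} [NormedAddCommGroup Z] [NormedSpace ℝ Z]

/-- The canonical form, pulled back to a vector space, in coordinates. -/
lemma canonicalForm_mfderiv_eq_coComp {G : Z → Cotangent (V := V) M} {z : Z}
    (hG : ContMDiffAt 𝓘(ℝ, Z) (ModelT V) ∞ G z) {x₀ : M}
    (h : (G z).proj ∈ (chartAt V x₀).source) (b : Z) :
    canonicalForm (G z) (mfderiv 𝓘(ℝ, Z) (ModelT V) G z b) =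
      coComp x₀ (G z).proj (G z).2
        (fderiv ℝ (fun y => extChartAt 𝓘(ℝ, V) x₀ (G y).proj) z b) := by
  rw [canonicalForm_mfderiv (hG.mdifferentiableAt (by simp))]
  have h1 := ((contMDiffAt_cotangent_iff h).1 hG).1.mdifferentiableAt (by simp)
  have h2 := mfderiv_comp z (mdifferentiableAt_chart h) h1
  refine (coComp_mfderiv_chart h (G z).2 _).symm.trans ?_
  rw [← mfderiv_eq_fderiv]
  change _ = coComp x₀ (G z).proj (G z).2 ((mfderiv 𝓘(ℝ, Z) 𝓘(ℝ, V)
    (extChartAt 𝓘(ℝ, V) x₀ ∘ fun y => (G y).proj) z : Z →L[ℝ] V) b)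
  rw [h2]
  rfl

end CotangentGeometry

/-! ### The canonical 1-form, its differential, and their pullbacks -/

section CanonicalTwoForm

variable {V : Type*} [NormedAddCommGroup V] [NormedSpace ℝ V]

/-- The canonical symplectic form on `V × V*`. -/
def canTwo (a b : V × (V →L[ℝ] ℝ)) : ℝ := a.2 b.1 - b.2 a.1

variable {M : Type*} [TopologicalSpace M] [ChartedSpace V M] [IsManifold 𝓘(ℝ, V) ∞ M]
  {Z : Type*} [NormedAddCommGroup Z] [NormedSpace ℝ Z]

/-- In the coordinates (q, p) of the bundle chart, θ = Σ pᵢ dqᵢ: by `extChartAt_cotangent_apply` the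
inverse chart has base coordinate q and covector components p. -/
lemma inChart_canonicalForm (ξ : Cotangent (V := V) M) {y : V × (V →L[ℝ] ℝ)}
    (hy : y ∈ (extChartAt (ModelT V) ξ).target) (u : Fin 1 → V × (V →L[ℝ] ℝ)) :
    inChart (ModelT V) (ofOneForm (ModelT V) canonicalForm) ξ y 1 u = ((y.2 (u 0).1 : ℝ) : ℂ) := by
  have hopen := (isOpen_extChartAt_target (I := ModelT V) ξ).mem_nhds hy
  have hG : ContMDiffAt 𝓘(ℝ, V × (V →L[ℝ] ℝ)) (ModelT V) ∞ (extChartAt (ModelT V) ξ).symm y :=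
    (contMDiffOn_extChartAt_symm ξ).contMDiffAt hopen
  have hs : ∀ z ∈ (extChartAt (ModelT V) ξ).target,
      ((extChartAt (ModelT V) ξ).symm z).proj ∈ (chartAt V ξ.proj).source := fun z hz => by
    have h1 := (extChartAt (ModelT V) ξ).map_target hz
    generalize (extChartAt (ModelT V) ξ).symm z = ζ at h1
    rw [FiberBundle.extChartAt] at h1
    simp at h1
    exact h1.1
  have he : ∀ z ∈ (extChartAt (ModelT V) ξ).target,
      (extChartAt 𝓘(ℝ, V) ξ.proj ((extChartAt (ModelT V) ξ).symm z).proj,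
        coComp ξ.proj ((extChartAt (ModelT V) ξ).symm z).proj ((extChartAt (ModelT V) ξ).symm z).2)
        = z := fun z hz => by
    rw [← extChartAt_cotangent_apply (hs z hz)]
    exact (extChartAt (ModelT V) ξ).right_inv hz
  change (((canonicalForm ((extChartAt (ModelT V) ξ).symm y))
    (mfderiv 𝓘(ℝ, V × (V →L[ℝ] ℝ)) (ModelT V) (extChartAt (ModelT V) ξ).symm y (u 0)) : ℝ) : ℂ) = _
  rw [canonicalForm_mfderiv_eq_coComp hG (hs y hy)]
  have h2 : (fun z => extChartAt 𝓘(ℝ, V) ξ.proj ((extChartAt (ModelT V) ξ).symm z).proj) =ᶠ[𝓝 y]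
      Prod.fst := by
    filter_upwards [hopen] with z hz
    exact congrArg Prod.fst (he z hz)
  rw [h2.fderiv_eq, fderiv_fst, show coComp ξ.proj _ _ = y.2 from congrArg Prod.snd (he y hy)]
  rfl

/-- Since θ = p dq is linear in p in the chart, its differential is dp ∧ dq. At the centre of the
chart the differential of the chart is the identity, so tangent vectors are already pairs (q-part,
p-part). -/
lemma extD_canonicalForm (ξ : Cotangent (V := V) M) :
    extD (ModelT V) (ofOneForm (ModelT V) canonicalForm) ξ =
      twoForm (T := TangentSpace (ModelT V) ξ) (fun a b => ((canTwo (V := V) a b : ℝ) : ℂ)) := by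
  funext p v
  rcases p with _ | _ | _ | p
  · rfl
  · simp only [extD]
    refine Finset.sum_eq_zero fun i _ => ?_
    have : (fun y => inChart (ModelT V) (ofOneForm (ModelT V) canonicalForm) ξ y 0
      (fun j => (mfderiv (ModelT V) 𝓘(ℝ, V × (V →L[ℝ] ℝ)) (extChartAt (ModelT V) ξ) ξ)
        (v (i.succAbove j)))) = fun _ => 0 := rfl
    erw [this]
    rw [fderiv_fun_const]
    exact mul_zero _
  · simp only [extD]
    have key : ∀ u : Fin 1 → V × (V →L[ℝ] ℝ), ∀ w,
        fderiv ℝ (fun y => inChart (ModelT V) (ofOneForm (ModelT V) canonicalForm) ξ y 1 u)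
          (extChartAt (ModelT V) ξ ξ) w = ((w.2 (u 0).1 : ℝ) : ℂ) := fun u w => by
      have h1 : (fun y => inChart (ModelT V) (ofOneForm (ModelT V) canonicalForm) ξ y 1 u)
          =ᶠ[𝓝 (extChartAt (ModelT V) ξ ξ)] fun y => ((y.2 (u 0).1 : ℝ) : ℂ) := by
        filter_upwards [extChartAt_target_mem_nhds (I := ModelT V) ξ] with y hy
        exact inChart_canonicalForm ξ hy u
      rw [h1.fderiv_eq]
      have h2 : HasFDerivAt (fun y : V × (V →L[ℝ] ℝ) => ((y.2 (u 0).1 : ℝ) : ℂ))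
          (Complex.ofRealCLM.comp ((ContinuousLinearMap.apply ℝ ℝ (u 0).1).comp
            (ContinuousLinearMap.snd ℝ V (V →L[ℝ] ℝ)))) (extChartAt (ModelT V) ξ ξ) :=
        (Complex.ofRealCLM.comp ((ContinuousLinearMap.apply ℝ ℝ (u 0).1).comp
          (ContinuousLinearMap.snd ℝ V (V →L[ℝ] ℝ)))).hasFDerivAt
      rw [h2.fderiv]
      rfl
    rw [mfderiv_extChartAt_self, Fin.sum_univ_two]
    erw [key, key]
    simp [twoForm, canTwo]
    rfl
  · simp only [extD]
    refine Finset.sum_eq_zero fun i _ => ?_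
    have : (fun y => inChart (ModelT V) (ofOneForm (ModelT V) canonicalForm) ξ y (p + 2)
      (fun j => (mfderiv (ModelT V) 𝓘(ℝ, V × (V →L[ℝ] ℝ)) (extChartAt (ModelT V) ξ) ξ)
        (v (i.succAbove j)))) = fun _ => 0 := rfl
    erw [this]
    rw [fderiv_fun_const]
    exact mul_zero _

/-- The canonical two-form, pulled back to a vector space, in coordinates. -/
lemma fderiv_canonicalForm_sub {G : Z → Cotangent (V := V) M} {z : Z}
    (hG : ∀ᶠ z' in 𝓝 z, ContMDiffAt 𝓘(ℝ, Z) (ModelT V) ∞ G z') {x₀ : M}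
    (h : (G z).proj ∈ (chartAt V x₀).source) (a b : Z) :
    fderiv ℝ (fun z' => canonicalForm (G z') (mfderiv 𝓘(ℝ, Z) (ModelT V) G z' b)) z a -
      fderiv ℝ (fun z' => canonicalForm (G z') (mfderiv 𝓘(ℝ, Z) (ModelT V) G z' a)) z b =
    canTwo (fderiv ℝ (fun y => extChartAt 𝓘(ℝ, V) x₀ (G y).proj) z a,
        fderiv ℝ (fun y => coComp x₀ (G y).proj (G y).2) z a)
      (fderiv ℝ (fun y => extChartAt 𝓘(ℝ, V) x₀ (G y).proj) z b,
        fderiv ℝ (fun y => coComp x₀ (G y).proj (G y).2) z b) := by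
  obtain ⟨h1, h2⟩ := (contMDiffAt_cotangent_iff h).1 hG.self_of_nhds
  have hP : ContDiffAt ℝ ∞ (fun y => coComp x₀ (G y).proj (G y).2) z := h2.contDiffAt
  have hQ : ContDiffAt ℝ ∞ (fun y => extChartAt 𝓘(ℝ, V) x₀ (G y).proj) z :=
    ((contMDiffAt_chart h).comp z h1).contDiffAt
  have hev : ∀ b : Z, (fun z' => canonicalForm (G z') (mfderiv 𝓘(ℝ, Z) (ModelT V) G z' b)) =ᶠ[𝓝 z]
      fun z' => coComp x₀ (G z').proj (G z').2
        (fderiv ℝ (fun y => extChartAt 𝓘(ℝ, V) x₀ (G y).proj) z' b) := fun b => by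
    filter_upwards [hG, h1.continuousAt ((chartAt V x₀).open_source.mem_nhds h)] with z' hz hz'
    exact canonicalForm_mfderiv_eq_coComp hz hz' b
  have hP' := (hP.differentiableAt (by simp)).hasFDerivAt
  have hQ' := ((hQ.fderiv_right (m := 1) (by norm_cast)).differentiableAt (by simp)).hasFDerivAt
  have hd : ∀ b c : Z, fderiv ℝ (fun z' => coComp x₀ (G z').proj (G z').2
      (fderiv ℝ (fun y => extChartAt 𝓘(ℝ, V) x₀ (G y).proj) z' b)) z c =
      coComp x₀ (G z).proj (G z).2
        (fderiv ℝ (fderiv ℝ (fun y => extChartAt 𝓘(ℝ, V) x₀ (G y).proj)) z c b) +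
      fderiv ℝ (fun y => coComp x₀ (G y).proj (G y).2) z c
        (fderiv ℝ (fun y => extChartAt 𝓘(ℝ, V) x₀ (G y).proj) z b) := fun b c => by
    rw [(hP'.clm_apply (hQ'.clm_apply (hasFDerivAt_const b z))).fderiv]
    simp
  -- The terms with second derivatives of the base coordinates cancel in the difference by symmetry.
  have hsymm : IsSymmSndFDerivAt ℝ (fun y => extChartAt 𝓘(ℝ, V) x₀ (G y).proj) z :=
    hQ.isSymmSndFDerivAt (by simp; exact WithTop.coe_le_coe.2 le_top)
  rw [(hev a).fderiv_eq, (hev b).fderiv_eq, hd, hd, hsymm.eq a b]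
  simp only [canTwo]
  ring

/-- The canonical two-form is the exterior derivative of the canonical one-form. -/
lemma canTwo_mfderiv {G : Z → Cotangent (V := V) M} {z : Z}
    (hG : ∀ᶠ z' in 𝓝 z, ContMDiffAt 𝓘(ℝ, Z) (ModelT V) ∞ G z') (a b : Z) :
    canTwo (V := V) (mfderiv 𝓘(ℝ, Z) (ModelT V) G z a) (mfderiv 𝓘(ℝ, Z) (ModelT V) G z b) =
    fderiv ℝ (fun z' => canonicalForm (G z') (mfderiv 𝓘(ℝ, Z) (ModelT V) G z' b)) z a -
      fderiv ℝ (fun z' => canonicalForm (G z') (mfderiv 𝓘(ℝ, Z) (ModelT V) G z' a)) z b := by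
  have hG₀ := hG.self_of_nhds
  have h : (G z).proj ∈ (chartAt V (G z).proj).source := mem_chart_source V _
  rw [fderiv_canonicalForm_sub hG h]
  obtain ⟨h1, h2⟩ := (contMDiffAt_cotangent_iff h).1 hG₀
  have hP : ContDiffAt ℝ ∞ (fun y => coComp (G z).proj (G y).proj (G y).2) z := h2.contDiffAt
  have hQ : ContDiffAt ℝ ∞ (fun y => extChartAt 𝓘(ℝ, V) (G z).proj (G y).proj) z :=
    ((contMDiffAt_chart h).comp z h1).contDiffAt
  have key : ∀ a : Z, (mfderiv 𝓘(ℝ, Z) (ModelT V) G z a : V × (V →L[ℝ] ℝ)) =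
      (fderiv ℝ (fun y => extChartAt 𝓘(ℝ, V) (G z).proj (G y).proj) z a,
        fderiv ℝ (fun y => coComp (G z).proj (G y).proj (G y).2) z a) := fun a => by
    have h3 := mfderiv_comp z (mdifferentiableAt_extChartAt (I := ModelT V)
      (mem_chart_source _ (G z))) (hG₀.mdifferentiableAt (by simp))
    rw [mfderiv_extChartAt_self] at h3
    have h4 : extChartAt (ModelT V) (G z) ∘ G =ᶠ[𝓝 z] fun y =>
        (extChartAt 𝓘(ℝ, V) (G z).proj (G y).proj, coComp (G z).proj (G y).proj (G y).2) := by
      filter_upwards [h1.continuousAt ((chartAt V _).open_source.mem_nhds h)] with y hy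
      exact extChartAt_cotangent_apply hy
    rw [h4.mfderiv_eq, mfderiv_eq_fderiv, (hQ.differentiableAt (by simp)).fderiv_prodMk
      (hP.differentiableAt (by simp))] at h3
    exact (DFunLike.congr_fun h3 a).symm
  rw [key, key]

/-- The canonical two-form, pulled back to a vector space, in coordinates. -/
lemma canTwo_mfderiv_eq {G : Z → Cotangent (V := V) M} {z : Z}
    (hG : ∀ᶠ z' in 𝓝 z, ContMDiffAt 𝓘(ℝ, Z) (ModelT V) ∞ G z') {x₀ : M}
    (h : (G z).proj ∈ (chartAt V x₀).source) (a b : Z) :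
    canTwo (V := V) (mfderiv 𝓘(ℝ, Z) (ModelT V) G z a) (mfderiv 𝓘(ℝ, Z) (ModelT V) G z b) =
    canTwo (fderiv ℝ (fun y => extChartAt 𝓘(ℝ, V) x₀ (G y).proj) z a,
        fderiv ℝ (fun y => coComp x₀ (G y).proj (G y).2) z a)
      (fderiv ℝ (fun y => extChartAt 𝓘(ℝ, V) x₀ (G y).proj) z b,
        fderiv ℝ (fun y => coComp x₀ (G y).proj (G y).2) z b) := by
  rw [canTwo_mfderiv hG, fderiv_canonicalForm_sub hG h]

/-- Pullback commutes with d: two maps that pull θ back to the same 1-form near a point pull dθ back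
to the same 2-form there. This yields the invariance of dθ under the cotangent lift. -/
lemma canTwo_mfderiv_congr {G G' : Z → Cotangent (V := V) M} {z : Z}
    (hG : ∀ᶠ z' in 𝓝 z, ContMDiffAt 𝓘(ℝ, Z) (ModelT V) ∞ G z')
    (hG' : ∀ᶠ z' in 𝓝 z, ContMDiffAt 𝓘(ℝ, Z) (ModelT V) ∞ G' z')
    (h : ∀ᶠ z' in 𝓝 z, ∀ b, canonicalForm (G z') (mfderiv 𝓘(ℝ, Z) (ModelT V) G z' b) =
      canonicalForm (G' z') (mfderiv 𝓘(ℝ, Z) (ModelT V) G' z' b)) (a b : Z) :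
    canTwo (V := V) (mfderiv 𝓘(ℝ, Z) (ModelT V) G z a) (mfderiv 𝓘(ℝ, Z) (ModelT V) G z b) =
      canTwo (V := V) (mfderiv 𝓘(ℝ, Z) (ModelT V) G' z a) (mfderiv 𝓘(ℝ, Z) (ModelT V) G' z b) := by
  rw [canTwo_mfderiv hG, canTwo_mfderiv hG']
  have h' : ∀ b, (fun z' => canonicalForm (G z') (mfderiv 𝓘(ℝ, Z) (ModelT V) G z' b)) =ᶠ[𝓝 z]
      fun z' => canonicalForm (G' z') (mfderiv 𝓘(ℝ, Z) (ModelT V) G' z' b) := fun b =>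
    h.mono fun z' hz => hz b
  rw [(h' a).fderiv_eq, (h' b).fderiv_eq]

end CanonicalTwoForm

/-- Between vector spaces the coordinate changes of tangent bundles are trivial, so the statement
about `mfderiv` in tangent coordinates becomes one about `fderiv`. -/
lemma contMDiffAt_fderiv_param {E' : Type*} [NormedAddCommGroup E'] [NormedSpace ℝ E']
    {B' : Type*} [TopologicalSpace B'] {I' : ModelWithCorners ℝ E' B'}
    {N' : Type*} [TopologicalSpace N'] [ChartedSpace B' N'] [IsManifold I' ∞ N']
    {E₁ E₂ : Type*} [NormedAddCommGroup E₁]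
    [NormedSpace ℝ E₁] [NormedAddCommGroup E₂] [NormedSpace ℝ E₂] {f : N' → E₁ → E₂} {g : N' → E₁}
    {z : N'} (hf : ContMDiffAt (I'.prod 𝓘(ℝ, E₁)) 𝓘(ℝ, E₂) ∞ (Function.uncurry f) (z, g z))
    (hg : ContMDiffAt I' 𝓘(ℝ, E₁) ∞ g z) :
    ContMDiffAt I' 𝓘(ℝ, E₁ →L[ℝ] E₂) ∞ (fun y => fderiv ℝ (f y) (g y)) z := by
  have h := ContMDiffAt.mfderiv f g hf hg (m := ∞) (by simp)
  refine h.congr_of_eventuallyEq (Filter.Eventually.of_forall fun y => ?_)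
  exact ((congrFun (inTangentCoordinates_model_space g (fun y => f y (g y))
    (fun y => (mfderiv 𝓘(ℝ, E₁) 𝓘(ℝ, E₂) (f y) (g y) : E₁ →L[ℝ] E₂)) z) y).trans
    mfderiv_eq_fderiv).symm

/-! ### The cotangent lift and equivariance of the moment map; the form `e^{itDθ}` -/

section Action

variable {V : Type*} [NormedAddCommGroup V] [NormedSpace ℝ V]
  {M : Type*} [TopologicalSpace M] [ChartedSpace V M] [IsManifold 𝓘(ℝ, V) ∞ M]

omit [IsManifold 𝓘(ℝ, V) ∞ M] in
lemma contMDiff_smul_left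
    (W : Type*) [NormedAddCommGroup W] [NormedSpace ℝ W]
    {H : Type*} [Group H] [TopologicalSpace H] [ChartedSpace W H]
    [MulAction H M] [ContMDiffSMul 𝓘(ℝ, W) 𝓘(ℝ, V) ∞ H M] (g : H) :
    ContMDiff 𝓘(ℝ, V) 𝓘(ℝ, V) ∞ (fun x : M => g • x) := by
  have h : ContMDiff ((𝓘(ℝ, W)).prod 𝓘(ℝ, V)) 𝓘(ℝ, V) ∞ (fun q : H × M => q.1 • q.2) :=
    ContMDiffSMul.contMDiff_smul
  exact h.comp (contMDiff_const.prodMk contMDiff_id)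

omit [IsManifold 𝓘(ℝ, V) ∞ M] in
lemma mfderiv_inv_smul_mfderiv_smul
    (W : Type*) [NormedAddCommGroup W] [NormedSpace ℝ W]
    {H : Type*} [Group H] [TopologicalSpace H] [ChartedSpace W H]
    [MulAction H M] [ContMDiffSMul 𝓘(ℝ, W) 𝓘(ℝ, V) ∞ H M]
    (g : H) (m : M) (v : V) :
    (mfderiv 𝓘(ℝ, V) 𝓘(ℝ, V) (fun x : M => g⁻¹ • x) (g • m) : V →L[ℝ] V)
      ((mfderiv 𝓘(ℝ, V) 𝓘(ℝ, V) (fun x : M => g • x) m : V →L[ℝ] V) v) = v := by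
  have h := mfderiv_comp m ((contMDiff_smul_left (V := V) (M := M) W g⁻¹).mdifferentiable (by simp) (g • m))
    ((contMDiff_smul_left (V := V) W g).mdifferentiable (by simp) m)
  have h2 : (fun x : M => g⁻¹ • x) ∘ (fun x : M => g • x) = id := by
    funext x; simp
  rw [h2, mfderiv_id] at h
  exact (DFunLike.congr_fun h v).symm

variable {W : Type*} [NormedAddCommGroup W] [NormedSpace ℝ W]
  {H : Type*} [Group H] [TopologicalSpace H] [ChartedSpace W H] [LieGroup 𝓘(ℝ, W) ∞ H]
  [MulAction H M] [ContMDiffSMul 𝓘(ℝ, W) 𝓘(ℝ, V) ∞ H M]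

omit [IsManifold 𝓘(ℝ, V) ∞ M] [LieGroup 𝓘(ℝ, W) ∞ H] in
lemma contMDiff_smul_right (m : M) : ContMDiff 𝓘(ℝ, W) 𝓘(ℝ, V) ∞ (fun h : H => h • m) := by
  have h : ContMDiff ((𝓘(ℝ, W)).prod 𝓘(ℝ, V)) 𝓘(ℝ, V) ∞ (fun q : H × M => q.1 • q.2) :=
    ContMDiffSMul.contMDiff_smul
  exact h.comp (contMDiff_id.prodMk contMDiff_const)

/-- In charts the new covector components are the old ones composed with the derivative of y ↦ h⁻¹y.
This derivative depends smoothly on h and y by `contMDiffAt_fderiv_param`. -/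
lemma contMDiff_cotangentLift : ContMDiff ((𝓘(ℝ, W)).prod (ModelT V)) (ModelT V) ∞
    (fun q : H × Cotangent (V := V) M => cotangentLift q.1 q.2) := by
  rintro ⟨h₀, ξ₀⟩
  set m₀ := ξ₀.proj
  set m₁ := h₀ • m₀
  have hproj : ContMDiff (ModelT V) 𝓘(ℝ, V) ∞ (fun ξ : Cotangent (V := V) M => ξ.proj) :=
    Bundle.contMDiff_proj _
  have hsmul : ContMDiff ((𝓘(ℝ, W)).prod 𝓘(ℝ, V)) 𝓘(ℝ, V) ∞ (fun q : H × M => q.1 • q.2) :=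
    ContMDiffSMul.contMDiff_smul
  have h1 : ContMDiff ((𝓘(ℝ, W)).prod (ModelT V)) 𝓘(ℝ, V) ∞
      (fun q : H × Cotangent (V := V) M => q.1 • q.2.proj) :=
    hsmul.comp (contMDiff_fst.prodMk (hproj.comp contMDiff_snd))
  have hm₁ : m₁ ∈ (chartAt V m₁).source := mem_chart_source V m₁
  rw [contMDiffAt_cotangent_iff (x₀ := m₁) hm₁]
  refine ⟨h1 _, ?_⟩
  have hco : ContMDiffAt ((𝓘(ℝ, W)).prod (ModelT V)) 𝓘(ℝ, V →L[ℝ] ℝ) ∞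
      (fun q : H × Cotangent (V := V) M => coComp m₀ q.2.proj q.2.2) (h₀, ξ₀) :=
    ((contMDiffAt_cotangent_iff (G := fun q : H × Cotangent (V := V) M => q.2) (z := (h₀, ξ₀))
      (x₀ := m₀) (mem_chart_source V m₀)).1 contMDiffAt_snd).2
  let f : H × Cotangent (V := V) M → V → V := fun q y =>
    extChartAt 𝓘(ℝ, V) m₀ (q.1⁻¹ • (extChartAt 𝓘(ℝ, V) m₁).symm y)
  let g : H × Cotangent (V := V) M → V := fun q => extChartAt 𝓘(ℝ, V) m₁ (q.1 • q.2.proj)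
  have hg : ContMDiffAt ((𝓘(ℝ, W)).prod (ModelT V)) 𝓘(ℝ, V) ∞ g (h₀, ξ₀) :=
    (contMDiffAt_chart (m := h₀ • ξ₀.proj) hm₁).comp (h₀, ξ₀) (h1 _)
  have hsg : (extChartAt 𝓘(ℝ, V) m₁).symm (g (h₀, ξ₀)) = m₁ :=
    (extChartAt 𝓘(ℝ, V) m₁).left_inv (mem_extChartAt_source m₁)
  have hf : ContMDiffAt (((𝓘(ℝ, W)).prod (ModelT V)).prod 𝓘(ℝ, V)) 𝓘(ℝ, V) ∞
      (Function.uncurry f) ((h₀, ξ₀), g (h₀, ξ₀)) := by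
    have h2 : ContMDiffAt (((𝓘(ℝ, W)).prod (ModelT V)).prod 𝓘(ℝ, V)) 𝓘(ℝ, V) ∞
        (fun q : (H × Cotangent (V := V) M) × V =>
          q.1.1⁻¹ • (extChartAt 𝓘(ℝ, V) m₁).symm q.2) ((h₀, ξ₀), g (h₀, ξ₀)) := by
      refine (hsmul (h₀⁻¹, (extChartAt 𝓘(ℝ, V) m₁).symm (g (h₀, ξ₀)))).comp (f := fun q : (H × Cotangent (V := V) M) × V =>
        (q.1.1⁻¹, (extChartAt 𝓘(ℝ, V) m₁).symm q.2)) ((h₀, ξ₀), g (h₀, ξ₀)) ?_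
      refine ContMDiffAt.prodMk ?_ ?_
      · exact (contMDiff_inv 𝓘(ℝ, W) ∞ (G := H)).contMDiffAt.comp ((h₀, ξ₀), g (h₀, ξ₀))
          (contMDiffAt_fst.comp ((h₀, ξ₀), g (h₀, ξ₀)) contMDiffAt_fst)
      · exact (contMDiffAt_chart_symm (mem_extChartAt_target m₁)).comp
          ((h₀, ξ₀), g (h₀, ξ₀)) contMDiffAt_snd
    refine ContMDiffAt.comp (g := extChartAt 𝓘(ℝ, V) m₀) ((h₀, ξ₀), g (h₀, ξ₀)) ?_ h2
    refine contMDiffAt_chart ?_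
    simp only [hsg, m₁, inv_smul_smul]
    exact mem_chart_source V m₀
  refine ((ContinuousLinearMap.compL ℝ V V ℝ).isBoundedBilinearMap.contDiff.contMDiff.contMDiffAt.comp
    (h₀, ξ₀) (hco.prodMk_space (contMDiffAt_fderiv_param hf hg))).congr_of_eventuallyEq ?_
  filter_upwards [(h1 (h₀, ξ₀)).continuousAt.preimage_mem_nhds ((chartAt V m₁).open_source.mem_nhds hm₁),
    (hproj.continuous.comp continuous_snd).continuousAt (x := (h₀, ξ₀)).preimage_mem_nhds
      ((chartAt V m₀).open_source.mem_nhds (mem_chart_source V m₀))] with q hq1 hq2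
  obtain ⟨h, ξ⟩ := q
  change h • ξ.proj ∈ (chartAt V m₁).source at hq1
  change ξ.proj ∈ (chartAt V m₀).source at hq2
  have e1 : (extChartAt 𝓘(ℝ, V) m₁).symm (extChartAt 𝓘(ℝ, V) m₁ (h • ξ.proj)) = h • ξ.proj :=
    (extChartAt 𝓘(ℝ, V) m₁).left_inv (by simpa using hq1)
  have d1 := ((contMDiffAt_chart_symm ((extChartAt 𝓘(ℝ, V) m₁).map_source
    (by simpa using hq1))).mdifferentiableAt (by simp)).hasMFDerivAt
  -- The base point is a variable subject to an equation: the chain rule produces the point `symm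
  -- (chart (h • ξ.proj))`, which equals `h • ξ.proj` only propositionally, while the type of the
  -- derivative depends on it.
  have d2 : ∀ x, x = h • ξ.proj → HasMFDerivAt 𝓘(ℝ, V) 𝓘(ℝ, V) (fun x : M => h⁻¹ • x) x
      (mfderiv 𝓘(ℝ, V) 𝓘(ℝ, V) (fun x : M => h⁻¹ • x) (h • ξ.proj) : V →L[ℝ] V) := by
    rintro _ rfl
    exact ((contMDiff_smul_left (M := M) (V := V) W h⁻¹).mdifferentiable (by simp) _).hasMFDerivAt
  have d3 : ∀ x, x = ξ.proj → HasMFDerivAt 𝓘(ℝ, V) 𝓘(ℝ, V) (extChartAt 𝓘(ℝ, V) m₀) x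
      (mfderiv 𝓘(ℝ, V) 𝓘(ℝ, V) (extChartAt 𝓘(ℝ, V) m₀) ξ.proj : V →L[ℝ] V) := by
    rintro _ rfl
    exact (mdifferentiableAt_chart hq2).hasMFDerivAt
  have d123 := (d3 (h⁻¹ • (extChartAt 𝓘(ℝ, V) m₁).symm (extChartAt 𝓘(ℝ, V) m₁ (h • ξ.proj)))
    (by rw [e1, inv_smul_smul])).comp (f := (fun x : M => h⁻¹ • x) ∘ (extChartAt 𝓘(ℝ, V) m₁).symm)
    (extChartAt 𝓘(ℝ, V) m₁ (h • ξ.proj)) ((d2 _ e1).comp _ d1)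
  ext v
  have key : ∀ D : V →L[ℝ] V, HasFDerivAt (f (h, ξ)) D (g (h, ξ)) → ∀ c,
      coComp m₀ ξ.proj ξ.2 (D v) = c →
      coComp m₀ ξ.proj ξ.2 (fderiv ℝ (f (h, ξ)) (g (h, ξ)) v) = c := by
    rintro D hD c rfl
    rw [hD.fderiv]
  exact (key _ d123.hasFDerivAt _ (coComp_mfderiv_chart hq2 ξ.2 _)).symm

lemma contMDiff_cotangentLift_left (ξ : Cotangent (V := V) M) :
    ContMDiff 𝓘(ℝ, W) (ModelT V) ∞ (fun h : H => cotangentLift h ξ) :=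
  contMDiff_cotangentLift.comp (contMDiff_id.prodMk contMDiff_const)

lemma contMDiff_cotangentLift_right (W : Type*) [NormedAddCommGroup W] [NormedSpace ℝ W]
    {H : Type*} [Group H] [TopologicalSpace H] [ChartedSpace W H] [LieGroup 𝓘(ℝ, W) ∞ H]
    [MulAction H M] [ContMDiffSMul 𝓘(ℝ, W) 𝓘(ℝ, V) ∞ H M] (g : H) :
    ContMDiff (ModelT V) (ModelT V) ∞
      (fun ξ : Cotangent (V := V) M => cotangentLift g ξ) :=
  (contMDiff_cotangentLift (W := W)).comp (contMDiff_const.prodMk contMDiff_id)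

omit [IsManifold 𝓘(ℝ, V) ∞ M] [TopologicalSpace H] [LieGroup 𝓘(ℝ, W) ∞ H] in
lemma cotangentLift_one (ξ : Cotangent (V := V) M) : cotangentLift (1 : H) ξ = ξ := by
  have h : ∀ (g : H) (m' : M), g = 1 → m' = ξ.proj →
      (⟨m', (ξ.2 : V →L[ℝ] ℝ).comp (mfderiv 𝓘(ℝ, V) 𝓘(ℝ, V) (fun x : M => g • x) m' :
        V →L[ℝ] V)⟩ : Cotangent (V := V) M) = ξ := by
    rintro _ _ rfl rfl
    have h2 : (fun x : M => (1 : H) • x) = id := by funext x; simp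
    rw [h2, mfderiv_id]
    rfl
  exact h _ _ inv_one (one_smul H ξ.proj)

/-- The cotangent lift covers the action on M, so the fundamental field upstairs projects to the one
downstairs. -/
lemma canonicalForm_fundamental (ξ : Cotangent (V := V) M) (X : W) :
    canonicalForm ξ (fundamental (H := H) (ModelT V) cotangentLift ξ X) =
      (ξ.2 : V →L[ℝ] ℝ) (fundamental (H := H) 𝓘(ℝ, V) (fun (g : H) (x : M) => g • x) ξ.proj X) := by
  have h := canonicalForm_mfderiv ((contMDiff_cotangentLift_left (W := W) (H := H) ξ).mdifferentiable
    (by simp) 1) X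
  rw [cotangentLift_one] at h
  exact h

/-- The moment map of the canonical form. -/
lemma momentMap_apply (ξ : Cotangent (V := V) M) (X : W) :
    momentMap (W := W) (H := H) (ModelT V) cotangentLift canonicalForm ξ X =
      -(ξ.2 : V →L[ℝ] ℝ)
        (fundamental (H := H) 𝓘(ℝ, V) (fun (g : H) (x : M) => g • x) ξ.proj X) := by
  rw [← canonicalForm_fundamental]
  rfl

-- Differentiate (g h g⁻¹)(g m) = g (h m) with respect to h at h = 1.
omit [IsManifold 𝓘(ℝ, V) ∞ M] in
lemma fundamental_smul_Ad (g : H) (m : M) (X : W) :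
    (fundamental (H := H) 𝓘(ℝ, V) (fun (g : H) (x : M) => g • x) (g • m) (Ad g X) : V) =
      (mfderiv 𝓘(ℝ, V) 𝓘(ℝ, V) (fun x : M => g • x) m : V →L[ℝ] V)
        (fundamental (H := H) 𝓘(ℝ, V) (fun (g : H) (x : M) => g • x) m X) := by
  have hc : ContMDiff 𝓘(ℝ, W) 𝓘(ℝ, W) ∞ (fun h : H => g * h * g⁻¹) :=
    (contMDiff_const.mul contMDiff_id).mul contMDiff_const
  have d1 := (hc.mdifferentiable (by simp) 1).hasMFDerivAt
  have d2 : ∀ x, x = (1 : H) → HasMFDerivAt 𝓘(ℝ, W) 𝓘(ℝ, V) (fun h : H => h • g • m) x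
      (mfderiv 𝓘(ℝ, W) 𝓘(ℝ, V) (fun h : H => h • g • m) 1 : W →L[ℝ] V) := by
    rintro _ rfl
    exact ((contMDiff_smul_right (g • m)).mdifferentiable (by simp) 1).hasMFDerivAt
  have d3 := ((contMDiff_smul_right (W := W) (H := H) (V := V) m).mdifferentiable (by simp)
    1).hasMFDerivAt
  have d4 : ∀ x, x = m → HasMFDerivAt 𝓘(ℝ, V) 𝓘(ℝ, V) (fun x : M => g • x) x
      (mfderiv 𝓘(ℝ, V) 𝓘(ℝ, V) (fun x : M => g • x) m : V →L[ℝ] V) := by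
    rintro _ rfl
    exact ((contMDiff_smul_left (M := M) (V := V) W g).mdifferentiable (by simp) _).hasMFDerivAt
  have d12 := (d2 _ (by simp)).comp (1 : H) d1
  have d34 := (d4 _ (by simp)).comp (1 : H) d3
  have he : ((fun h : H => h • g • m) ∘ fun h : H => g * h * g⁻¹) =
      (fun x : M => g • x) ∘ fun h : H => h • m := by
    funext h
    simp [mul_smul]
  rw [he] at d12
  exact DFunLike.congr_fun (hasMFDerivAt_unique d12 d34) X

lemma momentMap_cotangentLift (g : H) (ξ : Cotangent (V := V) M) (X : W) :
    momentMap (W := W) (H := H) (ModelT V) cotangentLift canonicalForm (cotangentLift g ξ) (Ad g X) =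
      momentMap (W := W) (H := H) (ModelT V) cotangentLift canonicalForm ξ X := by
  rw [momentMap_apply, momentMap_apply]
  congr 1
  change (ξ.2 : V →L[ℝ] ℝ) ((mfderiv 𝓘(ℝ, V) 𝓘(ℝ, V) (fun x : M => g⁻¹ • x) (g • ξ.proj) :
    V →L[ℝ] V) _) = _
  congr 1
  refine (congrArg _ (fundamental_smul_Ad g ξ.proj X)).trans ?_
  exact mfderiv_inv_smul_mfderiv_smul W g ξ.proj _

lemma Ad_comp_Ad_inv (g : H) : (Ad g : W →L[ℝ] W).comp (Ad g⁻¹) = ContinuousLinearMap.id ℝ W := by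
  have hc : ∀ g : H, ContMDiff 𝓘(ℝ, W) 𝓘(ℝ, W) ∞ (fun h : H => g * h * g⁻¹) := fun g =>
    (contMDiff_const.mul contMDiff_id).mul contMDiff_const
  have d1 := ((hc g⁻¹).mdifferentiable (by simp) 1).hasMFDerivAt
  have d2 : ∀ x, x = (1 : H) → HasMFDerivAt 𝓘(ℝ, W) 𝓘(ℝ, W) (fun h : H => g * h * g⁻¹) x
      (mfderiv 𝓘(ℝ, W) 𝓘(ℝ, W) (fun h : H => g * h * g⁻¹) 1 : W →L[ℝ] W) := by
    rintro _ rfl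
    exact ((hc g).mdifferentiable (by simp) 1).hasMFDerivAt
  have d12 := (d2 _ (by simp)).comp (1 : H) d1
  have he : ((fun h : H => g * h * g⁻¹) ∘ fun h : H => g⁻¹ * h * g⁻¹⁻¹) = id := by
    funext h
    simp [mul_assoc]
  rw [he] at d12
  exact hasMFDerivAt_unique d12 (hasMFDerivAt_id 1)

omit [LieGroup 𝓘(ℝ, W) ∞ H] [ContMDiffSMul 𝓘(ℝ, W) 𝓘(ℝ, V) ∞ H M] in
lemma equivDOne_canonicalForm (X : W) (ξ : Cotangent (V := V) M) (p : ℕ)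
    (v : Fin p → TangentSpace (ModelT V) ξ) :
    equivDOne (H := H) (ModelT V) cotangentLift canonicalForm X ξ p v =
      if p = 0 then ((momentMap (W := W) (H := H) (ModelT V) cotangentLift canonicalForm ξ X : ℝ) : ℂ)
      else twoForm (T := TangentSpace (ModelT V) ξ) (fun a b => ((canTwo (V := V) a b : ℝ) : ℂ)) p v := by
  change extD (ModelT V) (ofOneForm (ModelT V) canonicalForm) ξ p v -
    contract (fundamental (ModelT V) cotangentLift ξ X) (ofOneForm (ModelT V) canonicalForm ξ) p v = _
  rw [extD_canonicalForm]
  rcases p with _ | p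
  · simp [twoForm, contract, momentMap, ofOneForm]
  · simp [contract, ofOneForm]

-- Only the scalar factor depends on X, because dθ does not; the two parts of Dθ(X) are given by
-- `equivDOne_canonicalForm`.
omit [LieGroup 𝓘(ℝ, W) ∞ H] [ContMDiffSMul 𝓘(ℝ, W) 𝓘(ℝ, V) ∞ H M] in
lemma expD_canonicalForm (t : ℝ) (X : W) (ξ : Cotangent (V := V) M) (p : ℕ)
    (v : Fin p → TangentSpace (ModelT V) ξ) :
    expD (H := H) (ModelT V) cotangentLift canonicalForm t X ξ p v =
      Complex.exp (Complex.I *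
        (((t • momentMap (W := W) (H := H) (ModelT V) cotangentLift canonicalForm ξ) X : ℝ) : ℂ)) *
      expTwo (T := TangentSpace (ModelT V) ξ)
        (fun a b => Complex.I * t * ((canTwo (V := V) a b : ℝ) : ℂ)) p v := by
  have h : positivePart ((Complex.I * (t : ℂ)) •
      equivDOne (H := H) (ModelT V) cotangentLift canonicalForm X ξ) =
      twoForm (T := TangentSpace (ModelT V) ξ)
        (fun a b => Complex.I * t * ((canTwo (V := V) a b : ℝ) : ℂ)) := by
    rw [twoForm_smul]
    funext q w
    simp only [positivePart, Pi.smul_apply, equivDOne_canonicalForm]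
    split_ifs with hq
    · subst hq
      simp [twoForm]
    · rfl
  simp only [expD, expForm, h, expTwo, Pi.smul_apply, equivDOne_canonicalForm, if_true]
  simp [mul_assoc]

variable [MeasurableSpace W] (μ : Measure W)

-- The integral over the Lie algebra touches only the scalar exponential and turns it into the
-- transform of φ at t f_θ. All decay in the proof comes from this factor.
omit [LieGroup 𝓘(ℝ, W) ∞ H] [ContMDiffSMul 𝓘(ℝ, W) 𝓘(ℝ, V) ∞ H M] in
lemma pairing_expD (t : ℝ) (φ : 𝓓((⊤ : TopologicalSpace.Opens W), ℂ)) (ξ : Cotangent (V := V) M)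
    (p : ℕ) (v : Fin p → TangentSpace (ModelT V) ξ) :
    pairing (ModelT V) μ (expD (H := H) (ModelT V) cotangentLift canonicalForm t) φ ξ p v =
      fhat μ φ (t • momentMap (W := W) (H := H) (ModelT V) cotangentLift canonicalForm ξ) *
      expTwo (T := TangentSpace (ModelT V) ξ)
        (fun a b => Complex.I * t * ((canTwo (V := V) a b : ℝ) : ℂ)) p v := by
  simp only [pairing, expD_canonicalForm, fhat]
  rw [← integral_mul_const]
  simp only [mul_assoc]

end Action

/-! ### Parametrization of the annihilator by a frame, in a chart of M -/

section Frames

variable {V : Type*} [NormedAddCommGroup V] [NormedSpace ℝ V]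
  {M : Type*} [TopologicalSpace M] [ChartedSpace V M]

lemma coComp_sum_smul {k : ℕ} (x₀ m : M) (x : Fin k → ℝ) (α : Fin k → CoFibre (V := V) M m) :
    coComp x₀ m (∑ j, x j • α j) = ∑ j, x j • coComp x₀ m (α j) := by
  have h : ∀ (D : V →L[ℝ] V) (α : Fin k → V →L[ℝ] ℝ),
      (∑ j, x j • α j).comp D = ∑ j, x j • (α j).comp D := fun D α => by
    ext v
    simp
  exact h _ α

/-- The components of a family of covector fields in the chart around `x₀`. -/
def frameComp {k : ℕ} (α : Fin k → ∀ m : M, CoFibre (V := V) M m) (x₀ : M) (j : Fin k) (y : V) :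
    V →L[ℝ] ℝ :=
  coComp x₀ ((extChartAt 𝓘(ℝ, V) x₀).symm y) (α j ((extChartAt 𝓘(ℝ, V) x₀).symm y))

variable [IsManifold 𝓘(ℝ, V) ∞ M]

/-- The parametrization `(y, x) ↦ ∑ⱼ xⱼ αⱼ` in the chart around `x₀`. -/
def frameChart {k : ℕ} (α : Fin k → ∀ m : M, CoFibre (V := V) M m) (x₀ : M)
    (z : V × (Fin k → ℝ)) : Cotangent (V := V) M :=
  frameMap α ((extChartAt 𝓘(ℝ, V) x₀).symm z.1, z.2)

variable {k : ℕ} {α : Fin k → ∀ m : M, CoFibre (V := V) M m} {U : Set M}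

lemma contMDiffAt_frameMap {m : M} (x : Fin k → ℝ)
    (hα : ∀ j, ContMDiffAt 𝓘(ℝ, V) (ModelT V) ∞ (fun m => (⟨m, α j m⟩ : Cotangent (V := V) M)) m) :
    ContMDiffAt ((𝓘(ℝ, V)).prod 𝓘(ℝ, Fin k → ℝ)) (ModelT V) ∞ (frameMap α) (m, x) := by
  have hm : m ∈ (chartAt V m).source := mem_chart_source V m
  refine (contMDiffAt_cotangent_iff (x₀ := m) hm).2 ⟨contMDiffAt_fst, ?_⟩
  have h : (fun z : M × (Fin k → ℝ) => coComp m (frameMap α z).proj (frameMap α z).2) =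
      fun z => ∑ j, z.2 j • coComp m z.1 (α j z.1) := by
    funext z
    exact coComp_sum_smul m z.1 z.2 fun j => α j z.1
  rw [h]
  have h2 : ∀ j, ContMDiffAt ((𝓘(ℝ, V)).prod 𝓘(ℝ, Fin k → ℝ)) 𝓘(ℝ, V →L[ℝ] ℝ) ∞
      (fun z : M × (Fin k → ℝ) => z.2 j • coComp m z.1 (α j z.1)) (m, x) := fun j => by
    have h3 : ContMDiffAt ((𝓘(ℝ, V)).prod 𝓘(ℝ, Fin k → ℝ)) 𝓘(ℝ, ℝ) ∞
        (fun z : M × (Fin k → ℝ) => z.2 j) (m, x) :=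
      (by fun_prop : ContDiff ℝ ∞ fun z : Fin k → ℝ => z j).contMDiff.contMDiffAt.comp (m, x)
        contMDiffAt_snd
    have h4 : ContMDiffAt ((𝓘(ℝ, V)).prod 𝓘(ℝ, Fin k → ℝ)) 𝓘(ℝ, V →L[ℝ] ℝ) ∞
        (fun z : M × (Fin k → ℝ) => coComp m z.1 (α j z.1)) (m, x) :=
      ContMDiffAt.comp (m, x) (g := fun m' => coComp m m' (α j m'))
        ((contMDiffAt_cotangent_iff (x₀ := m) hm).1 (hα j)).2 contMDiffAt_fst
    exact (contDiff_smul (𝕜 := ℝ) (F := V →L[ℝ] ℝ)).contMDiff.contMDiffAt.comp (m, x)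
      (h3.prodMk_space h4)
  exact ContMDiffAt.sum fun j _ => h2 j

variable {x₀ : M}

lemma contDiffAt_frameComp {y : V} (hy : y ∈ (extChartAt 𝓘(ℝ, V) x₀).target) {j : Fin k}
    (hα : ContMDiffAt 𝓘(ℝ, V) (ModelT V) ∞ (fun m => (⟨m, α j m⟩ : Cotangent (V := V) M))
      ((extChartAt 𝓘(ℝ, V) x₀).symm y)) :
    ContDiffAt ℝ ∞ (frameComp α x₀ j) y := by
  have h := hα.comp y (contMDiffAt_chart_symm hy)
  have hs : (extChartAt 𝓘(ℝ, V) x₀).symm y ∈ (chartAt V x₀).source := by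
    simpa using (extChartAt 𝓘(ℝ, V) x₀).map_target hy
  exact ((contMDiffAt_cotangent_iff (G := (fun m => (⟨m, α j m⟩ : Cotangent (V := V) M)) ∘
    (extChartAt 𝓘(ℝ, V) x₀).symm) (x₀ := x₀) hs).1 h).2.contDiffAt

lemma contMDiffAt_frameChart {y : V} (hy : y ∈ (extChartAt 𝓘(ℝ, V) x₀).target) (x : Fin k → ℝ)
    (hα : ∀ j, ContMDiffAt 𝓘(ℝ, V) (ModelT V) ∞ (fun m => (⟨m, α j m⟩ : Cotangent (V := V) M))
      ((extChartAt 𝓘(ℝ, V) x₀).symm y)) :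
    ContMDiffAt 𝓘(ℝ, V × (Fin k → ℝ)) (ModelT V) ∞ (frameChart α x₀) (y, x) := by
  refine ContMDiffAt.comp (y, x) (f := fun z : V × (Fin k → ℝ) =>
    ((extChartAt 𝓘(ℝ, V) x₀).symm z.1, z.2)) (contMDiffAt_frameMap x hα) ?_
  refine ContMDiffAt.prodMk ?_ contDiff_snd.contMDiff.contMDiffAt
  exact (contMDiffAt_chart_symm hy).comp (y, x) contDiff_fst.contMDiff.contMDiffAt

lemma mfderiv_frameChart {y : V} (hy : y ∈ (extChartAt 𝓘(ℝ, V) x₀).target) (x : Fin k → ℝ)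
    (hα : ∀ j, ContMDiffAt 𝓘(ℝ, V) (ModelT V) ∞ (fun m => (⟨m, α j m⟩ : Cotangent (V := V) M))
      ((extChartAt 𝓘(ℝ, V) x₀).symm y)) (a : V × (Fin k → ℝ)) :
    (mfderiv 𝓘(ℝ, V × (Fin k → ℝ)) (ModelT V) (frameChart α x₀) (y, x) a : V × (V →L[ℝ] ℝ)) =
      mfderiv ((𝓘(ℝ, V)).prod 𝓘(ℝ, Fin k → ℝ)) (ModelT V) (frameMap α)
        ((extChartAt 𝓘(ℝ, V) x₀).symm y, x)
        (((mfderiv 𝓘(ℝ, V) 𝓘(ℝ, V) (extChartAt 𝓘(ℝ, V) x₀).symm y : V →L[ℝ] V) a.1, a.2) :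
          V × (Fin k → ℝ)) := by
  have d1 := ((contMDiffAt_frameMap x hα).mdifferentiableAt (by simp)).hasMFDerivAt
  have d2 : HasMFDerivAt 𝓘(ℝ, V × (Fin k → ℝ)) 𝓘(ℝ, V)
      (fun z : V × (Fin k → ℝ) => (extChartAt 𝓘(ℝ, V) x₀).symm z.1) (y, x)
      ((mfderiv 𝓘(ℝ, V) 𝓘(ℝ, V) (extChartAt 𝓘(ℝ, V) x₀).symm y : V →L[ℝ] V).comp
        (ContinuousLinearMap.fst ℝ V (Fin k → ℝ))) :=
    ((contMDiffAt_chart_symm hy).mdifferentiableAt (by simp)).hasMFDerivAt.comp (y, x)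
      (hasFDerivAt_fst (𝕜 := ℝ) (p := (y, x))).hasMFDerivAt
  have d3 : HasMFDerivAt 𝓘(ℝ, V × (Fin k → ℝ)) 𝓘(ℝ, Fin k → ℝ)
      (fun z : V × (Fin k → ℝ) => z.2) (y, x) (ContinuousLinearMap.snd ℝ V (Fin k → ℝ)) :=
    (hasFDerivAt_snd (𝕜 := ℝ) (p := (y, x))).hasMFDerivAt
  have d := HasMFDerivAt.comp (y, x) d1 (d2.prodMk d3)
  exact DFunLike.congr_fun d.mfderiv a

lemma map_append_single {V' : Type*} [NormedAddCommGroup V'] [NormedSpace ℝ V'] {p : ℕ} (D : V →L[ℝ] V') (u : Fin p → V)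
    (i : Fin (p + k)) :
    Fin.append (fun i => ((D (u i), 0) : V' × (Fin k → ℝ)))
        (fun j => ((0, Pi.single j 1) : V' × (Fin k → ℝ))) i =
      (D (Fin.append (fun i => ((u i, 0) : V × (Fin k → ℝ)))
        (fun j => ((0, Pi.single j 1) : V × (Fin k → ℝ))) i).1,
      (Fin.append (fun i => ((u i, 0) : V × (Fin k → ℝ)))
        (fun j => ((0, Pi.single j 1) : V × (Fin k → ℝ))) i).2) := by
  refine Fin.addCases (fun i => ?_) (fun j => ?_) i
  · rw [Fin.append_left, Fin.append_left]
  · rw [Fin.append_right, Fin.append_right, map_zero]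

/-- The integrand over the fibres in the chart around `x₀`. -/
lemma fibreIntegrand_chart {y : V} (hy : y ∈ (extChartAt 𝓘(ℝ, V) x₀).target) (x : Fin k → ℝ)
    (hα : ∀ j, ContMDiffAt 𝓘(ℝ, V) (ModelT V) ∞ (fun m => (⟨m, α j m⟩ : Cotangent (V := V) M))
      ((extChartAt 𝓘(ℝ, V) x₀).symm y)) (η : Form (ModelT V) (Cotangent (V := V) M)) (p : ℕ)
    (u : Fin p → V) :
    fibreIntegrand α η ((extChartAt 𝓘(ℝ, V) x₀).symm y) p
        (fun i => mfderiv 𝓘(ℝ, V) 𝓘(ℝ, V) (extChartAt 𝓘(ℝ, V) x₀).symm y (u i)) x =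
      η (frameChart α x₀ (y, x)) (p + k)
        (fun i => mfderiv 𝓘(ℝ, V × (Fin k → ℝ)) (ModelT V) (frameChart α x₀) (y, x)
          (Fin.append (fun i => ((u i, 0) : V × (Fin k → ℝ)))
            (fun j => ((0, Pi.single j 1) : V × (Fin k → ℝ))) i)) := by
  simp only [fibreIntegrand, pullback]
  refine congrArg (η (frameChart α x₀ (y, x)) (p + k)) (funext fun i => ?_)
  refine Eq.trans ?_ (mfderiv_frameChart hy x hα _).symm
  refine congrArg (mfderiv ((𝓘(ℝ, V)).prod 𝓘(ℝ, Fin k → ℝ)) (ModelT V) (frameMap α)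
        ((extChartAt 𝓘(ℝ, V) x₀).symm y, x)) ?_
  exact map_append_single (V := V) (V' := V) (mfderiv 𝓘(ℝ, V) 𝓘(ℝ, V) (extChartAt 𝓘(ℝ, V) x₀).symm y :
    V →L[ℝ] V) u i

/-- The pull-back of `e^{itω}` by a parametrized frame with components `c`, evaluated on the vectors
`u` and the coordinate vectors of the fibre. -/
def frameExp (c : Fin k → V → (V →L[ℝ] ℝ)) (t : ℝ) (y : V) (p : ℕ) (u : Fin p → V)
    (x : Fin k → ℝ) : ℂ :=
  expTwo (fun a b => Complex.I * t * ((canTwo a b : ℝ) : ℂ)) (p + k)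
    (Fin.append (fun i => (u i, ∑ j, x j • fderiv ℝ (c j) y (u i))) (fun j => (0, c j y)))

/-- The vectors `u` and the coordinate vectors of the fibre. -/
def frameVec {p : ℕ} (u : Fin p → V) (i : Fin (p + k)) : V × (Fin k → ℝ) :=
  Fin.append (fun i => ((u i, 0) : V × (Fin k → ℝ)))
    (fun j => ((0, Pi.single j 1) : V × (Fin k → ℝ))) i

/-- The images of the vectors `frameVec` in a parametrized frame with components `c`. -/
def frameCoord (c : Fin k → V → (V →L[ℝ] ℝ)) (y : V) {p : ℕ} (u : Fin p → V) (x : Fin k → ℝ)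
    (i : Fin (p + k)) : V × (V →L[ℝ] ℝ) :=
  Fin.append (fun i => (u i, ∑ j, x j • fderiv ℝ (c j) y (u i))) (fun j => (0, c j y)) i

lemma eventually_contMDiffAt_frameChart (hU : IsOpen U)
    (hα : ∀ j, ContMDiffOn 𝓘(ℝ, V) (ModelT V) ∞ (fun m => (⟨m, α j m⟩ : Cotangent (V := V) M)) U)
    {y : V} (hy : y ∈ (extChartAt 𝓘(ℝ, V) x₀).target)
    (hyU : (extChartAt 𝓘(ℝ, V) x₀).symm y ∈ U) (x : Fin k → ℝ) :
    ∀ᶠ z in 𝓝 (y, x), z.1 ∈ (extChartAt 𝓘(ℝ, V) x₀).target ∧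
      ContMDiffAt 𝓘(ℝ, V × (Fin k → ℝ)) (ModelT V) ∞ (frameChart α x₀) z := by
  have hev : ∀ᶠ y' in 𝓝 y, y' ∈ (extChartAt 𝓘(ℝ, V) x₀).target ∧
      (extChartAt 𝓘(ℝ, V) x₀).symm y' ∈ U :=
    (Filter.eventually_mem_set.2 ((isOpen_extChartAt_target x₀).mem_nhds hy)).and
      ((contMDiffAt_chart_symm hy).continuousAt.preimage_mem_nhds (hU.mem_nhds hyU))
  filter_upwards [(continuousAt_fst (p := (y, x))).eventually hev] with z hz
  exact ⟨hz.1, contMDiffAt_frameChart hz.1 z.2 fun j => (hα j).contMDiffAt (hU.mem_nhds hz.2)⟩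

section

variable (hU : IsOpen U)
    (hα : ∀ j, ContMDiffOn 𝓘(ℝ, V) (ModelT V) ∞ (fun m => (⟨m, α j m⟩ : Cotangent (V := V) M)) U)
    {y : V} (hy : y ∈ (extChartAt 𝓘(ℝ, V) x₀).target)
    (hyU : (extChartAt 𝓘(ℝ, V) x₀).symm y ∈ U) (x : Fin k → ℝ) {p : ℕ} (u : Fin p → V)
include hU hα hy hyU

/-- In coordinates the parametrization is (y, x) ↦ (y, Σ xⱼ cⱼ(y)). Its derivative is (u, Σ xⱼ
dcⱼ(u)) in a base direction and (0, cⱼ(y)) in the j-th fibre direction. -/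
lemma fderiv_frameChart (i : Fin (p + k)) :
    (fderiv ℝ (fun z => extChartAt 𝓘(ℝ, V) x₀ (frameChart α x₀ z).proj) (y, x) (frameVec u i),
      fderiv ℝ (fun z => coComp x₀ (frameChart α x₀ z).proj (frameChart α x₀ z).2) (y, x)
        (frameVec u i)) = frameCoord (frameComp α x₀) y u x i := by
  have hQ : HasFDerivAt (fun z => extChartAt 𝓘(ℝ, V) x₀ (frameChart α x₀ z).proj)
      (ContinuousLinearMap.fst ℝ V (Fin k → ℝ)) (y, x) := by
    refine hasFDerivAt_fst.congr_of_eventuallyEq ?_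
    filter_upwards [eventually_contMDiffAt_frameChart hU hα hy hyU x] with z hz
    exact (extChartAt 𝓘(ℝ, V) x₀).right_inv hz.1
  have hc : ∀ j, HasFDerivAt (frameComp α x₀ j) (fderiv ℝ (frameComp α x₀ j) y) y := fun j =>
    ((contDiffAt_frameComp hy ((hα j).contMDiffAt (hU.mem_nhds hyU))).differentiableAt
      (by simp)).hasFDerivAt
  have hPe : (fun z => coComp x₀ (frameChart α x₀ z).proj (frameChart α x₀ z).2) =
      fun z => ∑ j, z.2 j • frameComp α x₀ j z.1 := by
    funext z
    exact coComp_sum_smul x₀ _ z.2 fun j => α j _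
  have hPj : ∀ j, HasFDerivAt (fun z : V × (Fin k → ℝ) => z.2 j • frameComp α x₀ j z.1)
      (x j • (fderiv ℝ (frameComp α x₀ j) y).comp (ContinuousLinearMap.fst ℝ V (Fin k → ℝ)) +
        ((ContinuousLinearMap.proj j).comp (ContinuousLinearMap.snd ℝ V (Fin k → ℝ))).smulRight
          (frameComp α x₀ j y)) (y, x) := fun j => by
    have h1 : HasFDerivAt (fun z : V × (Fin k → ℝ) => z.2 j)
      ((ContinuousLinearMap.proj j).comp (ContinuousLinearMap.snd ℝ V (Fin k → ℝ))) (y, x) :=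
      ((ContinuousLinearMap.proj (R := ℝ) (φ := fun _ : Fin k => ℝ) j).comp
        (ContinuousLinearMap.snd ℝ V (Fin k → ℝ))).hasFDerivAt
    exact h1.smul ((hc j).comp (y, x) hasFDerivAt_fst)
  have hP := HasFDerivAt.fun_sum (u := Finset.univ) fun j _ => hPj j
  rw [hQ.fderiv, hPe, hP.fderiv]
  refine Fin.addCases (fun i => ?_) (fun j => ?_) i
  · simp only [frameVec, frameCoord]
    rw [Fin.append_left, Fin.append_left]
    simp [sum_apply]
  · simp only [frameVec, frameCoord]
    rw [Fin.append_right, Fin.append_right]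
    simp [sum_apply, Pi.single_apply]

lemma canTwo_mfderiv_frameChart (a b : Fin (p + k)) :
    canTwo (V := V)
        (mfderiv 𝓘(ℝ, V × (Fin k → ℝ)) (ModelT V) (frameChart α x₀) (y, x) (frameVec u a))
        (mfderiv 𝓘(ℝ, V × (Fin k → ℝ)) (ModelT V) (frameChart α x₀) (y, x) (frameVec u b)) =
      canTwo (frameCoord (frameComp α x₀) y u x a) (frameCoord (frameComp α x₀) y u x b) := by
  have hys : (extChartAt 𝓘(ℝ, V) x₀).symm y ∈ (chartAt V x₀).source := by
    simpa using (extChartAt 𝓘(ℝ, V) x₀).map_target hy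
  have hs : (frameChart α x₀ (y, x)).proj ∈ (chartAt V x₀).source := hys
  rw [← fderiv_frameChart hU hα hy hyU, ← fderiv_frameChart hU hα hy hyU]
  exact canTwo_mfderiv_eq ((eventually_contMDiffAt_frameChart hU hα hy hyU x).mono fun _ h => h.2)
    hs _ _

lemma canonicalForm_mfderiv_frameChart (a : Fin (p + k)) :
    canonicalForm (frameChart α x₀ (y, x))
        (mfderiv 𝓘(ℝ, V × (Fin k → ℝ)) (ModelT V) (frameChart α x₀) (y, x) (frameVec u a)) =
      ∑ j, x j * frameComp α x₀ j y (frameCoord (frameComp α x₀) y u x a).1 := by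
  have hys : (extChartAt 𝓘(ℝ, V) x₀).symm y ∈ (chartAt V x₀).source := by
    simpa using (extChartAt 𝓘(ℝ, V) x₀).map_target hy
  have hs : (frameChart α x₀ (y, x)).proj ∈ (chartAt V x₀).source := hys
  refine (canonicalForm_mfderiv_eq_coComp
    (eventually_contMDiffAt_frameChart hU hα hy hyU x).self_of_nhds.2 hs _).trans ?_
  rw [← fderiv_frameChart hU hα hy hyU x u a]
  have h : coComp x₀ (frameChart α x₀ (y, x)).proj (frameChart α x₀ (y, x)).2 =
    ∑ j, x j • frameComp α x₀ j y := coComp_sum_smul x₀ _ x fun j => α j _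
  rw [h]
  simp [sum_apply]

lemma expTwo_mfderiv_frameChart (t : ℝ) :
    expTwo (T := V × (V →L[ℝ] ℝ)) (fun a b => Complex.I * t * ((canTwo a b : ℝ) : ℂ)) (p + k)
        (fun i => mfderiv 𝓘(ℝ, V × (Fin k → ℝ)) (ModelT V) (frameChart α x₀) (y, x)
          (Fin.append (fun i => ((u i, 0) : V × (Fin k → ℝ)))
            (fun j => ((0, Pi.single j 1) : V × (Fin k → ℝ))) i)) =
      frameExp (frameComp α x₀) t y p u x :=
  expTwo_congr fun a b => congrArg (fun r : ℝ => Complex.I * t * (r : ℂ))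
    (canTwo_mfderiv_frameChart hU hα hy hyU x u a b)

end

end Frames

/-! ### Local formula for the fibre integrand -/

section LocalForm

variable {V : Type*} [NormedAddCommGroup V] [NormedSpace ℝ V]
  {M : Type*} [TopologicalSpace M] [ChartedSpace V M] [IsManifold 𝓘(ℝ, V) ∞ M]
  {k : ℕ} {α : Fin k → ∀ m : M, CoFibre (V := V) M m} {U : Set M} {x₀ : M}

/-- The values of the canonical 2-form on the pushed-forward vectors are affine in x with
coefficients smooth in y. The exponential is a polynomial in these values, and functions of moderate
growth form an algebra. -/
lemma isModerate_frameExp {Ω L : Set V} (hΩ : IsOpen Ω) (hL : L ⊆ Ω) (hLc : IsCompact L)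
    {c : Fin k → V → (V →L[ℝ] ℝ)} (hc : ∀ j, ContDiffOn ℝ ∞ (c j) Ω) (t : ℝ) (p : ℕ)
    (u : Fin p → V) :
    IsModerate Ω L (fun z : V × (Fin k → ℝ) => frameExp c t z.1 p u z.2) := by
  have hcst : ∀ f : V → ℝ, ContDiffOn ℝ ∞ f Ω →
      (fun z : V × (Fin k → ℝ) => (f z.1 : ℂ)) ∈ moderate (Fin k → ℝ) hΩ hL hLc := fun f hf =>
    isModerate_comp_fst hΩ hL hLc (Complex.ofRealCLM.contDiff.comp_contDiffOn hf)
  have happ : ∀ (g : V → (V →L[ℝ] ℝ)) (v : V), ContDiffOn ℝ ∞ g Ω →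
      ContDiffOn ℝ ∞ (fun y => g y v) Ω := fun g v hg => hg.clm_apply contDiffOn_const
  have hdapp : ∀ (j : Fin k) (v w : V), ContDiffOn ℝ ∞ (fun y => fderiv ℝ (c j) y v w) Ω :=
    fun j v w => (((hc j).fderiv_of_isOpen hΩ (m := ∞) (by simp)).clm_apply
      contDiffOn_const).clm_apply contDiffOn_const
  have hx : ∀ j : Fin k, (fun z : V × (Fin k → ℝ) => (z.2 j : ℂ)) ∈
      moderate (Fin k → ℝ) hΩ hL hLc := fun j =>
    isModerate_snd_apply hΩ hL (F := ℂ)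
      (Complex.ofRealCLM.comp (ContinuousLinearMap.proj (R := ℝ) (φ := fun _ : Fin k => ℝ) j))
  set S := moderate (Fin k → ℝ) hΩ hL hLc
  have hsum : ∀ f : Fin k → V × (Fin k → ℝ) → ℂ, (∀ i, f i ∈ S) →
      (fun z => ∑ i, f i z) ∈ S := fun f h => by
    have := S.sum_mem (t := Finset.univ) fun i _ => h i
    convert this using 1
    funext z
    simp
  have hdsum : ∀ v w : V, (fun z : V × (Fin k → ℝ) =>
      (((∑ j, z.2 j • fderiv ℝ (c j) z.1 v) w : ℝ) : ℂ)) ∈ S := fun v w => by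
    have h := hsum (fun j z => (z.2 j : ℂ) * ((fderiv ℝ (c j) z.1 v w : ℝ) : ℂ))
      fun j => S.mul_mem (hx j) (hcst _ (hdapp j v w))
    convert h using 1
    funext z
    simp [sum_apply]
  have hzero : (fun _ : V × (Fin k → ℝ) => (0 : ℂ)) ∈ S := S.zero_mem
  have hneg : ∀ f ∈ S, (fun z => -f z) ∈ S := fun f hf => S.neg_mem hf
  have key : (fun z : V × (Fin k → ℝ) => frameExp c t z.1 p u z.2) = fun z =>
      expTwo (fun a b => Complex.I * t * ((canTwo
        (Fin.append (fun i => ((u i, ∑ j, z.2 j • fderiv ℝ (c j) z.1 (u i)) : V × (V →L[ℝ] ℝ)))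
          (fun j => (0, c j z.1)) a)
        (Fin.append (fun i => ((u i, ∑ j, z.2 j • fderiv ℝ (c j) z.1 (u i)) : V × (V →L[ℝ] ℝ)))
          (fun j => (0, c j z.1)) b) : ℝ) : ℂ)) (p + k) id := by
    funext z
    rw [frameExp, expTwo_eq_index]
  change _ ∈ S
  rw [key]
  refine expTwo_mem S _ (fun a b => ?_) _ _
  refine S.mul_mem (S.algebraMap_mem (Complex.I * t)) ?_
  simp only [canTwo, Complex.ofReal_sub]
  refine S.sub_mem ?_ ?_ <;> refine Fin.addCases (fun i => ?_) (fun i => ?_) a <;>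
    refine Fin.addCases (fun j => ?_) (fun j => ?_) b <;>
    simp only [Fin.append_left, Fin.append_right, map_zero, Complex.ofReal_zero]
  all_goals first
    | exact hdsum _ _
    | exact hzero
    | exact hcst _ (happ _ _ (hc _))

variable {W : Type*} [NormedAddCommGroup W] [NormedSpace ℝ W]
  {H : Type*} [Group H] [TopologicalSpace H] [ChartedSpace W H] [LieGroup 𝓘(ℝ, W) ∞ H]
  [MulAction H M] [ContMDiffSMul 𝓘(ℝ, W) 𝓘(ℝ, V) ∞ H M]

variable (H) in
/-- The values of the moment map of the canonical form on a frame. -/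
def frameMoment (α : Fin k → ∀ m : M, CoFibre (V := V) M m) (m : M) (j : Fin k) : W →L[ℝ] ℝ :=
  -((α j m : V →L[ℝ] ℝ).comp
    (fundamental (H := H) 𝓘(ℝ, V) (fun (g : H) (x : M) => g • x) m : W →L[ℝ] V))

lemma momentMap_frameMap (α : Fin k → ∀ m : M, CoFibre (V := V) M m) (m : M) (x : Fin k → ℝ) :
    momentMap (W := W) (H := H) (ModelT V) cotangentLift canonicalForm (frameMap α (m, x)) =
      ∑ j, x j • frameMoment H α m j := by
  ext X
  rw [momentMap_apply]
  have h : ∀ (c : Fin k → V →L[ℝ] ℝ) (F : W →L[ℝ] V),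
      -(∑ j, x j • c j) (F X) = (∑ j, x j • (-((c j).comp F))) X := fun c F => by
    simp [sum_apply]
  exact h (fun j => α j m) _

variable [MeasurableSpace W] (μ : Measure W)

/-- The working formula for the fibre integrand: an oscillatory factor depending on a linear
function of x, times a polynomial in x. -/
lemma fibreIntegrand_pairing (hU : IsOpen U)
    (hα : ∀ j, ContMDiffOn 𝓘(ℝ, V) (ModelT V) ∞ (fun m => (⟨m, α j m⟩ : Cotangent (V := V) M)) U)
    {y : V} (hy : y ∈ (extChartAt 𝓘(ℝ, V) x₀).target)
    (hyU : (extChartAt 𝓘(ℝ, V) x₀).symm y ∈ U) (x : Fin k → ℝ) (t : ℝ)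
    (φ : 𝓓((⊤ : TopologicalSpace.Opens W), ℂ)) (p : ℕ) (u : Fin p → V) :
    fibreIntegrand α (pairing (ModelT V) μ (expD (H := H) (ModelT V) cotangentLift canonicalForm t) φ)
        ((extChartAt 𝓘(ℝ, V) x₀).symm y) p
        (fun i => mfderiv 𝓘(ℝ, V) 𝓘(ℝ, V) (extChartAt 𝓘(ℝ, V) x₀).symm y (u i)) x =
      fhat μ φ (t • ∑ j, x j • frameMoment H α ((extChartAt 𝓘(ℝ, V) x₀).symm y) j) *
        frameExp (frameComp α x₀) t y p u x := by
  rw [fibreIntegrand_chart hy x fun j => (hα j).contMDiffAt (hU.mem_nhds hyU), pairing_expD]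
  congr 1
  · rw [← momentMap_frameMap]
    rfl
  · exact expTwo_mfderiv_frameChart hU hα hy hyU x u t

end LocalForm

/-! ### Transversality and smoothness of the moment map on a frame -/

section Smooth

variable {V : Type*} [NormedAddCommGroup V] [NormedSpace ℝ V]
  {M : Type*} [TopologicalSpace M] [ChartedSpace V M] [IsManifold 𝓘(ℝ, V) ∞ M]
  {k : ℕ} {α : Fin k → ∀ m : M, CoFibre (V := V) M m} {U : Set M} {x₀ : M}
  {W : Type*} [NormedAddCommGroup W] [NormedSpace ℝ W]
  {H : Type*} [Group H] [TopologicalSpace H] [ChartedSpace W H] [LieGroup 𝓘(ℝ, W) ∞ H]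
  [MulAction H M] [ContMDiffSMul 𝓘(ℝ, W) 𝓘(ℝ, V) ∞ H M]

-- If Σ gⱼ aⱼ vanishes on the image of `F`, it vanishes on all of V, since it also vanishes on the
-- common kernel of the aⱼ and the two together span.
omit [IsManifold 𝓘(ℝ, V) ∞ M] in
lemma linearIndependent_neg_comp {a : Fin k → V →L[ℝ] ℝ} (ha : LinearIndependent ℝ a)
    {F : W →L[ℝ] V} (h : ∀ v, ∃ e, (∀ j, a j e = 0) ∧ ∃ X, e + F X = v) :
    LinearIndependent ℝ fun j => -((a j).comp F) := by
  rw [Fintype.linearIndependent_iff] at ha ⊢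
  intro g hg
  refine ha g (ContinuousLinearMap.ext fun v => ?_)
  obtain ⟨e, he, X, rfl⟩ := h v
  have h4 := DFunLike.congr_fun hg X
  simpa [sum_apply, he, mul_add] using h4

lemma linearIndependent_coe {E' : Type*} [AddCommGroup E'] [Module ℝ E'] (S : Submodule ℝ E')
    {b : Fin k → S} (hb : LinearIndependent ℝ b) : LinearIndependent ℝ fun j => (b j : E') :=
  hb.map' S.subtype (Submodule.ker_subtype S)

-- Here transversality enters: a covector that kills both `D.E m` and the orbit directions is 0, so
-- the moment map is injective on the fibres of E⁰.
omit [LieGroup 𝓘(ℝ, W) ∞ H] [ContMDiffSMul 𝓘(ℝ, W) 𝓘(ℝ, V) ∞ H M] in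
lemma linearIndependent_frameMoment {D : CoorientedDistribution V M k}
    (hT : Transverse (W := W) D H) (hα : IsOrientedFrame D.E D.o U α) {m : M} (hm : m ∈ U) :
    LinearIndependent ℝ fun j => frameMoment (W := W) H α m j := by
  obtain ⟨b, hb, -⟩ := hα.oriented m hm
  have hli : LinearIndependent ℝ fun j => ((b j : annihilator D.E m) : V →L[ℝ] ℝ) :=
    linearIndependent_coe _ b.linearIndependent
  have hb' : (fun j => ((b j : annihilator D.E m) : V →L[ℝ] ℝ)) =
    fun j => (α j m : V →L[ℝ] ℝ) := funext hb
  rw [hb'] at hli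
  refine linearIndependent_neg_comp (V := V) hli fun v₀ => ?_
  obtain ⟨v, hv₀⟩ : ∃ v : TangentSpace 𝓘(ℝ, V) m, v = v₀ := ⟨v₀, rfl⟩
  have hv : v ∈ D.E m ⊔ (fundamental (H := H) 𝓘(ℝ, V) (fun (g : H) (x : M) => g • x) m :
      W →L[ℝ] TangentSpace 𝓘(ℝ, V) m).range := by
    rw [hT m]; trivial
  obtain ⟨e, he, _, ⟨X, rfl⟩, hv'⟩ := Submodule.mem_sup.1 hv
  refine ⟨e, fun j => ?_, X, hv'.trans hv₀⟩
  have h1 := (b j).2 e he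
  exact (congrArg (fun f : V →L[ℝ] ℝ => f e) (hb j)).symm.trans h1

variable (H) in
/-- The fundamental vector fields in the chart around `x₀`. -/
def fundamentalChart (W : Type*) [NormedAddCommGroup W] [NormedSpace ℝ W] [ChartedSpace W H]
    (x₀ : M) (y : V) : W →L[ℝ] V :=
  (mfderiv 𝓘(ℝ, V) 𝓘(ℝ, V) (extChartAt 𝓘(ℝ, V) x₀) ((extChartAt 𝓘(ℝ, V) x₀).symm y) :
    V →L[ℝ] V).comp (fundamental (H := H) 𝓘(ℝ, V) (fun (g : H) (x : M) => g • x)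
      ((extChartAt 𝓘(ℝ, V) x₀).symm y) : W →L[ℝ] V)

/-- In charts of M and of H at 1 this is the derivative in the group variable of the action map, at
a fixed point of the group chart, with y as a parameter. -/
lemma contDiffAt_fundamentalChart {y : V} (hy : y ∈ (extChartAt 𝓘(ℝ, V) x₀).target) :
    ContDiffAt ℝ ∞ (fundamentalChart H W x₀) y := by
  let w₀ : W := extChartAt 𝓘(ℝ, W) (1 : H) 1
  have hw₀ : (extChartAt 𝓘(ℝ, W) (1 : H)).symm w₀ = 1 :=
    (extChartAt 𝓘(ℝ, W) (1 : H)).left_inv (mem_extChartAt_source 1)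
  let f : V → W → V := fun y' w => extChartAt 𝓘(ℝ, V) x₀
    ((extChartAt 𝓘(ℝ, W) (1 : H)).symm w • (extChartAt 𝓘(ℝ, V) x₀).symm y')
  have hs : ∀ y' ∈ (extChartAt 𝓘(ℝ, V) x₀).target,
      (extChartAt 𝓘(ℝ, V) x₀).symm y' ∈ (chartAt V x₀).source := fun y' hy' => by
    simpa using (extChartAt 𝓘(ℝ, V) x₀).map_target hy'
  have hsmul : ContMDiff ((𝓘(ℝ, W)).prod 𝓘(ℝ, V)) 𝓘(ℝ, V) ∞ (fun q : H × M => q.1 • q.2) :=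
    ContMDiffSMul.contMDiff_smul
  have hf : ContMDiffAt ((𝓘(ℝ, V)).prod 𝓘(ℝ, W)) 𝓘(ℝ, V) ∞ (Function.uncurry f) (y, w₀) := by
    refine ContMDiffAt.comp (I' := 𝓘(ℝ, V)) (g := extChartAt 𝓘(ℝ, V) x₀) (f := fun z : V × W =>
      (extChartAt 𝓘(ℝ, W) (1 : H)).symm z.2 • (extChartAt 𝓘(ℝ, V) x₀).symm z.1) (y, w₀) ?_ ?_
    · refine contMDiffAt_chart ?_
      simpa only [hw₀, one_smul] using hs y hy
    · refine ContMDiffAt.comp (f := fun z : V × W => ((extChartAt 𝓘(ℝ, W) (1 : H)).symm z.2,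
        (extChartAt 𝓘(ℝ, V) x₀).symm z.1)) (y, w₀)
        (hsmul ((extChartAt 𝓘(ℝ, W) (1 : H)).symm w₀, (extChartAt 𝓘(ℝ, V) x₀).symm y)) ?_
      exact ((contMDiffAt_chart_symm (mem_extChartAt_target (1 : H))).comp (y, w₀)
        contMDiffAt_snd).prodMk ((contMDiffAt_chart_symm hy).comp (y, w₀) contMDiffAt_fst)
  refine (contMDiffAt_fderiv_param hf contMDiffAt_const).contDiffAt.congr_of_eventuallyEq ?_
  filter_upwards [(isOpen_extChartAt_target x₀).mem_nhds hy] with y' hy'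
  have d1 := ((contMDiffAt_chart_symm (mem_extChartAt_target (I := 𝓘(ℝ, W))
    (1 : H))).mdifferentiableAt (by simp)).hasMFDerivAt
  have d2 : ∀ h, h = (1 : H) → HasMFDerivAt 𝓘(ℝ, W) 𝓘(ℝ, V)
      (fun h : H => h • (extChartAt 𝓘(ℝ, V) x₀).symm y') h
      (mfderiv 𝓘(ℝ, W) 𝓘(ℝ, V) (fun h : H => h • (extChartAt 𝓘(ℝ, V) x₀).symm y') 1 :
        W →L[ℝ] V) := by
    rintro _ rfl
    exact ((contMDiff_smul_right _).mdifferentiable (by simp) 1).hasMFDerivAt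
  have d3 : ∀ m, m = (extChartAt 𝓘(ℝ, V) x₀).symm y' → HasMFDerivAt 𝓘(ℝ, V) 𝓘(ℝ, V)
      (extChartAt 𝓘(ℝ, V) x₀) m (mfderiv 𝓘(ℝ, V) 𝓘(ℝ, V) (extChartAt 𝓘(ℝ, V) x₀)
        ((extChartAt 𝓘(ℝ, V) x₀).symm y') : V →L[ℝ] V) := by
    rintro _ rfl
    exact (mdifferentiableAt_chart (hs y' hy')).hasMFDerivAt
  have d := (d3 ((extChartAt 𝓘(ℝ, W) (1 : H)).symm w₀ • (extChartAt 𝓘(ℝ, V) x₀).symm y')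
    (by rw [hw₀, one_smul])).comp (f := (fun h : H => h • (extChartAt 𝓘(ℝ, V) x₀).symm y') ∘
      (extChartAt 𝓘(ℝ, W) (1 : H)).symm) w₀ ((d2 _ hw₀).comp _ d1)
  ext X
  have key : ∀ D : W →L[ℝ] V, HasFDerivAt (f y') D w₀ → ∀ c, D X = c →
      c = fderiv ℝ (f y') w₀ X := by
    rintro D hD c rfl
    rw [hD.fderiv]
  refine key _ d.hasFDerivAt _ ?_
  -- The chart of H at 1 has the identity as differential there, hence so has its inverse, and no
  -- extra factor remains.
  have hX := mfderiv_chart_symm_mfderiv_chart (mem_chart_source W (1 : H)) X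
  rw [mfderiv_extChartAt_self] at hX
  exact congrArg (fun X' : W => (mfderiv 𝓘(ℝ, V) 𝓘(ℝ, V) (extChartAt 𝓘(ℝ, V) x₀)
      ((extChartAt 𝓘(ℝ, V) x₀).symm y') : V →L[ℝ] V)
    ((fundamental (H := H) 𝓘(ℝ, V) (fun (g : H) (x : M) => g • x)
      ((extChartAt 𝓘(ℝ, V) x₀).symm y') : W →L[ℝ] V) X')) hX

lemma contDiffAt_frameMoment {y : V} (hy : y ∈ (extChartAt 𝓘(ℝ, V) x₀).target) {j : Fin k}
    (hα : ContMDiffAt 𝓘(ℝ, V) (ModelT V) ∞ (fun m => (⟨m, α j m⟩ : Cotangent (V := V) M))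
      ((extChartAt 𝓘(ℝ, V) x₀).symm y)) :
    ContDiffAt ℝ ∞ (fun y' => frameMoment (W := W) H α ((extChartAt 𝓘(ℝ, V) x₀).symm y') j) y := by
  have h := ((contDiffAt_frameComp hy hα).clm_comp
    (contDiffAt_fundamentalChart (W := W) (H := H) hy)).neg
  refine h.congr_of_eventuallyEq ?_
  filter_upwards [(isOpen_extChartAt_target x₀).mem_nhds hy] with y' hy'
  have hs : (extChartAt 𝓘(ℝ, V) x₀).symm y' ∈ (chartAt V x₀).source := by
    simpa using (extChartAt 𝓘(ℝ, V) x₀).map_target hy'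
  ext X
  exact congrArg Neg.neg (coComp_mfderiv_chart hs _ _).symm

end Smooth

/-! ### Change of frame in the integrand -/

section FrameChange

variable {V : Type*} [NormedAddCommGroup V] [NormedSpace ℝ V] {k : ℕ}

/-- The canonical two-form as a bilinear map. -/
def canTwoBilin (V : Type*) [NormedAddCommGroup V] [NormedSpace ℝ V] (κ : ℂ) :
    V × (V →L[ℝ] ℝ) →ₗ[ℝ] V × (V →L[ℝ] ℝ) →ₗ[ℝ] ℂ :=
  LinearMap.mk₂ ℝ (fun a b => κ * ((canTwo a b : ℝ) : ℂ))
    (fun a a' b => by simp [canTwo]; ring) (fun c a b => by simp [canTwo]; ring)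
    (fun a b b' => by simp [canTwo]; ring) (fun c a b => by simp [canTwo]; ring)

lemma isAlt_expTwo_canTwo (κ : ℂ) :
    IsAlt (expTwo (T := V × (V →L[ℝ] ℝ)) (fun a b => κ * ((canTwo a b : ℝ) : ℂ))) :=
  isAlt_expTwo (canTwoBilin V κ) fun v => by simp [canTwoBilin, canTwo]

/-- If a family of vectors stays in the span of a frame, then so does its derivative at a zero. -/
lemma fderiv_mem_span_of_eventually {E' : Type*} [NormedAddCommGroup E'] [NormedSpace ℝ E']
    [FiniteDimensional ℝ E']
    {c : Fin k → V → E'} {γ : V → E'} {y : V} (hc : ∀ j, DifferentiableAt ℝ (c j) y)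
    (hli : LinearIndependent ℝ fun j => c j y) (hγ : DifferentiableAt ℝ γ y) (h0 : γ y = 0)
    (hmem : ∀ᶠ y' in 𝓝 y, γ y' ∈ Submodule.span ℝ (Set.range fun j => c j y')) (v : V) :
    fderiv ℝ γ y v ∈ Submodule.span ℝ (Set.range fun j => c j y) := by
  let T : V → (Fin k → ℝ) →L[ℝ] E' := fun y' =>
    ∑ j, (ContinuousLinearMap.proj (R := ℝ) (φ := fun _ : Fin k => ℝ) j).smulRight (c j y')
  have hTapp : ∀ y' x, T y' x = ∑ j, x j • c j y' := fun y' x => by simp [T, sum_apply]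
  have hTd : DifferentiableAt ℝ T y := by
    refine DifferentiableAt.fun_sum fun j _ => ?_
    exact (ContinuousLinearMap.smulRightL ℝ (Fin k → ℝ) E'
      (ContinuousLinearMap.proj j)).differentiableAt.comp y (hc j)
  have hTinj : Function.Injective (T y) := by
    rw [injective_iff_map_eq_zero]
    intro x hx
    rw [hTapp] at hx
    exact funext (Fintype.linearIndependent_iff.1 hli x hx)
  -- With a left inverse `N` of the frame map at y, the endomorphism N T(y') is invertible near y.
  -- So the coordinates `e` of γ in the moving frame are differentiable and vanish at y, and
  -- differentiating γ = T e leaves only T(y) e'(y).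
  obtain ⟨N, hN⟩ : ∃ N : E' →L[ℝ] (Fin k → ℝ), N.comp (T y) = ContinuousLinearMap.id ℝ _ := by
    obtain ⟨N, hN⟩ := LinearMap.exists_leftInverse_of_injective (T y : (Fin k → ℝ) →ₗ[ℝ] E')
      (LinearMap.ker_eq_bot.2 hTinj)
    exact ⟨N.toContinuousLinearMap, ContinuousLinearMap.ext fun x => DFunLike.congr_fun hN x⟩
  let S : V → (Fin k → ℝ) →L[ℝ] (Fin k → ℝ) := fun y' => N.comp (T y')
  have hSd : DifferentiableAt ℝ S y := (differentiableAt_const N).clm_comp hTd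
  have hSy : S y = 1 := hN
  let e : V → (Fin k → ℝ) := fun y' => Ring.inverse (S y') (N (γ y'))
  have hed : DifferentiableAt ℝ e y := by
    refine DifferentiableAt.clm_apply ?_ (N.differentiableAt.comp y hγ)
    have h1 : DifferentiableAt ℝ Ring.inverse (S y) := by
      rw [hSy]
      exact differentiableAt_inverse (𝕜 := ℝ) (x := (1 : (Fin k → ℝ) →L[ℝ] (Fin k → ℝ))) isUnit_one
    exact h1.comp y hSd
  have he0 : e y = 0 := by simp [e, h0]
  have hev : γ =ᶠ[𝓝 y] fun y' => T y' (e y') := by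
    have hunit : ∀ᶠ y' in 𝓝 y, IsUnit (S y') := by
      refine hSd.continuousAt.eventually ?_
      rw [hSy]
      exact Units.isOpen.mem_nhds isUnit_one
    filter_upwards [hmem, hunit] with y' h1 h2
    obtain ⟨x, hx⟩ := (Submodule.mem_span_range_iff_exists_fun ℝ).1 h1
    rw [← hTapp] at hx
    have h3 : N (γ y') = S y' x := by rw [← hx]; rfl
    have h4 : e y' = x := by
      simp only [e, h3]
      rw [← mul_apply_eq_comp, Ring.inverse_mul_cancel _ h2]
      rfl
    rw [h4, hx]
  have hd := hTd.hasFDerivAt.clm_apply hed.hasFDerivAt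
  rw [hev.fderiv_eq, hd.fderiv]
  simp only [he0, add_apply, ContinuousLinearMap.coe_comp, Function.comp_apply]
  rw [hTapp]
  simp
  exact Submodule.sum_mem _ fun j _ => Submodule.smul_mem _ _ (Submodule.subset_span ⟨j, rfl⟩)

/-- The fibre coordinates change by x ↦ xg, and the k fibre vectors contribute the determinant. The
horizontal vectors change by vectors in the span of the fibre vectors, which do not affect the
value. -/
lemma frameExp_change [FiniteDimensional ℝ V] {c c' : Fin k → V → (V →L[ℝ] ℝ)} {y : V}
    (hc : ∀ j, DifferentiableAt ℝ (c j) y) (hc' : ∀ j, DifferentiableAt ℝ (c' j) y)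
    (hli : LinearIndependent ℝ fun j => c j y)
    (hmem : ∀ᶠ y' in 𝓝 y, ∀ j, c' j y' ∈ Submodule.span ℝ (Set.range fun j => c j y'))
    {g : Matrix (Fin k) (Fin k) ℝ} (hg : ∀ j, c' j y = ∑ i, g j i • c i y) (t : ℝ) (p : ℕ)
    (u : Fin p → V) (x : Fin k → ℝ) :
    frameExp c' t y p u x = (g.det : ℂ) * frameExp c t y p u (Matrix.vecMul x g) := by
  obtain ⟨A, hA⟩ := isAlt_expTwo_canTwo (V := V) (Complex.I * t) (p + k)
  -- The matrix `g` is frozen at y. The variation of the transition matrix contributes only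
  -- combinations of the covectors `c i y`.
  have hd : ∀ j v, fderiv ℝ (c' j) y v - ∑ i, g j i • fderiv ℝ (c i) y v ∈
      Submodule.span ℝ (Set.range fun j => c j y) := fun j v => by
    have hsum : DifferentiableAt ℝ (fun y' => ∑ i, g j i • c i y') y :=
      DifferentiableAt.fun_sum fun i _ => (hc i).fun_const_smul _
    have h := fderiv_mem_span_of_eventually (γ := fun y' => c' j y' - ∑ i, g j i • c i y') hc hli
      ((hc' j).sub hsum) (by simp [hg j]) (hmem.mono fun y' hy' => Submodule.sub_mem _ (hy' j)
        (Submodule.sum_mem _ fun i _ => Submodule.smul_mem _ _ (Submodule.subset_span ⟨i, rfl⟩))) v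
    rw [fderiv_fun_sub (hc' j) hsum, fderiv_fun_sum fun i _ => (hc i).fun_const_smul _] at h
    simpa [sum_apply, fderiv_fun_const_smul (hc _)] using h
  have hs : ∀ s ∈ Submodule.span ℝ (Set.range fun j => c j y), ((0, s) : V × (V →L[ℝ] ℝ)) ∈
      Submodule.span ℝ (Set.range fun j => ((0, c j y) : V × (V →L[ℝ] ℝ))) := fun s hs => by
    have := Submodule.mem_map_of_mem (f := LinearMap.inr ℝ V (V →L[ℝ] ℝ)) hs
    rw [Submodule.map_span, ← Set.range_comp] at this
    exact this
  simp only [frameExp, hA]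
  have h1 : (fun j => ((0, c' j y) : V × (V →L[ℝ] ℝ))) = fun j => ∑ i, g j i • (0, c i y) := by
    funext j
    rw [hg j]
    simp [Prod.ext_iff, Prod.fst_sum, Prod.snd_sum]
  rw [h1, append_sum_smul]
  congr 1
  rw [← append_add_of_mem_span A (fun i => (u i, ∑ j, Matrix.vecMul x g j • fderiv ℝ (c j) y (u i)))
    (fun i => (0, ∑ j, x j • (fderiv ℝ (c' j) y (u i) - ∑ l, g j l • fderiv ℝ (c l) y (u i))))
    _ fun i => hs _ (Submodule.sum_mem _ fun j _ => Submodule.smul_mem _ _ (hd j _))]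
  congr 2
  funext i
  simp only [Pi.add_apply, Prod.mk_add_mk, add_zero, Prod.mk.injEq, true_and]
  simp only [smul_sub, Finset.sum_sub_distrib, Matrix.vecMul, dotProduct, Finset.sum_smul,
    Finset.smul_sum, smul_smul]
  rw [Finset.sum_comm (f := fun j l => (x j * g j l) • fderiv ℝ (c l) y (u i))]
  abel

/-- The Jacobian of the substitution is |det g|. Positivity of the determinant, that is,
compatibility of the frames with the orientation, removes the absolute value. -/
lemma integral_vecMul {g : Matrix (Fin k) (Fin k) ℝ} (hg : 0 < g.det) (F : (Fin k → ℝ) → ℂ) :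
    ∫ x, (g.det : ℂ) * F (Matrix.vecMul x g) = ∫ x, F x := by
  have hdet : g.transpose.det ≠ 0 := by
    rw [Matrix.det_transpose]
    exact hg.ne'
  have hdet' : LinearMap.det (Matrix.toLin' g.transpose) ≠ 0 := by rwa [LinearMap.det_toLin']
  let e := (LinearMap.equivOfDetNeZero _ hdet').toContinuousLinearEquiv.toHomeomorph
  have he : ∀ x, e x = Matrix.vecMul x g := fun x => by
    change Matrix.toLin' g.transpose x = _
    rw [Matrix.toLin'_apply, Matrix.mulVec_transpose]
  have h1 := e.measurableEmbedding.integral_map (μ := volume) F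
  have h2 : Measure.map e volume = ENNReal.ofReal |g.transpose.det⁻¹| • volume :=
    Real.map_matrix_volume_pi_eq_smul_volume_pi hdet
  rw [h2, integral_smul_measure, Matrix.det_transpose, ENNReal.toReal_ofReal (abs_nonneg _),
    abs_of_pos (inv_pos.2 hg)] at h1
  rw [integral_const_mul]
  simp only [he] at h1
  rw [← h1, Complex.real_smul, ← mul_assoc]
  have : (g.det : ℂ) ≠ 0 := by exact_mod_cast hg.ne'
  push_cast
  rw [mul_inv_cancel₀ this, one_mul]

end FrameChange

/-! ### Independence of the fibre integral from the oriented frame -/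

section FrameIndependence

variable {V : Type*} [NormedAddCommGroup V] [NormedSpace ℝ V]
  {M : Type*} [TopologicalSpace M] [ChartedSpace V M] [IsManifold 𝓘(ℝ, V) ∞ M]
  {k : ℕ} {D : CoorientedDistribution V M k} {α β : Fin k → ∀ m : M, CoFibre (V := V) M m}
  {U U' : Set M}

lemma exists_matrix_of_orientation_eq {E' : Type*} [AddCommGroup E'] [Module ℝ E']
    (S : Submodule ℝ E') (a b : Module.Basis (Fin k) ℝ S) (h : a.orientation = b.orientation) :
    ∃ g : Matrix (Fin k) (Fin k) ℝ, 0 < g.det ∧ ∀ j, (b j : E') = ∑ i, g j i • (a i : E') := by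
  refine ⟨(a.toMatrix b).transpose, ?_, fun j => ?_⟩
  · rw [Matrix.det_transpose, ← Module.Basis.det_apply]
    exact (Module.Basis.orientation_eq_iff_det_pos a b).1 h
  · have h1 := congrArg S.subtype (a.sum_toMatrix_smul_self b j)
    rw [map_sum] at h1
    exact h1.symm

lemma exists_matrix_of_isOrientedFrame (hα : IsOrientedFrame D.E D.o U α)
    (hβ : IsOrientedFrame D.E D.o U' β) {m : M} (hm : m ∈ U) (hm' : m ∈ U') :
    ∃ g : Matrix (Fin k) (Fin k) ℝ, 0 < g.det ∧
      ∀ j, β j m = ∑ i, g j i • α i m := by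
  obtain ⟨a, ha, hao⟩ := hα.oriented m hm
  obtain ⟨b, hb, hbo⟩ := hβ.oriented m hm'
  obtain ⟨g, hg, h⟩ := exists_matrix_of_orientation_eq _ a b (hao.trans hbo.symm)
  refine ⟨g, hg, fun j => ?_⟩
  have h1 := h j
  rw [hb] at h1
  simp only [ha] at h1
  exact h1

omit [IsManifold 𝓘(ℝ, V) ∞ M] [TopologicalSpace M] [ChartedSpace V M] in
lemma sum_smul_clm_apply (g : Fin k → ℝ) (c : Fin k → V →L[ℝ] ℝ) (v : V) :
    (∑ i, g i • c i) v = ∑ i, g i * c i v := by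
  simp [sum_apply]

lemma linearIndependent_frameComp (hα : IsOrientedFrame D.E D.o U α) {x₀ : M} {y : V}
    (hy : y ∈ (extChartAt 𝓘(ℝ, V) x₀).target) (hyU : (extChartAt 𝓘(ℝ, V) x₀).symm y ∈ U) :
    LinearIndependent ℝ fun j => frameComp α x₀ j y := by
  have hs : (extChartAt 𝓘(ℝ, V) x₀).symm y ∈ (chartAt V x₀).source := by
    simpa using (extChartAt 𝓘(ℝ, V) x₀).map_target hy
  obtain ⟨b, hb, -⟩ := hα.oriented _ hyU
  have hli := linearIndependent_coe _ b.linearIndependent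
  rw [Fintype.linearIndependent_iff] at hli ⊢
  intro g hg
  refine hli g (ContinuousLinearMap.ext fun v => ?_)
  have h1 := DFunLike.congr_fun hg ((mfderiv 𝓘(ℝ, V) 𝓘(ℝ, V) (extChartAt 𝓘(ℝ, V) x₀)
    ((extChartAt 𝓘(ℝ, V) x₀).symm y) : V →L[ℝ] V) v)
  refine (sum_smul_clm_apply (V := V) _ _ _).trans
    (Eq.trans (Finset.sum_congr rfl fun j _ => ?_) ((sum_smul_clm_apply (V := V) _ _ _).symm.trans h1))
  refine congrArg (fun r : ℝ => g j * r) ?_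
  rw [hb]
  exact (coComp_mfderiv_chart hs (α j ((extChartAt 𝓘(ℝ, V) x₀).symm y)) v).symm

omit [IsManifold 𝓘(ℝ, V) ∞ M] in
lemma exists_chart_symm_eq (m : M) :
    ∃ (x₀ : M) (y : V), y ∈ (extChartAt 𝓘(ℝ, V) x₀).target ∧ (extChartAt 𝓘(ℝ, V) x₀).symm y = m :=
  ⟨m, extChartAt 𝓘(ℝ, V) m m, mem_extChartAt_target m, (extChartAt 𝓘(ℝ, V) m).left_inv
    (mem_extChartAt_source m)⟩

lemma exists_mfderiv_chart_symm_eq {x₀ : M} {y : V} (hy : y ∈ (extChartAt 𝓘(ℝ, V) x₀).target)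
    {p : ℕ} (v : Fin p → V) : ∃ u : Fin p → V,
      (fun i => (mfderiv 𝓘(ℝ, V) 𝓘(ℝ, V) (extChartAt 𝓘(ℝ, V) x₀).symm y : V →L[ℝ] V) (u i)) = v := by
  have hs : (extChartAt 𝓘(ℝ, V) x₀).symm y ∈ (chartAt V x₀).source := by
    simpa using (extChartAt 𝓘(ℝ, V) x₀).map_target hy
  have h := mfderiv_chart_symm_mfderiv_chart hs
  rw [(extChartAt 𝓘(ℝ, V) x₀).right_inv hy] at h
  exact ⟨_, funext fun i => h (v i)⟩

variable {W : Type*} [NormedAddCommGroup W] [NormedSpace ℝ W]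
  {H : Type*} [Group H] [TopologicalSpace H] [ChartedSpace W H] [LieGroup 𝓘(ℝ, W) ∞ H]
  [MulAction H M] [ContMDiffSMul 𝓘(ℝ, W) 𝓘(ℝ, V) ∞ H M]

omit [IsManifold 𝓘(ℝ, V) ∞ M] [LieGroup 𝓘(ℝ, W) ∞ H] [ContMDiffSMul 𝓘(ℝ, W) 𝓘(ℝ, V) ∞ H M] in
lemma frameMoment_sum (g : Fin k → ℝ) (α : Fin k → ∀ m : M, CoFibre (V := V) M m)
    (m : M) (j : Fin k) (h : β j m = ∑ i, g i • α i m) :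
    frameMoment (W := W) H β m j = ∑ i, g i • frameMoment H α m i := by
  have h1 : ∀ (c : Fin k → V →L[ℝ] ℝ) (F : W →L[ℝ] V),
      -((∑ j, g j • c j).comp F) = ∑ j, g j • (-((c j).comp F)) := fun c F => by
    ext X
    simp [sum_apply]
  rw [frameMoment, h]
  exact h1 (fun j => α j m) _

variable [FiniteDimensional ℝ V] [MeasurableSpace W] (μ : Measure W)

/-- The fibre integrals do not depend on the oriented frame. -/
lemma integral_fibreIntegrand_congr (hα : IsOrientedFrame D.E D.o U α)
    (hβ : IsOrientedFrame D.E D.o U' β) {m : M} (hm : m ∈ U) (hm' : m ∈ U')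
    (φ : 𝓓((⊤ : TopologicalSpace.Opens W), ℂ)) (p : ℕ) (v : Fin p → TangentSpace 𝓘(ℝ, V) m) :
    ∫ x, fibreIntegrand β (expTheta H μ φ) m p v x =
      ∫ x, fibreIntegrand α (expTheta H μ φ) m p v x := by
  obtain ⟨x₀, y, hy, rfl⟩ := exists_chart_symm_eq (V := V) m
  obtain ⟨u, rfl⟩ := exists_mfderiv_chart_symm_eq hy v
  obtain ⟨g, hg, hgs⟩ := exists_matrix_of_isOrientedFrame hα hβ hm hm'
  have hdα : ∀ j, DifferentiableAt ℝ (frameComp α x₀ j) y := fun j =>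
    (contDiffAt_frameComp hy ((hα.smooth j).contMDiffAt (hα.isOpen.mem_nhds hm))).differentiableAt
      (by simp)
  have hdβ : ∀ j, DifferentiableAt ℝ (frameComp β x₀ j) y := fun j =>
    (contDiffAt_frameComp hy ((hβ.smooth j).contMDiffAt (hβ.isOpen.mem_nhds hm'))).differentiableAt
      (by simp)
  have hcomb : ∀ (y' : V) (j : Fin k) (g : Fin k → ℝ),
      β j ((extChartAt 𝓘(ℝ, V) x₀).symm y') = ∑ i, g i • α i ((extChartAt 𝓘(ℝ, V) x₀).symm y') →
      frameComp β x₀ j y' = ∑ i, g i • frameComp α x₀ i y' := fun y' j g h => by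
    rw [frameComp, h]
    exact coComp_sum_smul x₀ _ g fun i => α i _
  -- The two frames span the same space at nearby points too, which is what controls the derivatives
  -- of β at y.
  have hmem : ∀ᶠ y' in 𝓝 y, ∀ j, frameComp β x₀ j y' ∈
      Submodule.span ℝ (Set.range fun j => frameComp α x₀ j y') := by
    have hc := (contMDiffAt_chart_symm (M := M) hy).continuousAt
    filter_upwards [hc.preimage_mem_nhds (hα.isOpen.mem_nhds hm),
      hc.preimage_mem_nhds (hβ.isOpen.mem_nhds hm')] with y' h1 h2 j
    obtain ⟨g', -, hg'⟩ := exists_matrix_of_isOrientedFrame hα hβ h1 h2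
    rw [hcomb y' j (g' j) (hg' j)]
    exact Submodule.sum_mem _ fun i _ => Submodule.smul_mem _ _ (Submodule.subset_span ⟨i, rfl⟩)
  have hli := linearIndependent_frameComp hα hy hm
  refine Eq.trans (integral_congr_ae (Filter.Eventually.of_forall fun x => ?_)) (integral_vecMul hg _)
  have h1 := fibreIntegrand_pairing (H := H) μ hβ.isOpen hβ.smooth hy hm' x 1 φ p u
  have h2 := fibreIntegrand_pairing (H := H) μ hα.isOpen hα.smooth hy hm (Matrix.vecMul x g) 1 φ p u
  refine h1.trans (Eq.trans ?_ (congrArg (fun z : ℂ => (g.det : ℂ) * z) h2.symm))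
  rw [frameExp_change hdα hdβ hli hmem (fun j => hcomb y j (g j) (hgs j)) 1 p u x, mul_left_comm]
  congr 3
  simp only [frameMoment_sum (H := H) (W := W) (g _) α _ _ (hgs _), Finset.smul_sum, smul_smul,
    Matrix.vecMul, dotProduct, Finset.sum_smul]
  rw [Finset.sum_comm]

end FrameIndependence

/-! ### Local smoothness of the fibre integrals -/

section Local

variable {V : Type*} [NormedAddCommGroup V] [NormedSpace ℝ V] [FiniteDimensional ℝ V]
  {M : Type*} [TopologicalSpace M] [ChartedSpace V M] [IsManifold 𝓘(ℝ, V) ∞ M]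
  {k : ℕ} {D : CoorientedDistribution V M k}
  {W : Type*} [NormedAddCommGroup W] [NormedSpace ℝ W] [FiniteDimensional ℝ W]
  {H : Type*} [Group H] [TopologicalSpace H] [ChartedSpace W H] [LieGroup 𝓘(ℝ, W) ∞ H]
  [MulAction H M] [ContMDiffSMul 𝓘(ℝ, W) 𝓘(ℝ, V) ∞ H M]
  [MeasurableSpace W] [BorelSpace W] (μ : Measure W) [μ.IsAddHaarMeasure]

omit [FiniteDimensional ℝ V] in
lemma CoorientedDistribution.exists_isOrientedFrame_frameAt (D : CoorientedDistribution V M k)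
    (m : M) : ∃ U, m ∈ U ∧ IsOrientedFrame D.E D.o U (D.frameAt m) :=
  ⟨_, (D.exists_frame m).choose_spec.choose_spec⟩

/-- Near each point the coefficients of `q_* ı^* e^{iDθ}` are oscillatory integrals, which depend
smoothly on the point. -/
theorem exists_fibreIntegral_smooth (hT : Transverse (W := W) D H) {x₀ : M} {y₁ : V}
    (hy₁ : y₁ ∈ (extChartAt 𝓘(ℝ, V) x₀).target) (p : ℕ) (u : Fin p → V) :
    ∃ O : Set V, IsOpen O ∧ y₁ ∈ O ∧
      (∀ φ : 𝓓((⊤ : TopologicalSpace.Opens W), ℂ),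
        ContDiffOn ℝ ∞ (fun y => inChart 𝓘(ℝ, V) (D.fibreIntegral (expTheta H μ φ)) x₀ y p u) O ∧
        Integrable (fibreIntegrand (D.frameAt ((extChartAt 𝓘(ℝ, V) x₀).symm y₁)) (expTheta H μ φ)
          ((extChartAt 𝓘(ℝ, V) x₀).symm y₁) p
          (fun i => mfderiv 𝓘(ℝ, V) 𝓘(ℝ, V) (extChartAt 𝓘(ℝ, V) x₀).symm y₁ (u i)))) ∧
      ∀ (K : Set W), IsCompact K → ∀ n : ℕ, ∃ (m : ℕ) (C : ℝ), 0 ≤ C ∧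
        ∀ φ : 𝓓((⊤ : TopologicalSpace.Opens W), ℂ), tsupport φ ⊆ K →
        ∀ b : ℝ, (∀ j ≤ m, ∀ X, ‖iteratedFDeriv ℝ j φ X‖ ≤ b) → ∀ y ∈ O,
        ‖iteratedFDeriv ℝ n
          (fun y => inChart 𝓘(ℝ, V) (D.fibreIntegral (expTheta H μ φ)) x₀ y p u) y‖ ≤ C * b := by
  obtain ⟨U, hU, hα⟩ := D.exists_isOrientedFrame_frameAt ((extChartAt 𝓘(ℝ, V) x₀).symm y₁)
  set α := D.frameAt ((extChartAt 𝓘(ℝ, V) x₀).symm y₁)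
  let Ω : Set V := (extChartAt 𝓘(ℝ, V) x₀).target ∩ (extChartAt 𝓘(ℝ, V) x₀).symm ⁻¹' U
  have hΩ : IsOpen Ω := (continuousOn_extChartAt_symm x₀).isOpen_inter_preimage
    (isOpen_extChartAt_target x₀) hα.isOpen
  have hsm : ∀ j, ∀ y ∈ Ω, ContMDiffAt 𝓘(ℝ, V) (ModelT V) ∞
      (fun m => (⟨m, α j m⟩ : Cotangent (V := V) M)) ((extChartAt 𝓘(ℝ, V) x₀).symm y) :=
    fun j y hy => (hα.smooth j).contMDiffAt (hα.isOpen.mem_nhds hy.2)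
  have hc : ∀ j, ContDiffOn ℝ ∞ (frameComp α x₀ j) Ω := fun j y hy =>
    (contDiffAt_frameComp hy.1 (hsm j y hy)).contDiffWithinAt
  let a : Fin k → V → W →L[ℝ] ℝ := fun j y => frameMoment H α ((extChartAt 𝓘(ℝ, V) x₀).symm y) j
  have ha : ∀ j, ContDiffOn ℝ ∞ (a j) Ω := fun j y hy =>
    (contDiffAt_frameMoment hy.1 (hsm j y hy)).contDiffWithinAt
  let P : V × (Fin k → ℝ) → ℂ := fun z => frameExp (frameComp α x₀) 1 z.1 p u z.2
  have hint : ∀ φ : 𝓓((⊤ : TopologicalSpace.Opens W), ℂ), ∀ y ∈ Ω, ∀ x,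
      fibreIntegrand α (expTheta H μ φ) ((extChartAt 𝓘(ℝ, V) x₀).symm y) p
        (fun i => mfderiv 𝓘(ℝ, V) 𝓘(ℝ, V) (extChartAt 𝓘(ℝ, V) x₀).symm y (u i)) x =
      oscIntegrand μ a P φ (y, x) := fun φ y hy x => by
    have h1 := fibreIntegrand_pairing (H := H) μ hα.isOpen hα.smooth hy.1 hy.2 x 1 φ p u
    rw [one_smul] at h1
    exact h1
  -- The definition of the fibre integral chooses a frame separately at each point. By independence
  -- of the frame, the single smooth frame α may be used on all of Ω.
  have hfi : ∀ φ : 𝓓((⊤ : TopologicalSpace.Opens W), ℂ), ∀ y ∈ Ω,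
      inChart 𝓘(ℝ, V) (D.fibreIntegral (expTheta H μ φ)) x₀ y p u =
        ∫ x, oscIntegrand μ a P φ (y, x) := fun φ y hy => by
    obtain ⟨U', hU', hβ⟩ := D.exists_isOrientedFrame_frameAt ((extChartAt 𝓘(ℝ, V) x₀).symm y)
    have h1 := integral_fibreIntegrand_congr (H := H) μ hα hβ hy.2 hU' φ p
      (fun i => mfderiv 𝓘(ℝ, V) 𝓘(ℝ, V) (extChartAt 𝓘(ℝ, V) x₀).symm y (u i))
    simp only [hint φ y hy] at h1
    exact h1
  obtain ⟨O, hO, hyO, hOΩ, h1, h2⟩ := exists_oscIntegral_smooth μ hΩ ha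
    (fun y hy => linearIndependent_frameMoment hT hα hy.2)
    (fun L hL hLc => isModerate_frameExp hΩ hL hLc hc 1 p u) (y₁ := y₁) ⟨hy₁, hU⟩
  refine ⟨O, hO, hyO, fun φ => ⟨?_, ?_⟩, fun K hK n => ?_⟩
  · exact (h1 φ φ.contDiff φ.hasCompactSupport).1.congr fun y hy => hfi φ y (hOΩ hy)
  · exact ((h1 φ φ.contDiff φ.hasCompactSupport).2 y₁ hyO).congr
      (Filter.Eventually.of_forall fun x => (hint φ y₁ ⟨hy₁, hU⟩ x).symm)
  · obtain ⟨m, C, hC, h⟩ := h2 K hK n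
    refine ⟨m, C, hC, fun φ hφ b hb y hy => ?_⟩
    have he : (fun y => inChart 𝓘(ℝ, V) (D.fibreIntegral (expTheta H μ φ)) x₀ y p u) =ᶠ[𝓝 y]
        fun y => ∫ x, oscIntegrand μ a P φ (y, x) := by
      filter_upwards [hO.mem_nhds hy] with y' hy' using hfi φ y' (hOΩ hy')
    rw [Filter.EventuallyEq.eq_of_nhds (Filter.EventuallyEq.iteratedFDeriv ℝ he n)]
    exact h φ φ.contDiff hφ b hb y hy

end Local

/-! ### Alternating maps: fixed arguments and integrals -/

section AlternatingIntegral

variable {T : Type*} [AddCommGroup T] [Module ℝ T]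

/-- The alternating map obtained by fixing the last arguments. -/
lemma exists_alternatingMap_append {p k : ℕ} (A : T [⋀^Fin (p + k)]→ₗ[ℝ] ℂ) (b : Fin k → T) :
    ∃ A' : T [⋀^Fin p]→ₗ[ℝ] ℂ, ∀ v, A (Fin.append v b) = A' v := by
  let ev : MultilinearMap ℝ (fun _ : Fin k => T) ℂ →ₗ[ℝ] ℂ :=
    { toFun := fun f => f b
      map_add' := fun _ _ => rfl
      map_smul' := fun _ _ => rfl }
  refine ⟨{ ev.compMultilinearMap (splitAlt A) with map_eq_zero_of_eq' := ?_ }, fun v =>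
    (splitAlt_apply A v b).symm⟩
  intro v i j hv hij
  refine (splitAlt_apply A v b).trans (A.map_eq_zero_of_eq _ (i := Fin.castAdd k i)
    (j := Fin.castAdd k j) ?_ fun h => hij (Fin.castAdd_injective _ _ h))
  rw [Fin.append_left, Fin.append_left, hv]

/-- Integrals of families of alternating maps are alternating. -/
lemma exists_alternatingMap_integral {S : Type*} [MeasurableSpace S] (ν : Measure S) {p : ℕ}
    {F : (Fin p → T) → S → ℂ} (hF : ∀ s, ∃ A : T [⋀^Fin p]→ₗ[ℝ] ℂ, ∀ v, F v s = A v)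
    (h : ∀ v, Integrable (F v) ν) : ∃ B : T [⋀^Fin p]→ₗ[ℝ] ℂ, ∀ v, ∫ s, F v s ∂ν = B v := by
  choose A hA using hF
  refine ⟨{ toFun := fun v => ∫ s, F v s ∂ν
            map_update_add' := ?_
            map_update_smul' := ?_
            map_eq_zero_of_eq' := ?_ }, fun v => rfl⟩
  · intro _ v i x y
    rw [← integral_add (h _) (h _)]
    simp only [hA, AlternatingMap.map_update_add]
  · intro _ v i c x
    rw [← integral_smul]
    simp only [hA, AlternatingMap.map_update_smul]
  · intro v i j hv hij
    simp only [hA, (A _).map_eq_zero_of_eq v hv hij, integral_zero]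

end AlternatingIntegral

/-! ### The fibre integral of `e^{iDθ}` as a continuous map into smooth forms -/

section Smooth

variable {V : Type*} [NormedAddCommGroup V] [NormedSpace ℝ V] [FiniteDimensional ℝ V]
  {M : Type*} [TopologicalSpace M] [ChartedSpace V M] [IsManifold 𝓘(ℝ, V) ∞ M]
  {k : ℕ} {D : CoorientedDistribution V M k}
  {W : Type*} [NormedAddCommGroup W] [NormedSpace ℝ W] [FiniteDimensional ℝ W]
  {H : Type*} [Group H] [TopologicalSpace H] [ChartedSpace W H] [LieGroup 𝓘(ℝ, W) ∞ H]
  [MulAction H M] [ContMDiffSMul 𝓘(ℝ, W) 𝓘(ℝ, V) ∞ H M]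
  [MeasurableSpace W] [BorelSpace W] (μ : Measure W) [μ.IsAddHaarMeasure]

-- The integrand is a scalar times the pullback of an alternating map under a linear map, with the
-- last k arguments fixed.
omit [FiniteDimensional ℝ V] [FiniteDimensional ℝ W] [BorelSpace W] [μ.IsAddHaarMeasure]
  [LieGroup 𝓘(ℝ, W) ∞ H] [ContMDiffSMul 𝓘(ℝ, W) 𝓘(ℝ, V) ∞ H M] in
lemma exists_alternatingMap_fibreIntegrand (α : Fin k → ∀ m : M, CoFibre (V := V) M m)
    (φ : 𝓓((⊤ : TopologicalSpace.Opens W), ℂ)) (m : M) (p : ℕ) (x : Fin k → ℝ) :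
    ∃ A : (TangentSpace 𝓘(ℝ, V) m) [⋀^Fin p]→ₗ[ℝ] ℂ,
      ∀ v, fibreIntegrand α (expTheta H μ φ) m p v x = A v := by
  obtain ⟨A, hA⟩ := isAlt_expTwo_canTwo (V := V) (Complex.I * ((1 : ℝ) : ℂ)) (p + k)
  let L : V × (Fin k → ℝ) →L[ℝ] V × (V →L[ℝ] ℝ) :=
    mfderiv ((𝓘(ℝ, V)).prod 𝓘(ℝ, Fin k → ℝ)) (ModelT V) (frameMap α) (m, x)
  obtain ⟨A', hA'⟩ := exists_alternatingMap_append (A.compLinearMap L.toLinearMap)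
    (fun j => ((0, Pi.single j 1) : V × (Fin k → ℝ)))
  let B : V [⋀^Fin p]→ₗ[ℝ] ℂ :=
    fhat μ φ ((1 : ℝ) • momentMap (W := W) (H := H) (ModelT V) cotangentLift canonicalForm
      (frameMap α (m, x))) • A'.compLinearMap (LinearMap.inl ℝ V (Fin k → ℝ))
  refine ⟨B, fun v => (pairing_expD (H := H) μ 1 φ (frameMap α (m, x)) (p + k) _).trans
    (congrArg (fun z : ℂ => _ * z) ((hA _).trans ?_))⟩
  exact hA' fun i => (v i, 0)

omit [FiniteDimensional ℝ V] [FiniteDimensional ℝ W] [LieGroup 𝓘(ℝ, W) ∞ H]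
  [ContMDiffSMul 𝓘(ℝ, W) 𝓘(ℝ, V) ∞ H M] in
lemma expTheta_add (φ ψ : 𝓓((⊤ : TopologicalSpace.Opens W), ℂ)) :
    expTheta (V := V) (M := M) H μ (φ + ψ) = expTheta H μ φ + expTheta H μ ψ := by
  have hint : ∀ (φ : 𝓓((⊤ : TopologicalSpace.Opens W), ℂ)) (a : W →L[ℝ] ℝ),
      Integrable (fun X => φ X * Complex.exp (Complex.I * (a X : ℂ))) μ := fun φ a =>
    (φ.continuous.mul (by fun_prop)).integrable_of_hasCompactSupport φ.hasCompactSupport.mul_right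
  have h : ∀ a, fhat μ (φ + ψ : 𝓓((⊤ : TopologicalSpace.Opens W), ℂ)) a =
      fhat μ φ a + fhat μ ψ a := fun a => by
    rw [fhat, fhat, fhat, ← integral_add (hint φ a) (hint ψ a)]
    simp [add_mul]
  funext ξ p v
  simp only [expTheta, Pi.add_apply, pairing_expD, h, add_mul]

omit [FiniteDimensional ℝ V] [FiniteDimensional ℝ W] [BorelSpace W] [μ.IsAddHaarMeasure]
  [LieGroup 𝓘(ℝ, W) ∞ H] [ContMDiffSMul 𝓘(ℝ, W) 𝓘(ℝ, V) ∞ H M] in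
lemma expTheta_smul (c : ℂ) (φ : 𝓓((⊤ : TopologicalSpace.Opens W), ℂ)) :
    expTheta (V := V) (M := M) H μ (c • φ) = c • expTheta H μ φ := by
  have h : ∀ a, fhat μ (c • φ : 𝓓((⊤ : TopologicalSpace.Opens W), ℂ)) a = c * fhat μ φ a :=
    fun a => by
      rw [fhat, fhat, ← integral_const_mul]
      simp [mul_assoc]
  funext ξ p v
  simp only [expTheta, Pi.smul_apply, pairing_expD, h, smul_eq_mul, mul_assoc]

lemma integrable_fibreIntegrand_expTheta (hT : Transverse (W := W) D H)
    (φ : 𝓓((⊤ : TopologicalSpace.Opens W), ℂ)) (m : M) (p : ℕ)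
    (v : Fin p → TangentSpace 𝓘(ℝ, V) m) :
    Integrable (fibreIntegrand (D.frameAt m) (expTheta H μ φ) m p v) := by
  obtain ⟨x₀, y, hy, rfl⟩ := exists_chart_symm_eq (V := V) m
  obtain ⟨u, rfl⟩ := exists_mfderiv_chart_symm_eq hy v
  obtain ⟨O, hO, hyO, h, -⟩ := exists_fibreIntegral_smooth μ hT hy p u
  exact (h φ).2

lemma isSmoothForm_fibreIntegral_expTheta (hT : Transverse (W := W) D H)
    (φ : 𝓓((⊤ : TopologicalSpace.Opens W), ℂ)) :
    IsSmoothForm 𝓘(ℝ, V) (D.fibreIntegral (expTheta H μ φ)) := by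
  refine ⟨fun m p => exists_alternatingMap_integral volume
    (fun x => exists_alternatingMap_fibreIntegrand μ _ φ m p x)
    (integrable_fibreIntegrand_expTheta μ hT φ m p), fun x₀ p u y hy => ?_⟩
  obtain ⟨O, hO, hyO, h, -⟩ := exists_fibreIntegral_smooth μ hT hy p u
  exact ((h φ).1.contDiffAt (hO.mem_nhds hyO)).contDiffWithinAt

/-- The local bounds around points of `L` are patched by compactness, taking the maximum of the
orders and of the constants for a union. -/
lemma exists_seminorm_fibreIntegral_expTheta (hT : Transverse (W := W) D H) {K : Set W}
    (hK : IsCompact K) (x₀ : M) {L : Set V} (hL : IsCompact L)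
    (hLt : L ⊆ (extChartAt 𝓘(ℝ, V) x₀).target) (p : ℕ) (u : Fin p → V) (n : ℕ) :
    ∃ (m : ℕ) (C : ℝ), ∀ φ : 𝓓((⊤ : TopologicalSpace.Opens W), ℂ), tsupport φ ⊆ K →
      ∀ b : ℝ, (∀ j ≤ m, ∀ X, ‖iteratedFDeriv ℝ j φ X‖ ≤ b) → ∀ y ∈ L,
      ‖iteratedFDeriv ℝ n
        (fun z => inChart 𝓘(ℝ, V) (D.fibreIntegral (expTheta H μ φ)) x₀ z p u) y‖ ≤ C * b := by
  refine hL.induction_on (p := fun L => ∃ (m : ℕ) (C : ℝ),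
      ∀ φ : 𝓓((⊤ : TopologicalSpace.Opens W), ℂ), tsupport φ ⊆ K →
      ∀ b : ℝ, (∀ j ≤ m, ∀ X, ‖iteratedFDeriv ℝ j φ X‖ ≤ b) → ∀ y ∈ L,
      ‖iteratedFDeriv ℝ n
        (fun z => inChart 𝓘(ℝ, V) (D.fibreIntegral (expTheta H μ φ)) x₀ z p u) y‖ ≤ C * b)
    ⟨0, 0, by simp⟩ ?_ ?_ ?_
  · rintro s t hst ⟨m, C, h⟩
    exact ⟨m, C, fun φ hφ b hb y hy => h φ hφ b hb y (hst hy)⟩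
  · rintro s t ⟨m, C, h⟩ ⟨m', C', h'⟩
    refine ⟨max m m', max C C', fun φ hφ b hb y hy => ?_⟩
    have hb0 : 0 ≤ b := (norm_nonneg _).trans (hb 0 (Nat.zero_le _) 0)
    rcases hy with hy | hy
    · exact (h φ hφ b (fun j hj => hb j (hj.trans (le_max_left _ _))) y hy).trans
        (mul_le_mul_of_nonneg_right (le_max_left _ _) hb0)
    · exact (h' φ hφ b (fun j hj => hb j (hj.trans (le_max_right _ _))) y hy).trans
        (mul_le_mul_of_nonneg_right (le_max_right _ _) hb0)
  · intro y hy
    obtain ⟨O, hO, hyO, -, h⟩ := exists_fibreIntegral_smooth μ hT (hLt hy) p u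
    obtain ⟨m, C, -, h⟩ := h K hK n
    exact ⟨O, mem_nhdsWithin_of_mem_nhds (hO.mem_nhds hyO), m, C, h⟩

end Smooth

/-! ### Linear substitutions in the transform -/

section ChangeOfVariables

variable {W : Type*} [NormedAddCommGroup W] [NormedSpace ℝ W] [FiniteDimensional ℝ W]
  [MeasurableSpace W] [BorelSpace W] (μ : Measure W) [μ.IsAddHaarMeasure]

lemma fhat_comp {A : W →L[ℝ] W} (hA : A.det ≠ 0) {φ ψ : W → ℂ} (h : ∀ X, ψ (A X) = φ X)
    {a b : W →L[ℝ] ℝ} (hab : ∀ X, b (A X) = a X) :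
    fhat μ ψ b = ((|A.det| : ℝ) : ℂ) * fhat μ φ a := by
  let e := (LinearMap.equivOfDetNeZero (A : W →ₗ[ℝ] W) hA).toContinuousLinearEquiv.toHomeomorph
  have he : ∀ X, e X = A X := fun X => rfl
  have h1 := e.measurableEmbedding.integral_map (μ := μ)
    fun X => ψ X * Complex.exp (Complex.I * (b X : ℂ))
  have h2 : Measure.map e μ = ENNReal.ofReal |A.det⁻¹| • μ :=
    Measure.map_linearMap_addHaar_eq_smul_addHaar μ hA
  rw [h2, integral_smul_measure, ENNReal.toReal_ofReal (abs_nonneg _)] at h1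
  simp only [he, h, hab] at h1
  rw [fhat, fhat, ← h1, Complex.real_smul, ← mul_assoc, ← Complex.ofReal_mul, ← abs_mul,
    mul_inv_cancel₀ hA]
  simp

end ChangeOfVariables

/-! ### Transport of frames and of the canonical forms by the action -/

section Transport

variable {V : Type*} [NormedAddCommGroup V] [NormedSpace ℝ V]
  {M : Type*} [TopologicalSpace M] [ChartedSpace V M] [IsManifold 𝓘(ℝ, V) ∞ M]
  {k : ℕ} {D : CoorientedDistribution V M k}
  {W : Type*} [NormedAddCommGroup W] [NormedSpace ℝ W]
  {H : Type*} [Group H] [TopologicalSpace H] [ChartedSpace W H] [LieGroup 𝓘(ℝ, W) ∞ H]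
  [MulAction H M] [ContMDiffSMul 𝓘(ℝ, W) 𝓘(ℝ, V) ∞ H M]

lemma det_Ad_ne_zero [FiniteDimensional ℝ W] (g : H) : (Ad g : W →L[ℝ] W).det ≠ 0 := by
  have h := congrArg ContinuousLinearMap.toLinearMap (Ad_comp_Ad_inv (W := W) g)
  have h1 : LinearMap.det (Ad g : W →L[ℝ] W).toLinearMap *
      LinearMap.det (Ad g⁻¹ : W →L[ℝ] W).toLinearMap = 1 := by
    rw [← LinearMap.det_comp]
    exact (congrArg LinearMap.det h).trans LinearMap.det_id
  exact left_ne_zero_of_mul_eq_one h1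

/-- The differential of the cotangent lift of the action preserves the canonical symplectic form. -/
lemma canTwo_mfderiv_cotangentLift (W : Type*) [NormedAddCommGroup W] [NormedSpace ℝ W]
    {H : Type*} [Group H] [TopologicalSpace H] [ChartedSpace W H] [LieGroup 𝓘(ℝ, W) ∞ H]
    [MulAction H M] [ContMDiffSMul 𝓘(ℝ, W) 𝓘(ℝ, V) ∞ H M] (g : H)
    {Z : Type*} [NormedAddCommGroup Z] [NormedSpace ℝ Z] {G : Z → Cotangent (V := V) M} {z : Z}
    (hG : ∀ᶠ z' in 𝓝 z, ContMDiffAt 𝓘(ℝ, Z) (ModelT V) ∞ G z') (a b : Z) :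
    canTwo (V := V) (mfderiv 𝓘(ℝ, Z) (ModelT V) (fun z => cotangentLift g (G z)) z a)
        (mfderiv 𝓘(ℝ, Z) (ModelT V) (fun z => cotangentLift g (G z)) z b) =
      canTwo (V := V) (mfderiv 𝓘(ℝ, Z) (ModelT V) G z a) (mfderiv 𝓘(ℝ, Z) (ModelT V) G z b) := by
  have hL : ∀ z', ContMDiffAt 𝓘(ℝ, Z) (ModelT V) ∞ G z' →
      ContMDiffAt 𝓘(ℝ, Z) (ModelT V) ∞ (fun z => cotangentLift g (G z)) z' := fun z' h =>
    (contMDiff_cotangentLift_right W g).contMDiffAt.comp z' h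
  refine canTwo_mfderiv_congr (hG.mono hL) hG ?_ a b
  -- The lift preserves θ: the transported covector is composed with the inverse differential, which
  -- cancels the differential of g on the projected vector. Invariance of dθ follows by
  -- `canTwo_mfderiv_congr`.
  filter_upwards [hG] with z' hz' b
  refine (canonicalForm_mfderiv ((hL z' hz').mdifferentiableAt (by simp)) b).trans
    (Eq.trans ?_ (canonicalForm_mfderiv (hz'.mdifferentiableAt (by simp)) b).symm)
  have d1 : MDifferentiableAt 𝓘(ℝ, Z) 𝓘(ℝ, V) (fun y => (G y).proj) z' :=
    ((Bundle.contMDiff_proj (CoFibre (V := V) M) (n := ∞) (IB := 𝓘(ℝ, V))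
      (F := V →L[ℝ] ℝ)).contMDiffAt.comp z' hz').mdifferentiableAt (by simp)
  have d2 := mfderiv_comp z' ((contMDiff_smul_left (M := M) (V := V) W g).mdifferentiable (by simp)
    (G z').proj) d1
  have d3 : (mfderiv 𝓘(ℝ, Z) 𝓘(ℝ, V) (fun y => (cotangentLift g (G y)).proj) z' : Z →L[ℝ] V) b =
    (mfderiv 𝓘(ℝ, V) 𝓘(ℝ, V) (fun x : M => g • x) (G z').proj : V →L[ℝ] V)
      ((mfderiv 𝓘(ℝ, Z) 𝓘(ℝ, V) (fun y => (G y).proj) z' : Z →L[ℝ] V) b) :=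
    DFunLike.congr_fun d2 b
  refine (congrArg _ d3).trans ?_
  exact congrArg ((G z').2 : V →L[ℝ] ℝ) (mfderiv_inv_smul_mfderiv_smul W g (G z').proj _)

-- In finite dimension the left inverse `mfderiv_inv_smul_mfderiv_smul` is also a right inverse.
omit [IsManifold 𝓘(ℝ, V) ∞ M] in
lemma mfderiv_smul_mfderiv_inv_smul [FiniteDimensional ℝ V]
    (W : Type*) [NormedAddCommGroup W] [NormedSpace ℝ W]
    {H : Type*} [Group H] [TopologicalSpace H] [ChartedSpace W H]
    [MulAction H M] [ContMDiffSMul 𝓘(ℝ, W) 𝓘(ℝ, V) ∞ H M]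
    (g : H) (m : M) (v : V) :
    (mfderiv 𝓘(ℝ, V) 𝓘(ℝ, V) (fun x : M => g • x) m : V →L[ℝ] V)
      ((mfderiv 𝓘(ℝ, V) 𝓘(ℝ, V) (fun x : M => g⁻¹ • x) (g • m) : V →L[ℝ] V) v) = v := by
  have h : ∀ A B : V →L[ℝ] V, (∀ v, B (A v) = v) → ∀ v, A (B v) = v := fun A B h v => by
    have h1 : B.toLinearMap ∘ₗ A.toLinearMap = LinearMap.id := LinearMap.ext h
    exact DFunLike.congr_fun ((LinearMap.comp_eq_id_comm ℝ V).1 h1) v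
  exact h _ _ (mfderiv_inv_smul_mfderiv_smul W g m) v

/-- The pull-back of a family of covector fields by the action of `g`. -/
def pullFrame (g : H) (β : Fin k → ∀ m : M, CoFibre (V := V) M m) (j : Fin k) (m : M) :
    CoFibre (V := V) M m :=
  (β j (g • m) : V →L[ℝ] ℝ).comp
    (mfderiv 𝓘(ℝ, V) 𝓘(ℝ, V) (fun x : M => g • x) m : V →L[ℝ] V)

omit [IsManifold 𝓘(ℝ, V) ∞ M] [TopologicalSpace H] in
lemma pullFrame_eq_cotangentLift (g : H) (β : Fin k → ∀ m : M, CoFibre (V := V) M m) (j : Fin k)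
    (m : M) : (⟨m, pullFrame g β j m⟩ : Cotangent (V := V) M) =
      cotangentLift g⁻¹ ⟨g • m, β j (g • m)⟩ := by
  have h : ∀ (h : H) (m' : M), h = g → m' = m →
      (⟨m, pullFrame g β j m⟩ : Cotangent (V := V) M) =
      ⟨m', (β j (g • m) : V →L[ℝ] ℝ).comp (mfderiv 𝓘(ℝ, V) 𝓘(ℝ, V) (fun x : M => h • x) m' :
        V →L[ℝ] V)⟩ := by
    rintro _ _ rfl rfl
    rfl
  exact h _ _ (inv_inv g) (inv_smul_smul g m)

-- The fibre coordinate x is the same on both sides: the action identifies the parametrization by β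
-- over g m with the one by the pulled-back frame over m.
omit [IsManifold 𝓘(ℝ, V) ∞ M] in
lemma frameMap_smul [FiniteDimensional ℝ V] (W : Type*) [NormedAddCommGroup W] [NormedSpace ℝ W]
    {H : Type*} [Group H] [TopologicalSpace H] [ChartedSpace W H]
    [MulAction H M] [ContMDiffSMul 𝓘(ℝ, W) 𝓘(ℝ, V) ∞ H M]
    (g : H) (β : Fin k → ∀ m : M, CoFibre (V := V) M m) (m : M)
    (x : Fin k → ℝ) : frameMap β (g • m, x) = cotangentLift g (frameMap (pullFrame g β) (m, x)) := by
  have h : ∀ (c : Fin k → V →L[ℝ] ℝ) (A B : V →L[ℝ] V), (∀ v, A (B v) = v) →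
      ∑ j, x j • c j = (∑ j, x j • (c j).comp A).comp B := fun c A B h => by
    ext v
    simp [sum_apply, h]
  exact congrArg (Bundle.TotalSpace.mk (g • m)) (h (fun j => β j (g • m)) _ _
    (mfderiv_smul_mfderiv_inv_smul W g m))

lemma exists_basis_of_linearIndependent {E' : Type*} [AddCommGroup E'] [Module ℝ E']
    {S : Submodule ℝ E'} (b₀ : Module.Basis (Fin k) ℝ S) {c : Fin k → E'} (hc : ∀ j, c j ∈ S)
    (hli : LinearIndependent ℝ c) : ∃ b : Module.Basis (Fin k) ℝ S, ∀ j, (b j : E') = c j := by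
  have hcard : Fintype.card (Fin k) = Module.finrank ℝ S := (Module.finrank_eq_card_basis b₀).symm
  have hli' : LinearIndependent ℝ fun j => (⟨c j, hc j⟩ : S) := LinearIndependent.of_comp S.subtype hli
  rcases isEmpty_or_nonempty (Fin k) with hk | hk
  · exact ⟨b₀, fun j => hk.elim j⟩
  · refine ⟨basisOfLinearIndependentOfCardEqFinrank hli' hcard, fun j => ?_⟩
    rw [coe_basisOfLinearIndependentOfCardEqFinrank]

lemma linearIndependent_comp_of_leftInverse {c : Fin k → V →L[ℝ] ℝ} (hc : LinearIndependent ℝ c)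
    {A B : V →L[ℝ] V} (h : ∀ v, B (A v) = v) : LinearIndependent ℝ fun j => (c j).comp B := by
  rw [Fintype.linearIndependent_iff] at hc ⊢
  intro r hr
  refine hc r (ContinuousLinearMap.ext fun v => ?_)
  simpa [sum_apply, h] using DFunLike.congr_fun hr (A v)

/-- The action maps bases of the annihilator to bases. -/
lemma exists_basis_coAct (W : Type*) [NormedAddCommGroup W] [NormedSpace ℝ W]
    {H : Type*} [Group H] [TopologicalSpace H] [ChartedSpace W H]
    [MulAction H M] [ContMDiffSMul 𝓘(ℝ, W) 𝓘(ℝ, V) ∞ H M] (hD : PreservedBy D H) (g : H) (m : M)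
    (b : Module.Basis (Fin k) ℝ (annihilator D.E m)) :
    ∃ b' : Module.Basis (Fin k) ℝ (annihilator D.E (g • m)),
      ∀ j, ((b' j : annihilator D.E (g • m)) : V →L[ℝ] ℝ) =
        coAct g (m := m) ((b j : annihilator D.E m) : V →L[ℝ] ℝ) := by
  let B : V →L[ℝ] V := mfderiv 𝓘(ℝ, V) 𝓘(ℝ, V) (fun x : M => g⁻¹ • x) (g • m)
  have hmem : ∀ j, ((b j : annihilator D.E m) : V →L[ℝ] ℝ).comp B ∈ annihilator D.E (g • m) :=
    fun j v hv => by
      have h : ∀ m', m' = m → ∀ w ∈ D.E m', ((b j : annihilator D.E m) : V →L[ℝ] ℝ) w = 0 := by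
        rintro _ rfl w hw
        exact (b j).2 w hw
      exact h _ (inv_smul_smul g m) _ (hD.map_mem g⁻¹ (g • m) v hv)
  have hli : LinearIndependent ℝ fun j => ((b j : annihilator D.E m) : V →L[ℝ] ℝ).comp B :=
    linearIndependent_comp_of_leftInverse (linearIndependent_coe _ b.linearIndependent)
      (mfderiv_inv_smul_mfderiv_smul W g m)
  obtain ⟨U, α, hU, hα⟩ := D.exists_frame (g • m)
  obtain ⟨b₀, -⟩ := hα.oriented _ hU
  exact exists_basis_of_linearIndependent b₀ hmem hli

/-- Pulling back by g is transport by the cotangent lift of g⁻¹, which is smooth and maps oriented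
bases of E⁰ to oriented bases. -/
lemma IsOrientedFrame.pullFrame (W : Type*) [NormedAddCommGroup W] [NormedSpace ℝ W]
    {H : Type*} [Group H] [TopologicalSpace H] [ChartedSpace W H] [LieGroup 𝓘(ℝ, W) ∞ H]
    [MulAction H M] [ContMDiffSMul 𝓘(ℝ, W) 𝓘(ℝ, V) ∞ H M] (hD : PreservedBy D H) {U : Set M}
    {β : Fin k → ∀ m : M, CoFibre (V := V) M m} (hβ : IsOrientedFrame D.E D.o U β) (g : H) :
    IsOrientedFrame D.E D.o ((fun m : M => g • m) ⁻¹' U) (EqForm.pullFrame g β) := by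
  have hs := contMDiff_smul_left (M := M) (V := V) W g
  refine ⟨hβ.isOpen.preimage hs.continuous, fun j m hm => ?_, fun m hm => ?_⟩
  · have h1 := (contMDiff_cotangentLift_right (V := V) (M := M) W g⁻¹).contMDiffAt.comp m
      (((hβ.smooth j).contMDiffAt (hβ.isOpen.mem_nhds hm)).comp m hs.contMDiffAt)
    refine (h1.congr_of_eventuallyEq (Filter.Eventually.of_forall fun m' => ?_)).contMDiffWithinAt
    exact pullFrame_eq_cotangentLift g β j m'
  · obtain ⟨b, hb, hbo⟩ := hβ.oriented (g • m) hm
    obtain ⟨b', hb'⟩ := exists_basis_coAct W hD g⁻¹ (g • m) b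
    have h1 := hD.orientation g⁻¹ (g • m) b b' hb' hbo
    -- Abstracting the group element and the point permits rewriting `g⁻¹⁻¹` to `g` and `g⁻¹ • g •
    -- m` to `m` in all dependent types at once.
    let P : H → M → Prop := fun h m' => ∃ b : Module.Basis (Fin k) ℝ (annihilator D.E m'),
      (∀ j, ((b j : annihilator D.E m') : V →L[ℝ] ℝ) = (β j (g • m) : V →L[ℝ] ℝ).comp
        (mfderiv 𝓘(ℝ, V) 𝓘(ℝ, V) (fun x : M => h • x) m' : V →L[ℝ] V)) ∧
      Module.Basis.orientation (R := ℝ) (M := annihilator D.E m') b = D.o m'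
    have hP : P g⁻¹⁻¹ (g⁻¹ • g • m) := ⟨b', fun j => (hb' j).trans (by rw [hb j]; rfl), h1⟩
    rw [inv_inv, inv_smul_smul] at hP
    exact hP

end Transport

/-! ### Equivariance of the fibre integral of `e^{iDθ}` -/

section Equivariance

variable {V : Type*} [NormedAddCommGroup V] [NormedSpace ℝ V] [FiniteDimensional ℝ V]
  {M : Type*} [TopologicalSpace M] [ChartedSpace V M] [IsManifold 𝓘(ℝ, V) ∞ M]
  {k : ℕ} {D : CoorientedDistribution V M k}
  {W : Type*} [NormedAddCommGroup W] [NormedSpace ℝ W]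
  {H : Type*} [Group H] [TopologicalSpace H] [ChartedSpace W H] [LieGroup 𝓘(ℝ, W) ∞ H]
  [MulAction H M] [ContMDiffSMul 𝓘(ℝ, W) 𝓘(ℝ, V) ∞ H M]

lemma mfderiv_frameMap_smul (W : Type*) [NormedAddCommGroup W] [NormedSpace ℝ W]
    {H : Type*} [Group H] [TopologicalSpace H] [ChartedSpace W H]
    [MulAction H M] [ContMDiffSMul 𝓘(ℝ, W) 𝓘(ℝ, V) ∞ H M] {U : Set M}
    {β : Fin k → ∀ m : M, CoFibre (V := V) M m} (hβ : IsOrientedFrame D.E D.o U β) (g : H)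
    {x₀ : M} {y : V} (hy : y ∈ (extChartAt 𝓘(ℝ, V) x₀).target)
    (hyU : g • (extChartAt 𝓘(ℝ, V) x₀).symm y ∈ U) (x : Fin k → ℝ) (a : V × (Fin k → ℝ)) :
    (mfderiv ((𝓘(ℝ, V)).prod 𝓘(ℝ, Fin k → ℝ)) (ModelT V) (frameMap β)
        (g • (extChartAt 𝓘(ℝ, V) x₀).symm y, x)
        (((mfderiv 𝓘(ℝ, V) 𝓘(ℝ, V) (fun x : M => g • x) ((extChartAt 𝓘(ℝ, V) x₀).symm y) : V →L[ℝ] V)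
          ((mfderiv 𝓘(ℝ, V) 𝓘(ℝ, V) (extChartAt 𝓘(ℝ, V) x₀).symm y : V →L[ℝ] V) a.1), a.2) :
            V × (Fin k → ℝ)) : V × (V →L[ℝ] ℝ)) =
      mfderiv 𝓘(ℝ, V × (Fin k → ℝ)) (ModelT V)
        (fun z => cotangentLift g (frameChart (pullFrame g β) x₀ z)) (y, x) a := by
  have d1 := ((contMDiffAt_frameMap x fun j => (hβ.smooth j).contMDiffAt
    (hβ.isOpen.mem_nhds hyU)).mdifferentiableAt (by simp)).hasMFDerivAt
  have d0 := ((contMDiff_smul_left (M := M) (V := V) W g).mdifferentiable (by simp)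
    ((extChartAt 𝓘(ℝ, V) x₀).symm y)).hasMFDerivAt
  have d2 : HasMFDerivAt 𝓘(ℝ, V × (Fin k → ℝ)) 𝓘(ℝ, V)
      (fun z : V × (Fin k → ℝ) => (extChartAt 𝓘(ℝ, V) x₀).symm z.1) (y, x)
      ((mfderiv 𝓘(ℝ, V) 𝓘(ℝ, V) (extChartAt 𝓘(ℝ, V) x₀).symm y : V →L[ℝ] V).comp
        (ContinuousLinearMap.fst ℝ V (Fin k → ℝ))) :=
    ((contMDiffAt_chart_symm hy).mdifferentiableAt (by simp)).hasMFDerivAt.comp (y, x)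
      (hasFDerivAt_fst (𝕜 := ℝ) (p := (y, x))).hasMFDerivAt
  have d3 : HasMFDerivAt 𝓘(ℝ, V × (Fin k → ℝ)) 𝓘(ℝ, Fin k → ℝ)
      (fun z : V × (Fin k → ℝ) => z.2) (y, x) (ContinuousLinearMap.snd ℝ V (Fin k → ℝ)) :=
    (hasFDerivAt_snd (𝕜 := ℝ) (p := (y, x))).hasMFDerivAt
  have d := HasMFDerivAt.comp (y, x) d1 ((d0.comp (y, x) d2).prodMk d3)
  have he : (frameMap β ∘ fun z : V × (Fin k → ℝ) =>
      (((fun x : M => g • x) ∘ fun z : V × (Fin k → ℝ) => (extChartAt 𝓘(ℝ, V) x₀).symm z.1) z, z.2)) =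
      fun z => cotangentLift g (frameChart (pullFrame g β) x₀ z) := by
    funext z
    exact frameMap_smul W g β _ _
  rw [he] at d
  exact (DFunLike.congr_fun d.mfderiv a).symm

variable [FiniteDimensional ℝ W] [MeasurableSpace W] [BorelSpace W] (μ : Measure W)
  [μ.IsAddHaarMeasure]

/-- In matching frames the identity holds at each x. The transform scales by |det Ad g| because the
moment map is equivariant, and the exponential of dθ is unchanged because the lift preserves dθ. -/
lemma fibreIntegrand_smul (hD : PreservedBy D H) {U : Set M}
    {β : Fin k → ∀ m : M, CoFibre (V := V) M m} (hβ : IsOrientedFrame D.E D.o U β) (g : H)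
    {φ ψ : 𝓓((⊤ : TopologicalSpace.Opens W), ℂ)} (h : ∀ X, ψ (Ad g X) = φ X) {m : M}
    (hm : g • m ∈ U) (p : ℕ) (v : Fin p → TangentSpace 𝓘(ℝ, V) m) (x : Fin k → ℝ) :
    fibreIntegrand β (expTheta H μ ψ) (g • m) p
        (fun i => mfderiv 𝓘(ℝ, V) 𝓘(ℝ, V) (fun x : M => g • x) m (v i)) x =
      ((|(Ad g : W →L[ℝ] W).det| : ℝ) : ℂ) *
        fibreIntegrand (pullFrame g β) (expTheta H μ φ) m p v x := by
  obtain ⟨x₀, y, hy, rfl⟩ := exists_chart_symm_eq (V := V) m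
  obtain ⟨u, rfl⟩ := exists_mfderiv_chart_symm_eq hy v
  have hβ' := hβ.pullFrame W hD g
  have hG : ∀ᶠ z in 𝓝 (y, x), ContMDiffAt 𝓘(ℝ, V × (Fin k → ℝ)) (ModelT V) ∞
      (frameChart (pullFrame g β) x₀) z := by
    have h1 : ∀ᶠ y' in 𝓝 y, y' ∈ (extChartAt 𝓘(ℝ, V) x₀).target ∧
        (extChartAt 𝓘(ℝ, V) x₀).symm y' ∈ (fun m : M => g • m) ⁻¹' U :=
      (Filter.eventually_mem_set.2 ((isOpen_extChartAt_target x₀).mem_nhds hy)).and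
        ((contMDiffAt_chart_symm hy).continuousAt.preimage_mem_nhds (hβ'.isOpen.mem_nhds hm))
    filter_upwards [(continuousAt_fst (p := (y, x))).eventually h1] with z hz
    exact contMDiffAt_frameChart hz.1 z.2 fun j =>
      (hβ'.smooth j).contMDiffAt (hβ'.isOpen.mem_nhds hz.2)
  have e1 := fibreIntegrand_chart hy x (fun j => (hβ'.smooth j).contMDiffAt
    (hβ'.isOpen.mem_nhds hm)) (expTheta H μ φ) p u
  have e2 := pairing_expD (H := H) μ 1 φ (frameChart (pullFrame g β) x₀ (y, x)) (p + k)
    (fun i => mfderiv 𝓘(ℝ, V × (Fin k → ℝ)) (ModelT V) (frameChart (pullFrame g β) x₀) (y, x)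
          (Fin.append (fun i => ((u i, 0) : V × (Fin k → ℝ)))
            (fun j => ((0, Pi.single j 1) : V × (Fin k → ℝ))) i))
  refine Eq.trans ?_ (congrArg _ (e1.trans e2).symm)
  refine (pairing_expD (H := H) μ 1 ψ (frameMap β (g • (extChartAt 𝓘(ℝ, V) x₀).symm y, x)) (p + k)
    _).trans ?_
  rw [← mul_assoc]
  congr 1
  · refine fhat_comp μ (det_Ad_ne_zero g) h fun X => ?_
    rw [frameMap_smul W]
    exact congrArg (fun r : ℝ => (1 : ℝ) * r) (momentMap_cotangentLift g _ X)
  · refine expTwo_congr fun a b => congrArg (fun r : ℝ => Complex.I * ((1 : ℝ) : ℂ) * (r : ℂ)) ?_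
    have key : ∀ i, (mfderiv ((𝓘(ℝ, V)).prod 𝓘(ℝ, Fin k → ℝ)) (ModelT V) (frameMap β)
        (g • (extChartAt 𝓘(ℝ, V) x₀).symm y, x)
        (Fin.append (fun i => (((mfderiv 𝓘(ℝ, V) 𝓘(ℝ, V) (fun x : M => g • x)
            ((extChartAt 𝓘(ℝ, V) x₀).symm y) : V →L[ℝ] V)
          ((mfderiv 𝓘(ℝ, V) 𝓘(ℝ, V) (extChartAt 𝓘(ℝ, V) x₀).symm y : V →L[ℝ] V) (u i)), 0) :
            V × (Fin k → ℝ))) (fun j => ((0, Pi.single j 1) : V × (Fin k → ℝ))) i) :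
            V × (V →L[ℝ] ℝ)) =
      mfderiv 𝓘(ℝ, V × (Fin k → ℝ)) (ModelT V)
        (fun z => cotangentLift g (frameChart (pullFrame g β) x₀ z)) (y, x)
          (Fin.append (fun i => ((u i, 0) : V × (Fin k → ℝ)))
            (fun j => ((0, Pi.single j 1) : V × (Fin k → ℝ))) i) := fun i => by
      refine Eq.trans ?_ (mfderiv_frameMap_smul W hβ g hy hm x _)
      exact congrArg _ (map_append_single (V := V) (V' := V)
        ((mfderiv 𝓘(ℝ, V) 𝓘(ℝ, V) (fun x : M => g • x) ((extChartAt 𝓘(ℝ, V) x₀).symm y) :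
          V →L[ℝ] V).comp
        (mfderiv 𝓘(ℝ, V) 𝓘(ℝ, V) (extChartAt 𝓘(ℝ, V) x₀).symm y : V →L[ℝ] V)) u i)
    refine Eq.trans ?_ (canTwo_mfderiv_cotangentLift W g hG _ _)
    exact congrArg₂ canTwo (key a) (key b)

/-- For equivariance, the frame chosen at g m is pulled back to m and exchanged for the frame chosen
at m by independence of the oriented frame. -/
theorem isEquivGenForm_fibreIntegral_expTheta (hD : PreservedBy D H)
    (hT : Transverse (W := W) D H) :
    IsEquivGenForm 𝓘(ℝ, V) (fun (g : H) (x : M) => g • x)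
      (fun φ : 𝓓((⊤ : TopologicalSpace.Opens W), ℂ) => D.fibreIntegral (expTheta H μ φ)) where
  smooth φ := isSmoothForm_fibreIntegral_expTheta μ hT φ
  map_add φ ψ := by
    funext m p v
    rw [expTheta_add]
    exact integral_add (integrable_fibreIntegrand_expTheta μ hT φ m p v)
      (integrable_fibreIntegrand_expTheta μ hT ψ m p v)
  map_smul c φ := by
    funext m p v
    rw [expTheta_smul]
    exact integral_const_mul c _
  continuous K hK x₀ L hL hLt p u n := exists_seminorm_fibreIntegral_expTheta μ hT hK x₀ hL hLt p u n
  equivariant g φ ψ h := by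
    funext m p v
    obtain ⟨U, hU, hβ⟩ := D.exists_isOrientedFrame_frameAt (g • m)
    obtain ⟨U', hU', hα⟩ := D.exists_isOrientedFrame_frameAt m
    have h1 : ∫ x, fibreIntegrand (D.frameAt (g • m)) (expTheta H μ ψ) (g • m) p
        (fun i => mfderiv 𝓘(ℝ, V) 𝓘(ℝ, V) (fun x : M => g • x) m (v i)) x =
        ((|(Ad g : W →L[ℝ] W).det| : ℝ) : ℂ) *
          ∫ x, fibreIntegrand (D.frameAt m) (expTheta H μ φ) m p v x := by
      rw [← integral_fibreIntegrand_congr (H := H) μ hα (hβ.pullFrame W hD g) hU' hU φ p v,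
        ← integral_const_mul]
      exact integral_congr_ae (Filter.Eventually.of_forall fun x =>
        fibreIntegrand_smul μ hD hβ g h hU p v x)
    exact h1

end Equivariance

/-! ### Integration along rays -/

section Radial

lemma integrable_inv_one_add_sq : Integrable fun t : ℝ => ((1 + ‖t‖) ^ 2)⁻¹ := by
  have h := integrable_one_add_norm (E := ℝ) (μ := volume) (r := 2) (by norm_num)
  refine h.congr (Filter.Eventually.of_forall fun t => ?_)
  change (1 + ‖t‖) ^ (-2 : ℝ) = ((1 + ‖t‖) ^ 2)⁻¹
  rw [Real.rpow_neg (by positivity)]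
  norm_num

lemma integrableOn_Ioi_of_decay {f : ℝ → ℂ} (hf : Continuous f) {C : ℝ}
    (h : ∀ t, 0 < t → (1 + t) ^ 2 * ‖f t‖ ≤ C) : IntegrableOn f (Set.Ioi 0) := by
  refine (integrable_inv_one_add_sq.const_mul C).integrableOn.mono' hf.aestronglyMeasurable ?_
  refine (ae_restrict_iff' measurableSet_Ioi).2 (Filter.Eventually.of_forall fun t ht => ?_)
  have ht' : (0 : ℝ) < t := ht
  rw [Real.norm_eq_abs, abs_of_pos ht', ← div_eq_mul_inv, le_div_iff₀ (by positivity), mul_comm]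
  exact h t ht'

variable {E : Type*} [NormedAddCommGroup E] [NormedSpace ℝ E] [FiniteDimensional ℝ E]
  [MeasurableSpace E] [BorelSpace E] (ν : Measure E) [ν.IsAddHaarMeasure]
  {n : ℕ} {Φ : E → ℂ} {g : E → ℝ}

omit [FiniteDimensional ℝ E] [MeasurableSpace E] [BorelSpace E] in
lemma hasCompactSupport_fderiv_self (hgc : HasCompactSupport g) :
    HasCompactSupport fun x => fderiv ℝ g x x :=
  (hgc.fderiv ℝ).mono fun x hx h => hx (by simp [h])

omit [MeasurableSpace E] [BorelSpace E] [FiniteDimensional ℝ E] in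
lemma continuous_fderiv_self (hg : ContDiff ℝ 1 g) : Continuous fun x => fderiv ℝ g x x :=
  (hg.continuous_fderiv (by simp)).clm_apply continuous_id

-- The radial derivative of `g` vanishes near 0 and outside a compact set. Where ‖x‖ ≥ r, decay of Φ
-- of order n + 2 pays for tⁿ and leaves (1 + t)⁻², integrable uniformly in x.
omit [FiniteDimensional ℝ E] in
lemma integrable_radial (hΦ : Continuous Φ) {C : ℝ} (hd : ∀ x, (1 + ‖x‖) ^ (n + 2) * ‖Φ x‖ ≤ C)
    (hg : ContDiff ℝ 1 g) (hgc : HasCompactSupport g) (h1 : ∀ᶠ x in 𝓝 0, g x = 1) :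
    Integrable (Function.uncurry fun (x : E) (t : ℝ) =>
      ((fderiv ℝ g x x : ℝ) : ℂ) * ((t : ℂ) ^ n * Φ (t • x)))
      (ν.prod (volume.restrict (Set.Ioi 0))) := by
  obtain ⟨r, hr, hball⟩ := Metric.eventually_nhds_iff_ball.1 h1
  have hc := continuous_fderiv_self hg
  have hzero : ∀ x, ‖x‖ < r → fderiv ℝ g x x = 0 := fun x hx => by
    have : g =ᶠ[𝓝 x] fun _ => 1 := by
      filter_upwards [Metric.isOpen_ball.mem_nhds (show x ∈ Metric.ball (0 : E) r by simpa using hx)]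
        with z hz using hball z hz
    rw [this.fderiv_eq]
    simp
  set ρ := min r 1
  have hρ : 0 < ρ := lt_min hr one_pos
  have hC : 0 ≤ C := (by positivity : 0 ≤ (1 + ‖(0 : E)‖) ^ (n + 2) * ‖Φ 0‖).trans (hd 0)
  have hI := ((hc.integrable_of_hasCompactSupport (μ := ν) (hasCompactSupport_fderiv_self hgc)).norm).mul_prod
    ((integrable_inv_one_add_sq.const_mul (C / ρ ^ (n + 2))).integrableOn (s := Set.Ioi (0 : ℝ)))
  refine hI.mono' ?_ ?_
  · refine Continuous.aestronglyMeasurable ?_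
    change Continuous fun z : E × ℝ => ((fderiv ℝ g z.1 z.1 : ℝ) : ℂ) * ((z.2 : ℂ) ^ n * Φ (z.2 • z.1))
    have hc' := Complex.continuous_ofReal.comp (hc.comp (continuous_fst (X := E) (Y := ℝ)))
    exact hc'.mul (by fun_prop)
  · have hm : ∀ᵐ z : E × ℝ ∂(ν.prod (volume.restrict (Set.Ioi 0))), z.2 ∈ Set.Ioi (0 : ℝ) :=
      Measure.quasiMeasurePreserving_snd.ae (ae_restrict_mem measurableSet_Ioi)
    filter_upwards [hm] with z hz
    obtain ⟨x, t⟩ := z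
    have ht : (0 : ℝ) < t := hz
    simp only [Function.uncurry_apply_pair, norm_mul, Complex.norm_real, norm_pow]
    rcases lt_or_ge ‖x‖ r with hx | hx
    · simp [hzero x hx]
    · refine mul_le_mul_of_nonneg_left ?_ (norm_nonneg _)
      have h2 : ρ * (1 + t) ≤ 1 + ‖t • x‖ := by
        rw [norm_smul, Real.norm_eq_abs, abs_of_pos ht]
        have h3 : ρ ≤ 1 := min_le_right _ _
        have h4 : ρ ≤ ‖x‖ := (min_le_left _ _).trans hx
        nlinarith
      have h5 := pow_le_pow_left₀ (by positivity) h2 (n + 2)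
      have h6 := (mul_le_mul_of_nonneg_right h5 (norm_nonneg (Φ (t • x)))).trans (hd (t • x))
      have h7 : t ^ n ≤ (1 + t) ^ n := pow_le_pow_left₀ ht.le (by linarith) n
      rw [Real.norm_eq_abs, abs_of_pos ht, ← div_eq_mul_inv, le_div_iff₀ (by positivity),
        le_div_iff₀ (by positivity)]
      calc t ^ n * ‖Φ (t • x)‖ * (1 + t) ^ 2 * ρ ^ (n + 2)
          ≤ (1 + t) ^ n * ‖Φ (t • x)‖ * (1 + t) ^ 2 * ρ ^ (n + 2) := by gcongr
        _ = (ρ * (1 + t)) ^ (n + 2) * ‖Φ (t • x)‖ := by rw [mul_pow]; ring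
        _ ≤ C := h6

omit [FiniteDimensional ℝ E] [MeasurableSpace E] [BorelSpace E] in
lemma hasDerivAt_comp_inv_smul (hg : ContDiff ℝ 1 g) (y : E) {t : ℝ} (ht : t ≠ 0) :
    HasDerivAt (fun t : ℝ => g (t⁻¹ • y)) (-(t⁻¹ * fderiv ℝ g (t⁻¹ • y) (t⁻¹ • y))) t := by
  have h1 : HasDerivAt (fun t : ℝ => t⁻¹ • y) ((-(t ^ 2)⁻¹) • y) t := (hasDerivAt_inv ht).smul_const y
  have h2 := ((hg.differentiable (by simp) (t⁻¹ • y)).hasFDerivAt).comp_hasDerivAt t h1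
  refine h2.congr_deriv ?_
  generalize fderiv ℝ g (t⁻¹ • y) = L
  rw [L.map_smul, L.map_smul, smul_eq_mul, smul_eq_mul]
  field_simp

/-- Differentiation under the integral gives -t⁻¹ times the radial derivative of `g` at y/t. The
substitution y = tx in dimension n + 1 contributes tⁿ⁺¹, so tⁿ remains. -/
lemma hasDerivAt_integral_comp_inv_smul (hint : Integrable Φ ν) (hg : ContDiff ℝ 1 g)
    (hgc : HasCompactSupport g) (hn : Module.finrank ℝ E = n + 1) {t : ℝ} (ht : 0 < t) :
    HasDerivAt (fun t : ℝ => ∫ y, ((g (t⁻¹ • y) : ℝ) : ℂ) * Φ y ∂ν)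
      (-∫ x, ((fderiv ℝ g x x : ℝ) : ℂ) * ((t : ℂ) ^ n * Φ (t • x)) ∂ν) t := by
  have hc := continuous_fderiv_self hg
  obtain ⟨B, hB⟩ := hgc.exists_bound_of_continuous hg.continuous
  obtain ⟨B', hB'⟩ := (hasCompactSupport_fderiv_self hgc).exists_bound_of_continuous hc
  have hB0 : 0 ≤ B' := (norm_nonneg _).trans (hB' 0)
  have hm : ∀ t : ℝ, Continuous fun y => ((g (t⁻¹ • y) : ℝ) : ℂ) := fun t =>
    Complex.continuous_ofReal.comp (hg.continuous.comp (by fun_prop))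
  have hm' : Continuous fun y => ((-(t⁻¹ * fderiv ℝ g (t⁻¹ • y) (t⁻¹ • y)) : ℝ) : ℂ) :=
    Complex.continuous_ofReal.comp
      (continuous_const.mul (hc.comp (continuous_const_smul t⁻¹))).neg
  have key := (hasDerivAt_integral_of_dominated_loc_of_deriv_le (μ := ν) (x₀ := t) (s := Set.Ioi (t / 2))
    (F := fun (t : ℝ) (y : E) => ((g (t⁻¹ • y) : ℝ) : ℂ) * Φ y)
    (F' := fun (t : ℝ) (y : E) => ((-(t⁻¹ * fderiv ℝ g (t⁻¹ • y) (t⁻¹ • y)) : ℝ) : ℂ) * Φ y)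
    (bound := fun y => ((t / 2)⁻¹ * B') * ‖Φ y‖) (Ioi_mem_nhds (by linarith))
    (Filter.Eventually.of_forall fun s => (hm s).aestronglyMeasurable.mul hint.1)
    (hint.bdd_mul (hm t).aestronglyMeasurable (Filter.Eventually.of_forall fun y => by
      simpa using hB (t⁻¹ • y)))
    (hm'.aestronglyMeasurable.mul hint.1)
    (Filter.Eventually.of_forall fun y s hs => ?_) (hint.norm.const_mul _)
    (Filter.Eventually.of_forall fun y s hs => ?_)).2
  · refine key.congr_deriv ?_
    have h1 := Measure.integral_comp_smul ν
      (fun y => ((fderiv ℝ g (t⁻¹ • y) (t⁻¹ • y) : ℝ) : ℂ) * Φ y) t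
    simp only [smul_smul, inv_mul_cancel₀ ht.ne', one_smul, hn] at h1
    have h2 : ∀ x, ((fderiv ℝ g x x : ℝ) : ℂ) * ((t : ℂ) ^ n * Φ (t • x)) =
        (t : ℂ) ^ n * (((fderiv ℝ g x x : ℝ) : ℂ) * Φ (t • x)) := fun x => by ring
    have h3 : ∀ y, ((-(t⁻¹ * fderiv ℝ g (t⁻¹ • y) (t⁻¹ • y)) : ℝ) : ℂ) * Φ y =
        (-(t : ℂ)⁻¹) * (((fderiv ℝ g (t⁻¹ • y) (t⁻¹ • y) : ℝ) : ℂ) * Φ y) := fun y => by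
      push_cast
      ring
    simp only [h2, h3, integral_const_mul, h1]
    rw [abs_of_pos (by positivity), Complex.real_smul]
    have ht' : (t : ℂ) ≠ 0 := by exact_mod_cast ht.ne'
    generalize (∫ y, ((fderiv ℝ g (t⁻¹ • y) (t⁻¹ • y) : ℝ) : ℂ) * Φ y ∂ν) = J
    push_cast
    field_simp
    ring
  · have hs' : t / 2 < s := hs
    have hs0 : 0 < s := by linarith
    rw [norm_mul, Complex.norm_real, norm_neg, norm_mul]
    refine mul_le_mul_of_nonneg_right (mul_le_mul ?_ (hB' _) (norm_nonneg _) (by positivity))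
      (norm_nonneg _)
    rw [Real.norm_eq_abs, abs_of_pos (by positivity)]
    exact inv_anti₀ (by positivity) hs'.le
  · have hs' : t / 2 < s := hs
    exact ((hasDerivAt_comp_inv_smul hg y ((by linarith : 0 < s).ne')).ofReal_comp).mul_const (Φ y)

/-- Integration along the rays of the radial derivative of a cutoff function. -/
theorem integral_radial (hn : Module.finrank ℝ E = n + 1) (hΦ : Continuous Φ)
    (hint : Integrable Φ ν) {C : ℝ} (hd : ∀ x, (1 + ‖x‖) ^ (n + 2) * ‖Φ x‖ ≤ C)
    (hg : ContDiff ℝ 1 g) (hgc : HasCompactSupport g) (h1 : ∀ᶠ x in 𝓝 0, g x = 1) :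
    ∫ x, ((fderiv ℝ g x x : ℝ) : ℂ) * (∫ t in Set.Ioi (0 : ℝ), (t : ℂ) ^ n * Φ (t • x)) ∂ν =
      -∫ x, Φ x ∂ν := by
  have hI := integrable_radial ν hΦ hd hg hgc h1
  simp only [← integral_const_mul]
  rw [integral_integral_swap hI]
  obtain ⟨B, hB⟩ := hgc.exists_bound_of_continuous hg.continuous
  -- After Fubini the inner integral is -G'(t), so the outer integral is the limit of G at 0 minus
  -- its limit at infinity, that is, 0 - ∫ Φ.
  let G : ℝ → ℂ := fun t => ∫ y, ((g (t⁻¹ • y) : ℝ) : ℂ) * Φ y ∂ν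
  have hm : ∀ t : ℝ, AEStronglyMeasurable (fun y => ((g (t⁻¹ • y) : ℝ) : ℂ) * Φ y) ν := fun t =>
    (Complex.continuous_ofReal.comp (hg.continuous.comp (by fun_prop))).aestronglyMeasurable.mul hint.1
  have hb : ∀ (t : ℝ) (y : E), ‖((g (t⁻¹ • y) : ℝ) : ℂ) * Φ y‖ ≤ B * ‖Φ y‖ := fun t y => by
    rw [norm_mul, Complex.norm_real]
    exact mul_le_mul_of_nonneg_right (hB _) (norm_nonneg _)
  have hinf : Filter.Tendsto G Filter.atTop (𝓝 (∫ y, Φ y ∂ν)) := by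
    refine tendsto_integral_filter_of_dominated_convergence (fun y => B * ‖Φ y‖)
      (Filter.Eventually.of_forall hm) (Filter.Eventually.of_forall fun t =>
        Filter.Eventually.of_forall (hb t)) (hint.norm.const_mul B)
      (Filter.Eventually.of_forall fun y => ?_)
    have h2 : Filter.Tendsto (fun t : ℝ => t⁻¹ • y) Filter.atTop (𝓝 0) := by
      simpa using (tendsto_inv_atTop_zero (𝕜 := ℝ)).smul_const y
    refine tendsto_const_nhds.congr' ?_
    filter_upwards [h2.eventually h1] with t ht
    rw [ht]
    simp
  -- In positive dimension the point y = 0 is a null set. It must be discarded for the limit at 0,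
  -- since g(y/t) stays equal to 1 there.
  have hE : Nontrivial E := Module.nontrivial_of_finrank_pos (R := ℝ) (by omega)
  have hzero : Filter.Tendsto G (𝓝[>] 0) (𝓝 0) := by
    have h3 : Filter.Tendsto G (𝓝[>] 0) (𝓝 (∫ _ : E, (0 : ℂ) ∂ν)) := by
      refine tendsto_integral_filter_of_dominated_convergence (fun y => B * ‖Φ y‖)
        (Filter.Eventually.of_forall hm) (Filter.Eventually.of_forall fun t =>
          Filter.Eventually.of_forall (hb t)) (hint.norm.const_mul B) ?_
      filter_upwards [compl_mem_ae_iff.2 (measure_singleton (μ := ν) (0 : E))] with y hy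
      have hy' : y ≠ 0 := hy
      have h2 : Filter.Tendsto (fun t : ℝ => ‖t⁻¹ • y‖) (𝓝[>] 0) Filter.atTop := by
        simp only [norm_smul]
        exact (tendsto_norm_atTop_atTop.comp tendsto_inv_nhdsGT_zero).atTop_mul_const
          (norm_pos_iff.2 hy')
      obtain ⟨R, hR⟩ := hgc.isBounded.subset_closedBall 0
      refine tendsto_const_nhds.congr' ?_
      filter_upwards [h2.eventually (Filter.eventually_gt_atTop R)] with t ht
      have : g (t⁻¹ • y) = 0 := by
        by_contra hne
        have := hR (subset_tsupport g hne)
        rw [mem_closedBall_zero_iff] at this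
        linarith
      simp [this]
    simpa using h3
  -- With the convention 0⁻¹ = 0 the value of `G` at 0 is ∫ Φ. It is replaced by the limit 0 to
  -- obtain continuity from the right.
  have hd' : ∀ t ∈ Set.Ioi (0 : ℝ), HasDerivAt (Function.update G 0 0)
      (-∫ x, ((fderiv ℝ g x x : ℝ) : ℂ) * ((t : ℂ) ^ n * Φ (t • x)) ∂ν) t := fun t ht => by
    refine (hasDerivAt_integral_comp_inv_smul ν hint hg hgc hn ht).congr_of_eventuallyEq ?_
    filter_upwards [Ioi_mem_nhds ht] with s hs
    exact Function.update_of_ne (ne_of_gt hs) _ _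
  have hfin := integral_Ioi_of_hasDerivAt_of_tendsto (f := Function.update G 0 0) (a := 0)
    (continuousWithinAt_update_same.2 (by rwa [Set.Ici_sdiff_left])) hd' hI.integral_prod_right.neg
    (hinf.congr' (by
      filter_upwards [Filter.eventually_gt_atTop 0] with s hs
      exact (Function.update_of_ne (ne_of_gt hs) _ _).symm))
  rw [integral_neg, Function.update_self, sub_zero] at hfin
  rw [← hfin, neg_neg]

end Radial

/-! ### Convergence of β(θ), and its product with a 1-form -/

section Forms

variable {V : Type*} [NormedAddCommGroup V] [NormedSpace ℝ V]
  {M : Type*} [TopologicalSpace M] [ChartedSpace V M] [IsManifold 𝓘(ℝ, V) ∞ M]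

/-- The differential of a function on the cotangent bundle. -/
def dFun (χ : Cotangent (V := V) M → ℝ) (ξ : Cotangent (V := V) M) :
    V × (V →L[ℝ] ℝ) →L[ℝ] ℝ :=
  mfderiv (ModelT V) 𝓘(ℝ, ℝ) χ ξ

lemma extD_ofFun {χ : Cotangent (V := V) M → ℝ} (hχ : ContMDiff (ModelT V) 𝓘(ℝ, ℝ) ∞ χ)
    (ξ : Cotangent (V := V) M) :
    extD (ModelT V) (ofFun (ModelT V) fun ζ => (χ ζ : ℂ)) ξ =
      oneForm (T := TangentSpace (ModelT V) ξ)
        (fun v => ((dFun χ ξ v : ℝ) : ℂ)) := by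
  funext p v
  rcases p with _ | _ | p
  · rfl
  · simp only [extD]
    have hd := hχ.mdifferentiable (by simp) ξ
    have h1 : DifferentiableAt ℝ (χ ∘ (extChartAt (ModelT V) ξ).symm) (extChartAt (ModelT V) ξ ξ) := by
      have hs : ContMDiffAt 𝓘(ℝ, V × (V →L[ℝ] ℝ)) (ModelT V) ∞ (extChartAt (ModelT V) ξ).symm
          (extChartAt (ModelT V) ξ ξ) :=
        (contMDiffOn_extChartAt_symm ξ).contMDiffAt (extChartAt_target_mem_nhds (I := ModelT V) ξ)
      exact ((hχ.contMDiffAt.comp _ hs).mdifferentiableAt (by simp)).differentiableAt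
    have h2 : dFun χ ξ =
        fderiv ℝ (χ ∘ (extChartAt (ModelT V) ξ).symm) (extChartAt (ModelT V) ξ ξ) := by
      rw [dFun, hd.mfderiv]
      simp only [writtenInExtChartAt, ModelWithCorners.range_eq_univ, fderivWithin_univ]
      rfl
    have key : ∀ (u : Fin 0 → V × (V →L[ℝ] ℝ)) (w : V × (V →L[ℝ] ℝ)),
        fderiv ℝ (fun y => inChart (ModelT V) (ofFun (ModelT V) fun ζ => (χ ζ : ℂ)) ξ y 0 u)
          (extChartAt (ModelT V) ξ ξ) w =
          ((dFun χ ξ w : ℝ) : ℂ) := fun u w => by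
      rw [h2]
      have h3 := Complex.ofRealCLM.hasFDerivAt.comp (extChartAt (ModelT V) ξ ξ) h1.hasFDerivAt
      exact DFunLike.congr_fun h3.fderiv w
    rw [mfderiv_extChartAt_self, Fin.sum_univ_one]
    erw [key]
    simp [oneForm]
    rfl
  · simp only [extD]
    refine Finset.sum_eq_zero fun i _ => ?_
    have : (fun y => inChart (ModelT V) (ofFun (ModelT V) fun ζ => (χ ζ : ℂ)) ξ y (p + 1)
      (fun j => (mfderiv (ModelT V) 𝓘(ℝ, V × (V →L[ℝ] ℝ)) (extChartAt (ModelT V) ξ) ξ)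
        (v (i.succAbove j)))) = fun _ => 0 := rfl
    erw [this]
    rw [fderiv_fun_const]
    exact mul_zero _

variable {W : Type*} [NormedAddCommGroup W] [NormedSpace ℝ W] [FiniteDimensional ℝ W]
  {H : Type*} [Group H] [TopologicalSpace H] [ChartedSpace W H] [LieGroup 𝓘(ℝ, W) ∞ H]
  [MulAction H M] [ContMDiffSMul 𝓘(ℝ, W) 𝓘(ℝ, V) ∞ H M]
  [MeasurableSpace W] [BorelSpace W] (μ : Measure W) [μ.IsAddHaarMeasure]

/-- On the ray through `f ≠ 0` the transform decreases rapidly in t. Order j + 2 pays for tʲ and for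
integrability at infinity. -/
lemma integrableOn_pow_mul_fhat {φ : W → ℂ} (hφ : ContDiff ℝ ∞ φ) (hc : HasCompactSupport φ)
    {f : W →L[ℝ] ℝ} (hf : f ≠ 0) (j : ℕ) :
    IntegrableOn (fun t : ℝ => (t : ℂ) ^ j * fhat μ φ (t • f)) (Set.Ioi 0) := by
  obtain ⟨C, hC, h⟩ := exists_fhat_decay_one_add μ (tsupport φ) hc 0 (j + 2)
  obtain ⟨b, hb⟩ := exists_iteratedFDeriv_bound hφ hc (j + 2)
  have hcont := (contDiff_fhat μ hφ hc).continuous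
  have hn : 0 < ‖f‖ := norm_pos_iff.2 hf
  set ρ := min ‖f‖ 1
  have hρ : 0 < ρ := lt_min hn one_pos
  refine integrableOn_Ioi_of_decay (C := C * b / ρ ^ (j + 2))
    ((Complex.continuous_ofReal.pow j).mul (hcont.comp (by fun_prop))) fun t ht => ?_
  have h1 := h φ hφ subset_rfl b hb (t • f)
  rw [norm_iteratedFDeriv_zero, norm_smul, Real.norm_eq_abs, abs_of_pos ht] at h1
  have h2 : ρ * (1 + t) ≤ 1 + t * ‖f‖ := by
    have h3 : ρ ≤ 1 := min_le_right _ _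
    have h4 : ρ ≤ ‖f‖ := min_le_left _ _
    nlinarith
  have h5 := (mul_le_mul_of_nonneg_right (pow_le_pow_left₀ (by positivity) h2 (j + 2))
    (norm_nonneg (fhat μ φ (t • f)))).trans h1
  have h7 : t ^ j ≤ (1 + t) ^ j := pow_le_pow_left₀ ht.le (by linarith) j
  rw [norm_mul, norm_pow, Complex.norm_real, Real.norm_eq_abs, abs_of_pos ht,
    le_div_iff₀ (by positivity)]
  calc (1 + t) ^ 2 * (t ^ j * ‖fhat μ φ (t • f)‖) * ρ ^ (j + 2)
      ≤ (1 + t) ^ 2 * ((1 + t) ^ j * ‖fhat μ φ (t • f)‖) * ρ ^ (j + 2) := by gcongr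
    _ = (ρ * (1 + t)) ^ (j + 2) * ‖fhat μ φ (t • f)‖ := by rw [mul_pow]; ring
    _ ≤ C * b := h5

omit [LieGroup 𝓘(ℝ, W) ∞ H] [ContMDiffSMul 𝓘(ℝ, W) 𝓘(ℝ, V) ∞ H M] in
/-- The integral over `t` in `β(θ)` converges away from the zeros of the moment map. -/
theorem integrableOn_pairing_expD (φ : 𝓓((⊤ : TopologicalSpace.Opens W), ℂ))
    {ξ : Cotangent (V := V) M}
    (hξ : momentMap (W := W) (H := H) (ModelT V) cotangentLift canonicalForm ξ ≠ 0) (p : ℕ)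
    (w : Fin p → TangentSpace (ModelT V) ξ) :
    IntegrableOn (fun t : ℝ => pairing (ModelT V) μ
      (expD (H := H) (ModelT V) cotangentLift canonicalForm t) φ ξ p w) (Set.Ioi 0) := by
  have h : ∀ t : ℝ, pairing (ModelT V) μ
      (expD (H := H) (ModelT V) cotangentLift canonicalForm t) φ ξ p w =
      ∑ j ∈ Finset.range (p + 1), (Complex.I ^ j / (j.factorial : ℂ) *
        wedgePow (twoForm (T := V × (V →L[ℝ] ℝ)) fun a b => ((canTwo a b : ℝ) : ℂ)) j p w) *
        ((t : ℂ) ^ j * fhat μ φ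
          (t • momentMap (W := W) (H := H) (ModelT V) cotangentLift canonicalForm ξ)) := fun t => by
    rw [pairing_expD]
    refine (congrArg (fun z : ℂ => _ * z) (expTwo_smul (T := V × (V →L[ℝ] ℝ))
      (fun a b => ((canTwo a b : ℝ) : ℂ)) (Complex.I * (t : ℂ)) (Nat.lt_succ_self p) w)).trans ?_
    rw [Finset.mul_sum]
    refine Finset.sum_congr rfl fun j _ => ?_
    rw [mul_pow]
    ring
  simp only [h]
  exact integrable_finsetSum _ fun j _ =>
    (integrableOn_pow_mul_fhat μ φ.contDiff φ.hasCompactSupport hξ j).const_mul _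

omit [LieGroup 𝓘(ℝ, W) ∞ H] [ContMDiffSMul 𝓘(ℝ, W) 𝓘(ℝ, V) ∞ H M] in
/-- The product of a `1`-form with `β(θ)`, on vectors whose span contains a vector `R` which
satisfies `θ = ι(R) dθ` on this span. -/
lemma wedge_betaForm (φ : 𝓓((⊤ : TopologicalSpace.Opens W), ℂ)) {ξ : Cotangent (V := V) M}
    (hξ : momentMap (W := W) (H := H) (ModelT V) cotangentLift canonicalForm ξ ≠ 0)
    (c : V × (V →L[ℝ] ℝ) →L[ℝ] ℝ) {n : ℕ} (w : Fin n → V × (V →L[ℝ] ℝ)) (r : Fin n → ℝ)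
    (hr : ∀ a, canonicalForm ξ (w a) = ∑ b, r b * canTwo (w b) (w a)) :
    wedge (oneForm (T := TangentSpace (ModelT V) ξ) fun v => ((c v : ℝ) : ℂ))
        (betaForm (H := H) (ModelT V) μ cotangentLift canonicalForm φ ξ) n w =
      -(((∑ b, r b * c (w b) : ℝ)) : ℂ) * ∫ t in Set.Ioi (0 : ℝ), (t : ℂ)⁻¹ *
        pairing (ModelT V) μ (expD (H := H) (ModelT V) cotangentLift canonicalForm t) φ ξ n w := by
  let A : PreForm (TangentSpace (ModelT V) ξ) :=
    (-Complex.I) • ofOneForm (ModelT V) canonicalForm ξ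
  let Q : ℝ → PreForm (TangentSpace (ModelT V) ξ) := fun t =>
    pairing (ModelT V) μ (expD (H := H) (ModelT V) cotangentLift canonicalForm t) φ ξ
  have hQ : ∀ p v, Integrable (fun t => Q t p v) (volume.restrict (Set.Ioi 0)) := fun p v =>
    integrableOn_pairing_expD μ φ hξ p v
  have hAQ : ∀ p v, Integrable (fun t => wedge A (Q t) p v) (volume.restrict (Set.Ioi 0)) :=
    fun p v => by
      simp only [wedge]
      exact integrable_finsetSum _ fun p _ => (integrable_finsetSum _ fun σ _ =>
        ((hQ _ _).const_mul _).const_mul _).const_mul _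
  -- Both wedge products can be taken under the t-integral, because the integrals converge
  -- absolutely away from the zeros of the moment map.
  have h1 : betaForm (H := H) (ModelT V) μ cotangentLift canonicalForm φ ξ =
      fun p v => ∫ t in Set.Ioi (0 : ℝ), wedge A (Q t) p v := by
    funext p v
    exact wedge_integral _ A Q hQ p v
  rw [h1]
  refine (wedge_integral (volume.restrict (Set.Ioi 0)) _ (fun t => wedge A (Q t)) hAQ n w).trans ?_
  rw [← integral_const_mul]
  refine setIntegral_congr_fun measurableSet_Ioi fun t ht => ?_
  have ht0 : (t : ℂ) ≠ 0 := by
    have : t ≠ 0 := ne_of_gt ht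
    exact_mod_cast this
  let cL : V × (V →L[ℝ] ℝ) →ₗ[ℝ] ℂ := Complex.ofRealCLM.toLinearMap ∘ₗ c.toLinearMap
  let θ : V × (V →L[ℝ] ℝ) →L[ℝ] ℝ := canonicalForm ξ
  let θL : V × (V →L[ℝ] ℝ) →ₗ[ℝ] ℂ := Complex.ofRealCLM.toLinearMap ∘ₗ θ.toLinearMap
  let e : PreForm (V × (V →L[ℝ] ℝ)) :=
    expTwo fun a b => Complex.I * t * ((canTwo a b : ℝ) : ℂ)
  -- The algebraic identity is applied with κ = it. Dividing by it and multiplying by the factor -i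
  -- of β gives the coefficient -t⁻¹.
  have h2 := wedge_wedge_expTwo cL θL (canTwoBilin V 1) (fun v => by simp [canTwoBilin, canTwo]) w
    (fun b => (r b : ℂ)) (fun a => by
      simp only [canTwoBilin, LinearMap.mk₂_apply, one_mul]
      change ((canonicalForm ξ (w a) : ℝ) : ℂ) = _
      rw [hr a]
      push_cast
      rfl) (Complex.I * t)
  have h3 : (fun v w => (Complex.I * t) * canTwoBilin V 1 v w) =
      fun a b : V × (V →L[ℝ] ℝ) => Complex.I * t * ((canTwo a b : ℝ) : ℂ) := by
    funext a b
    simp [canTwoBilin]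
  rw [h3] at h2
  have hA : A = fun p v => (-Complex.I) * oneForm (fun v => θL v) p v := by
    funext p v
    change -Complex.I * ofOneForm (ModelT V) canonicalForm ξ p v = _
    refine congrArg _ ?_
    rcases p with _ | _ | p <;> rfl
  have hQe : Q t = fun p v => fhat μ φ
      (t • momentMap (W := W) (H := H) (ModelT V) cotangentLift canonicalForm ξ) * e p v := by
    funext p v
    exact pairing_expD (H := H) μ t φ ξ p v
  have h4 : wedge A (Q t) = fun p v => (-Complex.I * fhat μ φ
      (t • momentMap (W := W) (H := H) (ModelT V) cotangentLift canonicalForm ξ)) *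
      wedge (oneForm (fun v => θL v)) e p v := by
    refine (congrArg₂ wedge hA hQe).trans ?_
    funext p v
    refine (wedge_smul_left (T := V × (V →L[ℝ] ℝ)) _ _ _ p v).trans ?_
    refine (congrArg _ (wedge_smul_right (T := V × (V →L[ℝ] ℝ)) _ _ _ p v)).trans ?_
    rw [mul_assoc]
  have h5 : wedge (oneForm (T := TangentSpace (ModelT V) ξ) fun v => ((c v : ℝ) : ℂ))
      (wedge A (Q t)) n w = (-Complex.I * fhat μ φ
      (t • momentMap (W := W) (H := H) (ModelT V) cotangentLift canonicalForm ξ)) *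
      wedge (oneForm (fun v => cL v)) (wedge (oneForm (fun v => θL v)) e) n w := by
    rw [h4]
    exact wedge_smul_right (T := V × (V →L[ℝ] ℝ)) (oneForm fun v => cL v) _ _ n w
  refine h5.trans ?_
  have h6 : Q t n w = fhat μ φ
      (t • momentMap (W := W) (H := H) (ModelT V) cotangentLift canonicalForm ξ) * e n w :=
    congrFun (congrFun hQe n) w
  change _ = -(((∑ b, r b * c (w b) : ℝ)) : ℂ) * ((t : ℂ)⁻¹ * Q t n w)
  rw [h6]
  have h7 : ((∑ b, r b * c (w b) : ℝ) : ℂ) = ∑ b, (r b : ℂ) * cL (w b) := by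
    push_cast
    rfl
  rw [h7]
  have h8 : Complex.I * t * wedge (oneForm (fun v => cL v)) (wedge (oneForm (fun v => θL v)) e) n w =
    (∑ b, (r b : ℂ) * cL (w b)) * e n w := h2
  generalize wedge (oneForm (fun v => cL v)) (wedge (oneForm (fun v => θL v)) e) n w = X at h8 ⊢
  have h9 : X = -Complex.I * (t : ℂ)⁻¹ * ((∑ b, (r b : ℂ) * cL (w b)) * e n w) := by
    rw [← h8]
    field_simp
    rw [Complex.I_sq]
    ring
  rw [h9]
  linear_combination (fhat μ φ
      (t • momentMap (W := W) (H := H) (ModelT V) cotangentLift canonicalForm ξ) * (t : ℂ)⁻¹ *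
      ((∑ b, (r b : ℂ) * cL (w b)) * e n w)) * Complex.I_sq

end Forms

/-! ### Dilation of the fibres -/

section Scaling

variable {V : Type*} [NormedAddCommGroup V] [NormedSpace ℝ V] {k : ℕ}

/-- The canonical 2-form is homogeneous of degree 1 in the covector components. Absorbing t there
replaces x by tx in the horizontal vectors and scales each of the k fibre vectors by t; undoing the
latter costs tᵏ. -/
lemma frameExp_smul (c : Fin k → V → (V →L[ℝ] ℝ)) (t : ℝ) (y : V) (p : ℕ) (u : Fin p → V)
    (x : Fin k → ℝ) : frameExp c t y p u x = (t : ℂ) ^ k * frameExp c 1 y p u (t • x) := by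
  obtain ⟨A, hA⟩ := isAlt_expTwo_canTwo (V := V) (Complex.I * ((1 : ℝ) : ℂ)) (p + k)
  simp only [frameExp, hA]
  rw [← append_smul, ← hA]
  refine expTwo_congr fun a b => ?_
  have key : ∀ i, Fin.append (fun i => (u i, ∑ j, (t • x) j • fderiv ℝ (c j) y (u i)))
      (fun j => t • ((0, c j y) : V × (V →L[ℝ] ℝ))) i =
      ((frameCoord c y u x i).1, t • (frameCoord c y u x i).2) := fun i => by
    simp only [frameCoord]
    refine Fin.addCases (fun i => ?_) (fun j => ?_) i
    · simp [Fin.append_left, Finset.smul_sum, mul_smul]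
    · simp [Fin.append_right]
  rw [key, key]
  change Complex.I * t * ((canTwo (frameCoord c y u x a) (frameCoord c y u x b) : ℝ) : ℂ) = _
  simp [canTwo]
  ring

end Scaling

/-! ### The fibre integrand of P_θ -/

section Paradan

variable {V : Type*} [NormedAddCommGroup V] [NormedSpace ℝ V]
  {M : Type*} [TopologicalSpace M] [ChartedSpace V M] [IsManifold 𝓘(ℝ, V) ∞ M]
  {k : ℕ} {α : Fin k → ∀ m : M, CoFibre (V := V) M m} {U : Set M} {x₀ : M}

/-- The sum is dχ applied to the image of the Euler vector (0, x), whose coefficients are 0 on the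
base vectors and x on the fibre vectors. -/
lemma sum_dFun_frameChart {χ : Cotangent (V := V) M → ℝ}
    (hχ : ContMDiff (ModelT V) 𝓘(ℝ, ℝ) ∞ χ) {y : V} {x : Fin k → ℝ}
    (hF : ContMDiffAt 𝓘(ℝ, V × (Fin k → ℝ)) (ModelT V) ∞ (frameChart α x₀) (y, x)) {p : ℕ}
    (u : Fin p → V) :
    ∑ b : Fin (p + k), Fin.append (fun _ => (0 : ℝ)) x b *
      dFun χ (frameChart α x₀ (y, x)) (mfderiv 𝓘(ℝ, V × (Fin k → ℝ)) (ModelT V)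
        (frameChart α x₀) (y, x) (frameVec u b)) =
      fderiv ℝ (fun x => χ (frameChart α x₀ (y, x))) x x := by
  let L : V × (Fin k → ℝ) →L[ℝ] ℝ := (dFun χ (frameChart α x₀ (y, x))).comp
    (mfderiv 𝓘(ℝ, V × (Fin k → ℝ)) (ModelT V) (frameChart α x₀) (y, x) :
      V × (Fin k → ℝ) →L[ℝ] V × (V →L[ℝ] ℝ))
  have h1 : HasFDerivAt (fun z => χ (frameChart α x₀ z)) L (y, x) :=
    (HasMFDerivAt.comp (y, x) (hχ.mdifferentiable (by simp) (frameChart α x₀ (y, x))).hasMFDerivAt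
      (hF.mdifferentiableAt (by simp)).hasMFDerivAt).hasFDerivAt
  have h2 : HasFDerivAt (fun x : Fin k → ℝ => χ (frameChart α x₀ (y, x)))
      (L.comp (ContinuousLinearMap.inr ℝ V (Fin k → ℝ))) x :=
    h1.comp x (hasFDerivAt_prodMk_right y x)
  have h3 : ∀ b : Fin (p + k), dFun χ (frameChart α x₀ (y, x)) (mfderiv 𝓘(ℝ, V × (Fin k → ℝ))
      (ModelT V) (frameChart α x₀) (y, x) (frameVec u b)) = L (frameVec u b) := fun b => rfl
  rw [h2.fderiv]
  simp only [h3]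
  rw [Fin.sum_univ_add]
  simp only [frameVec, Fin.append_left, Fin.append_right, zero_mul, Finset.sum_const_zero, zero_add]
  have h4 : ContinuousLinearMap.inr ℝ V (Fin k → ℝ) x =
      ∑ j, x j • ((0, Pi.single j 1) : V × (Fin k → ℝ)) := by
    refine Prod.ext ?_ ?_
    · simp [Prod.fst_sum]
    · simp only [Prod.snd_sum, Prod.smul_snd]
      exact pi_eq_sum_univ' x
  rw [ContinuousLinearMap.comp_apply, h4, map_sum]
  exact Finset.sum_congr rfl fun j _ => (L.map_smul _ _).symm

variable {W : Type*} [NormedAddCommGroup W] [NormedSpace ℝ W] [FiniteDimensional ℝ W]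
  {H : Type*} [Group H] [TopologicalSpace H] [ChartedSpace W H] [LieGroup 𝓘(ℝ, W) ∞ H]
  [MulAction H M] [ContMDiffSMul 𝓘(ℝ, W) 𝓘(ℝ, V) ∞ H M]
  [MeasurableSpace W] [BorelSpace W] (μ : Measure W) [μ.IsAddHaarMeasure]

/-- The Euler vector R lies in the span of the vectors on which the form is evaluated and satisfies
θ = ι(R)dθ there. Hence dχ ∧ β(θ) becomes a radial derivative of χ times an integral along a ray. -/
lemma fibreIntegrand_paradanTheta (hU : IsOpen U)
    (hα : ∀ j, ContMDiffOn 𝓘(ℝ, V) (ModelT V) ∞ (fun m => (⟨m, α j m⟩ : Cotangent (V := V) M)) U)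
    {χ : Cotangent (V := V) M → ℝ} (hχ : ContMDiff (ModelT V) 𝓘(ℝ, ℝ) ∞ χ)
    {y : V} (hy : y ∈ (extChartAt 𝓘(ℝ, V) x₀).target)
    (hyU : (extChartAt 𝓘(ℝ, V) x₀).symm y ∈ U) {x : Fin k → ℝ}
    (hx : ∑ j, x j • frameMoment (W := W) H α ((extChartAt 𝓘(ℝ, V) x₀).symm y) j ≠ 0)
    (φ : 𝓓((⊤ : TopologicalSpace.Opens W), ℂ)) (p : ℕ) (u : Fin p → V) :
    fibreIntegrand α (paradanTheta H μ χ φ) ((extChartAt 𝓘(ℝ, V) x₀).symm y) p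
        (fun i => mfderiv 𝓘(ℝ, V) 𝓘(ℝ, V) (extChartAt 𝓘(ℝ, V) x₀).symm y (u i)) x =
      (∫ X, φ X ∂μ) * (if p + k = 0 then ((χ (frameChart α x₀ (y, x)) : ℝ) : ℂ) else 0) -
        ((fderiv ℝ (fun x => χ (frameChart α x₀ (y, x))) x x : ℝ) : ℂ) *
        ∫ t in Set.Ioi (0 : ℝ), (t : ℂ)⁻¹ *
          (fhat μ φ (t • ∑ j, x j • frameMoment H α ((extChartAt 𝓘(ℝ, V) x₀).symm y) j) *
            frameExp (frameComp α x₀) t y p u x) := by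
  have hF := (eventually_contMDiffAt_frameChart hU hα hy hyU x).self_of_nhds.2
  have hmom : momentMap (W := W) (H := H) (ModelT V) cotangentLift canonicalForm
      (frameChart α x₀ (y, x)) ≠ 0 := by
    refine ne_of_eq_of_ne ?_ hx
    exact momentMap_frameMap α _ x
  have hat : ∀ j, ContMDiffAt 𝓘(ℝ, V) (ModelT V) ∞ (fun m => (⟨m, α j m⟩ : Cotangent (V := V) M))
      ((extChartAt 𝓘(ℝ, V) x₀).symm y) := fun j => (hα j).contMDiffAt (hU.mem_nhds hyU)
  -- The hypothesis θ = ι(R)dθ is checked in coordinates: pairing (0, cⱼ) with a vector gives cⱼ of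
  -- its base component, and the sum with weights xⱼ is θ.
  have hw := wedge_betaForm (H := H) μ φ hmom (dFun χ (frameChart α x₀ (y, x)))
    (fun i : Fin (p + k) => mfderiv 𝓘(ℝ, V × (Fin k → ℝ)) (ModelT V) (frameChart α x₀) (y, x)
      (frameVec u i)) (Fin.append (fun _ => (0 : ℝ)) x) (fun a => by
        rw [canonicalForm_mfderiv_frameChart hU hα hy hyU]
        refine Eq.trans ?_ (Finset.sum_congr rfl fun b _ => congrArg _
          (canTwo_mfderiv_frameChart hU hα hy hyU x u b a).symm)
        rw [Fin.sum_univ_add]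
        simp [frameCoord, canTwo])
  rw [sum_dFun_frameChart hχ hF] at hw
  have hp : ∀ t : ℝ, pairing (ModelT V) μ
      (expD (H := H) (ModelT V) cotangentLift canonicalForm t) φ (frameChart α x₀ (y, x)) (p + k)
      (fun i : Fin (p + k) => mfderiv 𝓘(ℝ, V × (Fin k → ℝ)) (ModelT V) (frameChart α x₀) (y, x)
        (frameVec u i)) =
      fhat μ φ (t • ∑ j, x j • frameMoment H α ((extChartAt 𝓘(ℝ, V) x₀).symm y) j) *
        frameExp (frameComp α x₀) t y p u x := fun t =>
    (fibreIntegrand_chart hy x hat _ p u).symm.trans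
      (fibreIntegrand_pairing (H := H) μ hU hα hy hyU x t φ p u)
  simp only [hp] at hw
  refine (fibreIntegrand_chart hy x hat _ p u).trans ?_
  have h0 : paradanTheta H μ χ φ (frameChart α x₀ (y, x)) =
      (∫ X, φ X ∂μ) • ofFun (ModelT V) (fun ζ => (χ ζ : ℂ)) (frameChart α x₀ (y, x)) +
      wedge (oneForm (T := TangentSpace (ModelT V) (frameChart α x₀ (y, x)))
        fun v => ((dFun χ (frameChart α x₀ (y, x)) v : ℝ) : ℂ))
        (betaForm (H := H) (ModelT V) μ cotangentLift canonicalForm φ (frameChart α x₀ (y, x))) := by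
    rw [← extD_ofFun hχ]
    rfl
  rw [h0, sub_eq_add_neg, ← neg_mul]
  exact congrArg₂ (· + ·) rfl hw

end Paradan

/-! ### The cutoff function on the fibres of the annihilator -/

section Cutoff

variable {V : Type*} [NormedAddCommGroup V] [NormedSpace ℝ V]
  {M : Type*} [TopologicalSpace M] [ChartedSpace V M] [IsManifold 𝓘(ℝ, V) ∞ M]
  {k : ℕ} {D : CoorientedDistribution V M k} {α : Fin k → ∀ m : M, CoFibre (V := V) M m}
  {U : Set M} {x₀ : M}
  {W : Type*} [NormedAddCommGroup W] [NormedSpace ℝ W] [FiniteDimensional ℝ W]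
  {H : Type*} [Group H] [TopologicalSpace H] [ChartedSpace W H] [LieGroup 𝓘(ℝ, W) ∞ H]
  [MulAction H M] [ContMDiffSMul 𝓘(ℝ, W) 𝓘(ℝ, V) ∞ H M]
  {χ : Cotangent (V := V) M → ℝ}

lemma contDiff_cutoff_frameChart (hα : IsOrientedFrame D.E D.o U α)
    (hχ : ContMDiff (ModelT V) 𝓘(ℝ, ℝ) ∞ χ) {y : V}
    (hy : y ∈ (extChartAt 𝓘(ℝ, V) x₀).target) (hyU : (extChartAt 𝓘(ℝ, V) x₀).symm y ∈ U) :
    ContDiff ℝ ∞ fun x => χ (frameChart α x₀ (y, x)) :=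
  contDiff_iff_contDiffAt.2 fun x =>
    ((hχ.contMDiffAt.comp (y, x) (eventually_contMDiffAt_frameChart hα.isOpen hα.smooth hy hyU
      x).self_of_nhds.2).contDiffAt).comp x (contDiff_prodMk_right y).contDiffAt

-- The moment map vanishes on the zero section, where x = 0.
omit [FiniteDimensional ℝ W] in
lemma eventually_cutoff_frameChart_eq_one (hα : IsOrientedFrame D.E D.o U α)
    (hχ : IsCutoff (W := W) D H χ) {y : V} (hy : y ∈ (extChartAt 𝓘(ℝ, V) x₀).target)
    (hyU : (extChartAt 𝓘(ℝ, V) x₀).symm y ∈ U) :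
    ∀ᶠ x in 𝓝 0, χ (frameChart α x₀ (y, x)) = 1 := by
  have h0 : momentMap (W := W) (H := H) (ModelT V) cotangentLift canonicalForm
      (frameChart α x₀ (y, 0)) = 0 := by
    refine (momentMap_frameMap α _ 0).trans ?_
    simp
  have hc : ContinuousAt (fun x => frameChart α x₀ (y, x)) 0 :=
    ContinuousAt.comp (f := fun x : Fin k → ℝ => (y, x)) (g := frameChart α x₀)
      (eventually_contMDiffAt_frameChart hα.isOpen hα.smooth hy hyU 0).self_of_nhds.2.continuousAt
      (by fun_prop)
  exact hc.eventually (hχ.eq_one _ h0)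

-- Properness over the single point m bounds the covector components on the support. Linear
-- independence of the frame converts this into a bound on x.
omit [FiniteDimensional ℝ W] [LieGroup 𝓘(ℝ, W) ∞ H] [ContMDiffSMul 𝓘(ℝ, W) 𝓘(ℝ, V) ∞ H M] in
lemma hasCompactSupport_cutoff_frameChart (hα : IsOrientedFrame D.E D.o U α)
    (hχ : IsCutoff (W := W) D H χ) {y : V} (hy : y ∈ (extChartAt 𝓘(ℝ, V) x₀).target)
    (hyU : (extChartAt 𝓘(ℝ, V) x₀).symm y ∈ U) :
    HasCompactSupport fun x => χ (frameChart α x₀ (y, x)) := by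
  set m := (extChartAt 𝓘(ℝ, V) x₀).symm y
  have hys : (extChartAt 𝓘(ℝ, V) x₀).symm y ∈ (chartAt V x₀).source := by
    simpa using (extChartAt 𝓘(ℝ, V) x₀).map_target hy
  have hs : m ∈ (chartAt V x₀).source := hys
  have hS := hχ.proper {m} isCompact_singleton
  set S := tsupport χ ∩ {ξ : Cotangent (V := V) M | ξ.proj ∈ ({m} : Set M) ∧
      (show V →L[ℝ] ℝ from ξ.2) ∈ annihilator D.E ξ.proj}
  have hq : ContinuousOn (fun ξ : Cotangent (V := V) M => coComp x₀ ξ.proj ξ.2) S := fun ξ hξ =>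
    (((contMDiffAt_cotangent_iff (G := fun ξ : Cotangent (V := V) M => ξ) (z := ξ) (x₀ := x₀)
      (by rw [show ξ.proj = m from hξ.2.1]; exact hs)).1 contMDiffAt_id).2.continuousAt).continuousWithinAt
  obtain ⟨R, hR⟩ := (hS.image_of_continuousOn hq).isBounded.exists_norm_le
  obtain ⟨c, hc, hlow⟩ := exists_one_add_norm_le (a := fun j (_ : V) => frameComp α x₀ j y)
    (Ω := {y}) (L := {y}) (fun j => continuousOn_const)
    (fun _ _ => linearIndependent_frameComp hα hy hyU) subset_rfl isCompact_singleton
  refine HasCompactSupport.intro (isCompact_closedBall 0 (c * (1 + R))) fun x hx => ?_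
  by_contra hne
  refine hx (mem_closedBall_zero_iff.2 ?_)
  obtain ⟨b, hb, -⟩ := hα.oriented m hyU
  have hmem : frameChart α x₀ (y, x) ∈ S := by
    refine ⟨subset_tsupport χ hne, rfl, ?_⟩
    have h1 : ∑ j, x j • ((b j : annihilator D.E m) : V →L[ℝ] ℝ) ∈ annihilator D.E m :=
      Submodule.sum_mem _ fun j _ => Submodule.smul_mem _ _ (b j).2
    simp only [hb] at h1
    exact h1
  have h2 := hR _ ⟨_, hmem, rfl⟩
  have h3 : coComp x₀ (frameChart α x₀ (y, x)).proj (frameChart α x₀ (y, x)).2 =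
    ∑ j, x j • frameComp α x₀ j y := coComp_sum_smul x₀ _ x fun j => α j _
  simp only [h3] at h2
  have h4 := hlow y rfl x
  nlinarith [mul_le_mul_of_nonneg_left h2 hc.le]

variable [MeasurableSpace W] [BorelSpace W] (μ : Measure W) [μ.IsAddHaarMeasure]

/-- The coefficient of `e^{iDθ}` in a chart decreases rapidly along the fibres. -/
lemma exists_decay_fibreIntegrand (hT : Transverse (W := W) D H)
    (hα : IsOrientedFrame D.E D.o U α) {y : V}
    (hy : y ∈ (extChartAt 𝓘(ℝ, V) x₀).target) (hyU : (extChartAt 𝓘(ℝ, V) x₀).symm y ∈ U)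
    (φ : 𝓓((⊤ : TopologicalSpace.Opens W), ℂ)) (p : ℕ) (u : Fin p → V) (R : ℕ) :
    Continuous (fun x => fhat μ φ (∑ j, x j • frameMoment H α ((extChartAt 𝓘(ℝ, V) x₀).symm y) j) *
      frameExp (frameComp α x₀) 1 y p u x) ∧ ∃ C : ℝ, ∀ x, (1 + ‖x‖) ^ R *
      ‖fhat μ φ (∑ j, x j • frameMoment H α ((extChartAt 𝓘(ℝ, V) x₀).symm y) j) *
        frameExp (frameComp α x₀) 1 y p u x‖ ≤ C := by
  let Ω : Set V := (extChartAt 𝓘(ℝ, V) x₀).target ∩ (extChartAt 𝓘(ℝ, V) x₀).symm ⁻¹' U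
  have hΩ : IsOpen Ω := (continuousOn_extChartAt_symm x₀).isOpen_inter_preimage
    (isOpen_extChartAt_target x₀) hα.isOpen
  have hsm : ∀ j, ∀ y ∈ Ω, ContMDiffAt 𝓘(ℝ, V) (ModelT V) ∞
      (fun m => (⟨m, α j m⟩ : Cotangent (V := V) M)) ((extChartAt 𝓘(ℝ, V) x₀).symm y) :=
    fun j y hy => (hα.smooth j).contMDiffAt (hα.isOpen.mem_nhds hy.2)
  have hc : ∀ j, ContDiffOn ℝ ∞ (frameComp α x₀ j) Ω := fun j y hy =>
    (contDiffAt_frameComp hy.1 (hsm j y hy)).contDiffWithinAt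
  let a : Fin k → V → W →L[ℝ] ℝ := fun j y => frameMoment H α ((extChartAt 𝓘(ℝ, V) x₀).symm y) j
  have ha : ∀ j, ContDiffOn ℝ ∞ (a j) Ω := fun j y hy =>
    (contDiffAt_frameMoment hy.1 (hsm j y hy)).contDiffWithinAt
  let P : V × (Fin k → ℝ) → ℂ := fun z => frameExp (frameComp α x₀) 1 z.1 p u z.2
  have hL : ({y} : Set V) ⊆ Ω := by
    rintro _ rfl
    exact ⟨hy, hyU⟩
  have hP : IsModerate Ω {y} P := isModerate_frameExp hΩ hL isCompact_singleton hc 1 p u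
  obtain ⟨N, C, -, h⟩ := exists_oscIntegrand_bound μ hΩ ha
    (fun y hy => linearIndependent_frameMoment hT hα hy.2) hL isCompact_singleton hP 0 R
    (tsupport φ) φ.hasCompactSupport
  obtain ⟨b, hb⟩ := exists_iteratedFDeriv_bound φ.contDiff φ.hasCompactSupport N
  refine ⟨?_, C * b, fun x => ?_⟩
  · refine ((contDiff_fhat μ φ.contDiff φ.hasCompactSupport).continuous.comp (by fun_prop)).mul ?_
    exact hP.1.continuousOn.comp_continuous (f := fun x : Fin k → ℝ => (y, x)) (by fun_prop)
      fun x => ⟨⟨hy, hyU⟩, trivial⟩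
  · have h1 := h φ φ.contDiff subset_rfl b hb y rfl x
    rw [norm_iteratedFDerivWithin_zero, ← div_eq_mul_inv, le_div_iff₀ (by positivity), mul_comm] at h1
    exact h1

omit [FiniteDimensional ℝ W] [LieGroup 𝓘(ℝ, W) ∞ H] [ContMDiffSMul 𝓘(ℝ, W) 𝓘(ℝ, V) ∞ H M]
  [BorelSpace W] [μ.IsAddHaarMeasure] in
lemma paradanTheta_of_eventually_eq_one (hχ : ContMDiff (ModelT V) 𝓘(ℝ, ℝ) ∞ χ)
    {ξ : Cotangent (V := V) M} (h : ∀ᶠ ζ in 𝓝 ξ, χ ζ = 1)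
    (φ : 𝓓((⊤ : TopologicalSpace.Opens W), ℂ)) (p : ℕ) (w : Fin p → TangentSpace (ModelT V) ξ) :
    paradanTheta H μ χ φ ξ p w = if p = 0 then ∫ X, φ X ∂μ else 0 := by
  have hd : dFun χ ξ = 0 := by
    have h1 : χ =ᶠ[𝓝 ξ] fun _ => 1 := h
    rw [dFun, h1.mfderiv_eq, mfderiv_const]
    rfl
  -- Writing dχ = 0 as 0 times itself lets the scalar be pulled out of the wedge product, so the
  -- product vanishes whatever value β has at ξ.
  have h0 : extD (ModelT V) (ofFun (ModelT V) fun ζ => (χ ζ : ℂ)) ξ =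
      fun p (v : Fin p → TangentSpace (ModelT V) ξ) => (0 : ℂ) *
        extD (ModelT V) (ofFun (ModelT V) fun ζ => (χ ζ : ℂ)) ξ p v := by
    rw [extD_ofFun hχ, hd]
    funext p v
    rcases p with _ | _ | p
    · simp [oneForm]
    · simp [oneForm]
      rfl
    · simp [oneForm]
  change (∫ X, φ X ∂μ) * (if p = 0 then ((χ ξ : ℝ) : ℂ) else 0) +
    wedge (extD (ModelT V) (ofFun (ModelT V) fun ζ => (χ ζ : ℂ)) ξ) _ p w = _
  rw [h0, wedge_smul_left, h.self_of_nhds]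
  simp

end Cutoff

/-! ### Comparison of the fibre integrals of P_θ and e^{iDθ} -/

section ParadanIntegral

lemma expTwo_zero {T : Type*} (p : ℕ) (v : Fin p → T) :
    expTwo (fun _ _ : T => (0 : ℂ)) p v = if p = 0 then 1 else 0 := by
  have h := expTwo_smul (fun _ _ : T => (0 : ℂ)) 0 (Nat.lt_succ_self p) v
  simp only [zero_mul] at h
  rw [h, Finset.sum_eq_single 0 (fun j _ hj => by simp [hj]) (by simp)]
  simp [wedgePow, scalarForm]

variable {V : Type*} [NormedAddCommGroup V] [NormedSpace ℝ V] [FiniteDimensional ℝ V]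
  {M : Type*} [TopologicalSpace M] [ChartedSpace V M] [IsManifold 𝓘(ℝ, V) ∞ M]
  {k : ℕ}
  {W : Type*} [NormedAddCommGroup W] [NormedSpace ℝ W] [FiniteDimensional ℝ W]
  {H : Type*} [Group H] [TopologicalSpace H] [ChartedSpace W H] [LieGroup 𝓘(ℝ, W) ∞ H]
  [MulAction H M] [ContMDiffSMul 𝓘(ℝ, W) 𝓘(ℝ, V) ∞ H M]
  {χ : Cotangent (V := V) M → ℝ}
  [MeasurableSpace W] [BorelSpace W] (μ : Measure W) [μ.IsAddHaarMeasure]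

-- The fibre is the single point x = 0 on the zero section. There χ = 1 nearby and the pullback of θ
-- is 0, so both integrands reduce to ∫ φ in degree 0.
omit [FiniteDimensional ℝ V] [FiniteDimensional ℝ W] [BorelSpace W] [μ.IsAddHaarMeasure] in
lemma fibreIntegrand_paradanTheta_of_rank_zero {D : CoorientedDistribution V M 0}
    (hχ : IsCutoff (W := W) D H χ)
    {α : Fin 0 → ∀ m : M, CoFibre (V := V) M m} {U : Set M} (hα : IsOrientedFrame D.E D.o U α)
    {x₀ : M} {y : V} (hy : y ∈ (extChartAt 𝓘(ℝ, V) x₀).target)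
    (hyU : (extChartAt 𝓘(ℝ, V) x₀).symm y ∈ U) (φ : 𝓓((⊤ : TopologicalSpace.Opens W), ℂ)) (p : ℕ)
    (u : Fin p → V) (x : Fin 0 → ℝ) :
    fibreIntegrand α (paradanTheta H μ χ φ) ((extChartAt 𝓘(ℝ, V) x₀).symm y) p
        (fun i => mfderiv 𝓘(ℝ, V) 𝓘(ℝ, V) (extChartAt 𝓘(ℝ, V) x₀).symm y (u i)) x =
      fibreIntegrand α (expTheta H μ φ) ((extChartAt 𝓘(ℝ, V) x₀).symm y) p
        (fun i => mfderiv 𝓘(ℝ, V) 𝓘(ℝ, V) (extChartAt 𝓘(ℝ, V) x₀).symm y (u i)) x := by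
  obtain rfl : x = 0 := Subsingleton.elim _ _
  have h0 : momentMap (W := W) (H := H) (ModelT V) cotangentLift canonicalForm
      (frameChart α x₀ (y, 0)) = 0 := (momentMap_frameMap α _ 0).trans (by simp)
  refine ((fibreIntegrand_chart hy 0 (fun j => j.elim0) _ p u).trans
    (paradanTheta_of_eventually_eq_one μ hχ.smooth (hχ.eq_one _ h0) φ _ _)).trans
    (Eq.trans ?_ (fibreIntegrand_pairing (H := H) μ hα.isOpen hα.smooth hy hyU 0 1 φ p u).symm)
  have h1 : frameExp (frameComp α x₀) 1 y p u 0 = if p + 0 = 0 then 1 else 0 := by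
    rw [← expTwo_zero (p + 0) (frameCoord (frameComp α x₀) y u 0)]
    refine expTwo_congr fun a b => ?_
    have h2 : ∀ i : Fin (p + 0), (frameCoord (frameComp α x₀) y u 0 i).2 = 0 := fun i => by
      simp only [frameCoord]
      refine Fin.addCases (fun i => ?_) (fun j => j.elim0) i
      rw [Fin.append_left]
      simp
    change Complex.I * ((1 : ℝ) : ℂ) * ((canTwo (frameCoord (frameComp α x₀) y u 0 a)
      (frameCoord (frameComp α x₀) y u 0 b) : ℝ) : ℂ) = 0
    rw [canTwo, h2, h2]
    simp
  rw [h1]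
  simp [fhat]

/-- The fibre integral of `P_θ` converges and equals the fibre integral of `e^{iDθ}`. -/
theorem integrable_and_integral_paradanTheta {D : CoorientedDistribution V M k}
    (hT : Transverse (W := W) D H) (hχ : IsCutoff (W := W) D H χ)
    (φ : 𝓓((⊤ : TopologicalSpace.Opens W), ℂ)) (m : M) (p : ℕ)
    (v : Fin p → TangentSpace 𝓘(ℝ, V) m) :
    Integrable (fibreIntegrand (D.frameAt m) (paradanTheta H μ χ φ) m p v) ∧
      ∫ x, fibreIntegrand (D.frameAt m) (paradanTheta H μ χ φ) m p v x =
        ∫ x, fibreIntegrand (D.frameAt m) (expTheta H μ φ) m p v x := by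
  have hint := integrable_fibreIntegrand_expTheta μ hT φ m p v
  obtain ⟨U, hU, hα⟩ := D.exists_isOrientedFrame_frameAt m
  generalize D.frameAt m = α at hint hα ⊢
  obtain ⟨x₀, y, hy, rfl⟩ := exists_chart_symm_eq (V := V) m
  obtain ⟨u, rfl⟩ := exists_mfderiv_chart_symm_eq hy v
  -- The radial argument needs a fibre of positive dimension n + 1; rank 0 is a pointwise identity.
  rcases k with _ | n
  · have h := fibreIntegrand_paradanTheta_of_rank_zero μ hχ hα hy hU φ p u
    exact ⟨hint.congr (Filter.Eventually.of_forall fun x => (h x).symm),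
      integral_congr_ae (Filter.Eventually.of_forall h)⟩
  let Φ : (Fin (n + 1) → ℝ) → ℂ := fun x =>
    fhat μ φ (∑ j, x j • frameMoment H α ((extChartAt 𝓘(ℝ, V) x₀).symm y) j) *
      frameExp (frameComp α x₀) 1 y p u x
  let g : (Fin (n + 1) → ℝ) → ℝ := fun x => χ (frameChart α x₀ (y, x))
  have hΦe : ∀ x, fibreIntegrand α (expTheta H μ φ) ((extChartAt 𝓘(ℝ, V) x₀).symm y) p
      (fun i => mfderiv 𝓘(ℝ, V) 𝓘(ℝ, V) (extChartAt 𝓘(ℝ, V) x₀).symm y (u i)) x = Φ x :=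
    fun x => by
      have h1 := fibreIntegrand_pairing (H := H) μ hα.isOpen hα.smooth hy hU x 1 φ p u
      rw [one_smul] at h1
      exact h1
  have hΦ : Integrable Φ := hint.congr (Filter.Eventually.of_forall hΦe)
  obtain ⟨hΦc, C, hC⟩ := exists_decay_fibreIntegrand μ hT hα hy hU φ p u (n + 2)
  have hg : ContDiff ℝ 1 g := (contDiff_cutoff_frameChart hα hχ.smooth hy hU).of_le (by simp)
  have hgc := hasCompactSupport_cutoff_frameChart hα hχ hy hU
  have hg1 := eventually_cutoff_frameChart_eq_one hα hχ hy hU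
  have hrad := integral_radial volume (n := n) (by simp) hΦc hΦ hC hg hgc hg1
  have hradi := (integrable_radial volume hΦc hC hg hgc hg1).integral_prod_left
  simp only [Function.uncurry_apply_pair, integral_const_mul] at hradi
  -- For x ≠ 0 the moment map does not vanish, by linear independence, so the formula for β applies.
  -- Dilation gives tⁿ⁺¹, which t⁻¹ reduces to tⁿ, and the degree 0 term χ drops out because k is
  -- positive.
  have hP : ∀ x, x ≠ 0 →
      -(((fderiv ℝ g x x : ℝ) : ℂ) * ∫ t in Set.Ioi (0 : ℝ), (t : ℂ) ^ n * Φ (t • x)) =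
      fibreIntegrand α (paradanTheta H μ χ φ) ((extChartAt 𝓘(ℝ, V) x₀).symm y) p
        (fun i => mfderiv 𝓘(ℝ, V) 𝓘(ℝ, V) (extChartAt 𝓘(ℝ, V) x₀).symm y (u i)) x := fun x hx => by
    have hx' : ∑ j, x j • frameMoment (W := W) H α ((extChartAt 𝓘(ℝ, V) x₀).symm y) j ≠ 0 :=
      fun h => hx (funext (Fintype.linearIndependent_iff.1
        (linearIndependent_frameMoment hT hα hU) x h))
    rw [fibreIntegrand_paradanTheta μ hα.isOpen hα.smooth hχ.smooth hy hU hx' φ p u,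
      if_neg (by omega), mul_zero, zero_sub]
    congr 2
    refine setIntegral_congr_fun measurableSet_Ioi fun t ht => ?_
    have ht0 : (t : ℂ) ≠ 0 := by
      have : t ≠ 0 := ne_of_gt ht
      exact_mod_cast this
    change (t : ℂ) ^ n * (fhat μ φ (∑ j, (t • x) j • _) * _) = _
    rw [frameExp_smul _ t]
    simp only [Pi.smul_apply, smul_eq_mul, mul_smul, ← Finset.smul_sum]
    field_simp
    ring
  -- The origin, the only zero of the moment map on the fibre, where β is irrelevant, has measure 0.
  have hae : ∀ᵐ x : Fin (n + 1) → ℝ, x ≠ 0 :=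
    compl_mem_ae_iff.2 (measure_singleton (μ := volume) 0)
  have hae' := hae.mono hP
  refine ⟨hradi.neg.congr hae', ?_⟩
  rw [← integral_congr_ae hae', integral_neg, hrad, neg_neg]
  exact integral_congr_ae (Filter.Eventually.of_forall fun x => (hΦe x).symm)

omit [FiniteDimensional ℝ V] [IsManifold 𝓘(ℝ, V) ∞ M] [FiniteDimensional ℝ W]
  [LieGroup 𝓘(ℝ, W) ∞ H] [ContMDiffSMul 𝓘(ℝ, W) 𝓘(ℝ, V) ∞ H M] [MeasurableSpace W]
  [BorelSpace W] in
lemma IsEquivGenForm.const_smul (c : ℂ)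
    {A : 𝓓((⊤ : TopologicalSpace.Opens W), ℂ) → Form 𝓘(ℝ, V) M}
    (hA : IsEquivGenForm 𝓘(ℝ, V) (fun (g : H) (x : M) => g • x) A) :
    IsEquivGenForm 𝓘(ℝ, V) (fun (g : H) (x : M) => g • x) fun φ => c • A φ where
  smooth φ := by
    obtain ⟨h1, h2⟩ := hA.smooth φ
    refine ⟨fun m p => ?_, fun x₀ p u => (h2 x₀ p u).const_smul c⟩
    obtain ⟨a, ha⟩ := h1 m p
    exact ⟨c • a, fun v => congrArg (c * ·) (ha v)⟩
  map_add φ ψ := by rw [hA.map_add, smul_add]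
  map_smul d φ := by rw [hA.map_smul, smul_comm]
  continuous K hK x₀ L hL hLt p u n := by
    obtain ⟨m, C, h⟩ := hA.continuous K hK x₀ L hL hLt p u n
    refine ⟨m, ‖c‖ * C, fun φ hφ b hb y hy => ?_⟩
    have hs : ContDiffAt ℝ n (fun z => inChart 𝓘(ℝ, V) (A φ) x₀ z p u) y :=
      (((hA.smooth φ).2 x₀ p u).contDiffAt
        ((isOpen_extChartAt_target x₀).mem_nhds (hLt hy))).of_le (by exact_mod_cast le_top)
    have h1 : iteratedFDeriv ℝ n (fun z => inChart 𝓘(ℝ, V) (c • A φ) x₀ z p u) y =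
        c • iteratedFDeriv ℝ n (fun z => inChart 𝓘(ℝ, V) (A φ) x₀ z p u) y :=
      iteratedFDeriv_const_smul_apply (a := c) hs
    rw [h1, norm_smul, mul_assoc]
    exact mul_le_mul_of_nonneg_left (h φ hφ b hb y hy) (norm_nonneg c)
  equivariant g φ ψ h := by
    have h1 : pullback 𝓘(ℝ, V) 𝓘(ℝ, V) (fun x : M => g • x) (c • A ψ) =
        c • pullback 𝓘(ℝ, V) 𝓘(ℝ, V) (fun x : M => g • x) (A ψ) := rfl
    rw [h1, hA.equivariant g φ ψ h, smul_comm]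

end ParadanIntegral

end EqForm

end

theorem mainTheorem4
    {V : Type*} [NormedAddCommGroup V] [NormedSpace ℝ V] [FiniteDimensional ℝ V]
    {M : Type*} [TopologicalSpace M] [ChartedSpace V M] [IsManifold 𝓘(ℝ, V) ∞ M]
    [T2Space M] [SigmaCompactSpace M]
    {W : Type*} [NormedAddCommGroup W] [NormedSpace ℝ W] [FiniteDimensional ℝ W]
    [MeasurableSpace W] [BorelSpace W]
    {H : Type*} [Group H] [TopologicalSpace H] [ChartedSpace W H] [LieGroup 𝓘(ℝ, W) ∞ H]
    [MulAction H M] [ContMDiffSMul 𝓘(ℝ, W) 𝓘(ℝ, V) ∞ H M]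
    (μ : Measure W) [μ.IsAddHaarMeasure]
    {k : ℕ} (D : CoorientedDistribution V M k)
    (hD : PreservedBy D H) (hT : Transverse (W := W) D H)
    (χ : Cotangent (V := V) M → ℝ) (hχ : IsCutoff (W := W) D H χ) :
    -- the integral over `t` in `β(θ)` converges away from the zeros of the moment map
    (∀ (φ : 𝓓((⊤ : TopologicalSpace.Opens W), ℂ)) (ξ : Cotangent (V := V) M),
      momentMap (W := W) (H := H) (ModelT V) cotangentLift canonicalForm ξ ≠ 0 →
      ∀ (p : ℕ) (w : Fin p → TangentSpace (ModelT V) ξ),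
        IntegrableOn (fun t : ℝ => pairing (ModelT V) μ
          (expD (H := H) (ModelT V) cotangentLift canonicalForm t) φ ξ p w) (Set.Ioi 0)) ∧
    -- both integrals over the fibres of the annihilator converge
    (∀ (φ : 𝓓((⊤ : TopologicalSpace.Opens W), ℂ)) (m : M) (p : ℕ)
      (v : Fin p → TangentSpace 𝓘(ℝ, V) m),
        Integrable (fibreIntegrand (D.frameAt m) (paradanTheta H μ χ φ) m p v) ∧
        Integrable (fibreIntegrand (D.frameAt m) (expTheta H μ φ) m p v)) ∧
    -- the results are equivariant forms with generalized coefficients on `M`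
    IsEquivGenForm 𝓘(ℝ, V) (fun (g : H) (x : M) => g • x)
      (fun φ => D.fibreIntegral (paradanTheta H μ χ φ)) ∧
    IsEquivGenForm 𝓘(ℝ, V) (fun (g : H) (x : M) => g • x) (JForm D H μ) ∧
    IsEquivGenForm 𝓘(ℝ, V) (fun (g : H) (x : M) => g • x)
      (fun φ => D.fibreIntegral (expTheta H μ φ)) ∧
    -- and they agree
    (fun φ => D.fibreIntegral (paradanTheta H μ χ φ)) =
      (fun φ => (2 * Real.pi * Complex.I : ℂ) ^ k • JForm D H μ φ) ∧
    (fun φ => (2 * Real.pi * Complex.I : ℂ) ^ k • JForm D H μ φ) =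
      (fun φ => D.fibreIntegral (expTheta H μ φ)) := by
  have hexp := isEquivGenForm_fibreIntegral_expTheta μ hD hT
  have hpar := fun φ m p v => integrable_and_integral_paradanTheta μ hT hχ φ m p v
  have heq : (fun φ => D.fibreIntegral (paradanTheta H μ χ φ)) =
      fun φ => D.fibreIntegral (expTheta H μ φ) := by
    funext φ m p v
    exact (hpar φ m p v).2
  have hpi : (2 * Real.pi * Complex.I : ℂ) ^ k ≠ 0 := pow_ne_zero _ Complex.two_pi_I_ne_zero
  have hJ : (fun φ => (2 * Real.pi * Complex.I : ℂ) ^ k • JForm D H μ φ) =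
      fun φ => D.fibreIntegral (expTheta H μ φ) := by
    funext φ
    rw [JForm, smul_smul, mul_inv_cancel₀ hpi, one_smul]
  refine ⟨fun φ ξ hξ p w => integrableOn_pairing_expD μ φ hξ p w, fun φ m p v =>
    ⟨(hpar φ m p v).1, integrable_fibreIntegrand_expTheta μ hT φ m p v⟩, ?_,
    hexp.const_smul _, hexp, heq.trans hJ.symm, hJ⟩
  -- Smoothness, continuity and equivariance of the fibre integral of P_θ follow from its equality
  -- with that of e^{iDθ}.
  rw [heq]
  exact hexp
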